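/- All 2-categories, 2-functors and 2-adjunctions are strict. A 2-category with finite products is a 2-category $\mathcal D$ with a terminal $0$-cell $1$ and binary products $A\times B$ of $0$-cells, in the 2-categorical sense: $\mathcal D(X,1)$ is the terminal category and the projections induce isomorphisms of categories $\mathcal D(X,A\times B)\cong\mathcal D(X,A)\times\mathcal D(X,B)$, for all $X$. **Monads.** A monad in $\mathcal D$ is $(\mathcal C,S,\eta,\mu)$ with $S:\mathcal C\to\mathcal C$ and 2-cells $\eta:1_{\mathcal C}\Rightarrow S$, $\mu:S^2\Rightarrow S$ satisfying the unit and associativity laws. An oplax morphism of monads $(\mathcal C,S,\eta,\mu)\to(\mathcal C',S',\eta',\mu')$ is a pair $(F,\tau)$ with $F:\mathcal C\to\mathcal C'$ and $\tau:FS\Rightarrow S'F$ such that $\tau\circ F(\eta)=\eta'_F$ and $\tau\circ F(\mu)=\mu'_F\circ S'(\tau)\circ\tau_S$; the composite of $(F,\tau)$ and $(F',\tau')$ is $(F'F,\ \tau'_F\circ F'(\tau))$. A transformation $(F,\tau)\Rightarrow(F',\tau')$ is a 2-cell $\sigma:F\Rightarrow F'$ with $\tau'\circ\sigma_S=S'(\sigma)\circ\tau$.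 These form a 2-category $\mathrm{Mnd}_{op}(\mathcal D)$, and a 2-functor $G$ induces $\mathrm{Mnd}_{op}(G)$. Let $\iota_{\mathcal D}:\mathcal D\to\mathrm{Mnd}_{op}(\mathcal D)$ send a $0$-cell to the identity monad on it. One says that $\mathcal D$ *admits Kleisli objects* if $\iota_{\mathcal D}$ has a left 2-adjoint $\mathcal K_{\mathcal D}:\mathrm{Mnd}_{op}(\mathcal D)\to\mathcal D$. If $G:\mathcal B\to\mathcal D$ is a 2-functor between 2-categories that admit Kleisli objects, $\mathcal B$ has *standard Kleisli objects with respect to* $G$ if the canonical 2-natural transformation $\mathcal K_{\mathcal D}\circ\mathrm{Mnd}_{op}(G)\Rightarrow G\circ\mathcal K_{\mathcal B}$ is a 2-natural isomorphism; its component at a monad $S$ is the transpose under $\mathcal K_{\mathcal D}\dashv\iota_{\mathcal D}$ of the image under $\mathrm{Mnd}_{op}(G)$ of the unit $S\to\iota_{\mathcal B}\mathcal K_{\mathcal B}(S)$. **Monoidal objects.** Let $\mathcal D$ have finite products. A monoidal object in $\mathcal D$ is a $0$-cell $\mathcal C$ with $1$-cells $\otimes:\mathcal C\times\mathcal C\to\mathcal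 C$, $I:1\to\mathcal C$ and invertible 2-cells $\alpha:\otimes\circ(1\times\otimes)\Rightarrow\otimes\circ(\otimes\times1)$, $\lambda:\otimes\circ\langle I,1_{\mathcal C}\rangle\Rightarrow1_{\mathcal C}$, $\rho:\otimes\circ\langle1_{\mathcal C},I\rangle\Rightarrow1_{\mathcal C}$ satisfying the pentagon and triangle equations. A lax monoidal $1$-cell $(F,\varphi,\bar\varphi)$ is a $1$-cell $F:\mathcal C\to\mathcal C'$ with 2-cells $\varphi:\otimes'\circ(F\times F)\Rightarrow F\circ\otimes$ and $\bar\varphi:I'\Rightarrow F\circ I$ (not necessarily invertible) compatible with $\alpha,\alpha'$, with $\rho,\rho'$ and with $\lambda,\lambda'$ in the usual way. A monoidal 2-cell $(F,\varphi,\bar\varphi)\Rightarrow(F',\varphi',\bar\varphi')$ is a 2-cell $\sigma:F\Rightarrow F'$ with $\varphi'\circ\otimes'(\sigma,\sigma)=\sigma_\otimes\circ\varphi$ and $\sigma_I\circ\bar\varphi=\bar\varphi'$. They form a 2-category $\mathrm{Mon}(\mathcal D)$ with a forgetful 2-functor $\mathcal U:\mathrm{Mon}(\mathcal D)\to\mathcal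 D$. **Theorem.** Let $\mathcal D$ be a 2-category with finite products that admits Kleisli objects, with $\mathcal K_{\mathcal D}:\mathrm{Mnd}_{op}(\mathcal D)\to\mathcal D$ preserving finite products of $0$-cells. Then $\mathrm{Mon}(\mathcal D)$ admits Kleisli objects, and these are standard with respect to $\mathcal D$: for every choice of the left 2-adjoint $\mathcal K_{\mathrm{Mon}(\mathcal D)}$ of $\iota_{\mathrm{Mon}(\mathcal D)}$, the canonical 2-natural transformation $$\mathcal K_{\mathcal D}\circ\mathrm{Mnd}_{op}(\mathcal U)\Longrightarrow\mathcal U\circ\mathcal K_{\mathrm{Mon}(\mathcal D)}$$ is a 2-natural isomorphism. -/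

import Mathlib

open CategoryTheory Bicategory

universe w v u w₁ v₁ u₁ w₂ v₂ u₂

namespace TwoCat

section Products

variable {D : Type u} [Bicategory.{w, v} D]

/-- A `0`-cell `T` is terminal in the `2`-categorical sense: every hom-category `D(X, T)` is the
terminal category. -/
structure IsTerminalCell (T : D) : Prop where
  unique_hom : ∀ X : D, Nonempty (Unique (X ⟶ T))
  unique_hom₂ : ∀ {X : D} (f g : X ⟶ T), Nonempty (Unique (f ⟶ g))

/-- `A ← P → B` is a product of `0`-cells in the `2`-categorical sense: composition with `p` and
`q` is an isomorphism of categories `D(X, P) ≅ D(X, A) × D(X, B)`, bijective on `1`-cells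
(first field) and on `2`-cells (second field). -/
structure IsBinaryProduct {A B P : D} (p : P ⟶ A) (q : P ⟶ B) : Prop where
  lift_unique : ∀ {X : D} (f : X ⟶ A) (g : X ⟶ B), ∃! h : X ⟶ P, h ≫ p = f ∧ h ≫ q = g
  lift₂_unique : ∀ {X : D} {h k : X ⟶ P} (σ : h ≫ p ⟶ k ≫ p) (τ : h ≫ q ⟶ k ≫ q),
    ∃! θ : h ⟶ k, θ ▷ p = σ ∧ θ ▷ q = τ

end Products

/-- A `2`-category with (chosen) finite products of `0`-cells. -/
class FiniteProducts (D : Type u) [Bicategory.{w, v} D] where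
  one : D
  isTerminal_one : IsTerminalCell one
  prod : D → D → D
  fst : ∀ A B : D, prod A B ⟶ A
  snd : ∀ A B : D, prod A B ⟶ B
  isBinaryProduct : ∀ A B : D, IsBinaryProduct (fst A B) (snd A B)

/-- A (strict) `2`-functor preserves finite products of `0`-cells: it sends terminal `0`-cells to
terminal `0`-cells and product cones to product cones. -/
structure PreservesFiniteProducts {B : Type u₁} [Bicategory.{w₁, v₁} B] {C : Type u₂}
    [Bicategory.{w₂, v₂} C] (F : StrictPseudofunctor B C) : Prop where
  terminal : ∀ {T : B}, IsTerminalCell T → IsTerminalCell (F.obj T)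
  binaryProduct : ∀ {X Y P : B} {p : P ⟶ X} {q : P ⟶ Y}, IsBinaryProduct p q →
    IsBinaryProduct (F.map p) (F.map q)

section TwoAdjunctions

variable {B : Type u₁} [Bicategory.{w₁, v₁} B] {C : Type u₂} [Bicategory.{w₂, v₂} C]

/-- `2`-natural transformations between `2`-functors. -/
structure TwoNatTrans (F G : StrictPseudofunctor B C) where
  app : ∀ a : B, F.obj a ⟶ G.obj a
  naturality : ∀ {a b : B} (f : a ⟶ b), F.map f ≫ app b = app a ≫ G.map f
  naturality₂ : ∀ {a b : B} {f g : a ⟶ b} (θ : f ⟶ g),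
    F.map₂ θ ▷ app b ≫ eqToHom (naturality g) = eqToHom (naturality f) ≫ app a ◁ G.map₂ θ

/-- `2`-natural isomorphisms between `2`-functors. -/
structure TwoNatIso (F G : StrictPseudofunctor B C) where
  hom : TwoNatTrans F G
  inv : TwoNatTrans G F
  hom_inv : ∀ a : B, hom.app a ≫ inv.app a = 𝟙 (F.obj a)
  inv_hom : ∀ a : B, inv.app a ≫ hom.app a = 𝟙 (G.obj a)

/-- A `2`-adjunction `L ⊣ R`: `2`-natural unit and counit, satisfying the triangle identities
strictly. -/
structure TwoAdjunction (L : StrictPseudofunctor B C) (R : StrictPseudofunctor C B) where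
  unit : TwoNatTrans (StrictPseudofunctor.id B) (L.comp R)
  counit : TwoNatTrans (R.comp L) (StrictPseudofunctor.id C)
  left_triangle : ∀ b : B, L.map (unit.app b) ≫ counit.app (L.obj b) = 𝟙 (L.obj b)
  right_triangle : ∀ c : C, unit.app (R.obj c) ≫ R.map (counit.app c) = 𝟙 (R.obj c)

end TwoAdjunctions

/-! ### Monads and oplax morphisms of monads -/

section Monads

/-- A monad `(C, S, η, μ)` in a `2`-category. -/
structure MndOp (D : Type u) [Bicategory.{w, v} D] where
  C : D
  S : C ⟶ C
  η : 𝟙 C ⟶ S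
  μ : S ≫ S ⟶ S
  η_left : η ▷ S ≫ μ = (λ_ S).hom
  η_right : S ◁ η ≫ μ = (ρ_ S).hom
  μ_assoc : μ ▷ S ≫ μ = (α_ S S S).hom ≫ S ◁ μ ≫ μ

namespace MndOp

variable {D : Type u} [Bicategory.{w, v} D]

/-- Oplax morphisms of monads `(F, τ)`; `S ≫ F` is the composite `F ∘ S`. -/
structure Hom (M N : MndOp D) where
  F : M.C ⟶ N.C
  τ : M.S ≫ F ⟶ F ≫ N.S
  τ_η : (λ_ F).inv ≫ M.η ▷ F ≫ τ = (ρ_ F).inv ≫ F ◁ N.η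
  τ_μ : M.μ ▷ F ≫ τ = (α_ M.S M.S F).hom ≫ M.S ◁ τ ≫ (α_ M.S F N.S).inv ≫ τ ▷ N.S ≫
    (α_ F N.S N.S).hom ≫ F ◁ N.μ

/-- Transformations of oplax morphisms of monads. -/
@[ext]
structure Hom₂ {M N : MndOp D} (f g : Hom M N) where
  σ : f.F ⟶ g.F
  comm : M.S ◁ σ ≫ g.τ = f.τ ≫ σ ▷ N.S

instance {M N : MndOp D} : Category (Hom M N) where
  Hom f g := Hom₂ f g
  id f := ⟨𝟙 _, by simp⟩
  comp s t := ⟨s.σ ≫ t.σ, by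
    rw [whiskerLeft_comp, Category.assoc, t.comm, reassoc_of% s.comm, comp_whiskerRight]⟩

@[ext]
theorem hom₂_ext {M N : MndOp D} {f g : Hom M N} {s t : f ⟶ g} (h : s.σ = t.σ) : s = t :=
  Hom₂.ext h

@[simp] theorem id_σ {M N : MndOp D} (f : Hom M N) : Hom₂.σ (𝟙 f) = 𝟙 f.F := rfl

@[simp] theorem comp_σ {M N : MndOp D} {f g h : Hom M N} (s : f ⟶ g) (t : g ⟶ h) :
    Hom₂.σ (s ≫ t) = s.σ ≫ t.σ := rfl

/-- The identity oplax morphism. -/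
@[simps]
def Hom.id (M : MndOp D) : Hom M M where
  F := 𝟙 M.C
  τ := (ρ_ M.S).hom ≫ (λ_ M.S).inv
  τ_η := by simp
  τ_μ := by simp

/-- Composition of oplax morphisms. -/
@[simps]
def Hom.comp {M N P : MndOp D} (f : Hom M N) (g : Hom N P) : Hom M P where
  F := f.F ≫ g.F
  τ := (α_ M.S f.F g.F).inv ≫ f.τ ▷ g.F ≫ (α_ f.F N.S g.F).hom ≫ f.F ◁ g.τ ≫
    (α_ f.F g.F P.S).inv
  τ_η := by
    calc _ = ((λ_ f.F).inv ≫ M.η ▷ f.F ≫ f.τ) ▷ g.F ≫ (α_ _ _ _).hom ≫ f.F ◁ g.τ ≫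
          (α_ f.F g.F _).inv := by bicategory
      _ = f.F ◁ ((λ_ g.F).inv ≫ N.η ▷ g.F ≫ g.τ) ≫ (α_ f.F g.F _).inv := by
        rw [f.τ_η]; bicategory
      _ = _ := by rw [g.τ_η]; bicategory
  τ_μ := by
    calc _ = (α_ _ _ _).inv ≫ (M.μ ▷ f.F ≫ f.τ) ▷ g.F ≫ (α_ _ _ _).hom ≫ f.F ◁ g.τ ≫
          (α_ f.F g.F _).inv := by bicategory
      _ = (α_ _ _ _).inv ≫ ((α_ M.S M.S f.F).hom ≫ M.S ◁ f.τ ≫ (α_ M.S f.F N.S).inv ≫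
          f.τ ▷ N.S ≫ (α_ f.F N.S N.S).hom) ▷ g.F ≫ (α_ _ _ _).hom ≫
          f.F ◁ (N.μ ▷ g.F ≫ g.τ) ≫ (α_ f.F g.F _).inv := by rw [f.τ_μ]; bicategory
      _ = 𝟙 _ ⊗≫ M.S ◁ f.τ ▷ g.F ⊗≫ (f.τ ▷ (N.S ≫ g.F) ≫ (f.F ≫ N.S) ◁ g.τ) ⊗≫
          f.F ◁ g.τ ▷ P.S ⊗≫ f.F ◁ g.F ◁ P.μ ⊗≫ 𝟙 _ := by rw [g.τ_μ]; bicategory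
      _ = _ := by rw [← whisker_exchange]; bicategory

/-- Invertible transformations from invertible `2`-cells. -/
@[simps]
def isoMk {M N : MndOp D} {f g : Hom M N} (e : f.F ≅ g.F)
    (h : M.S ◁ e.hom ≫ g.τ = f.τ ≫ e.hom ▷ N.S) : f ≅ g where
  hom := ⟨e.hom, h⟩
  inv := ⟨e.inv, by
    rw [← cancel_epi (M.S ◁ e.hom), ← Category.assoc, ← Category.assoc, h]
    simp⟩

/-- Left whiskering. -/
@[simps]
def Hom.whiskerLeft {M N P : MndOp D} (f : Hom M N) {g h : Hom N P} (s : Hom₂ g h) :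
    Hom₂ (f.comp g) (f.comp h) where
  σ := f.F ◁ s.σ
  comm := by
    change M.S ◁ f.F ◁ s.σ ≫ ((α_ M.S f.F h.F).inv ≫ f.τ ▷ h.F ≫ (α_ f.F N.S h.F).hom ≫
      f.F ◁ h.τ ≫ (α_ f.F h.F P.S).inv) = ((α_ M.S f.F g.F).inv ≫ f.τ ▷ g.F ≫
      (α_ f.F N.S g.F).hom ≫ f.F ◁ g.τ ≫ (α_ f.F g.F P.S).inv) ≫ (f.F ◁ s.σ) ▷ P.S
    calc _ = 𝟙 _ ⊗≫ ((M.S ≫ f.F) ◁ s.σ ≫ f.τ ▷ h.F) ⊗≫ f.F ◁ h.τ ⊗≫ 𝟙 _ := by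
          bicategory
      _ = 𝟙 _ ⊗≫ f.τ ▷ g.F ⊗≫ f.F ◁ (N.S ◁ s.σ ≫ h.τ) ⊗≫ 𝟙 _ := by
          rw [whisker_exchange]; bicategory
      _ = _ := by rw [s.comm]; bicategory

/-- Right whiskering. -/
@[simps]
def Hom.whiskerRight {M N P : MndOp D} {f g : Hom M N} (s : Hom₂ f g) (h : Hom N P) :
    Hom₂ (f.comp h) (g.comp h) where
  σ := s.σ ▷ h.F
  comm := by
    change M.S ◁ s.σ ▷ h.F ≫ ((α_ M.S g.F h.F).inv ≫ g.τ ▷ h.F ≫ (α_ g.F N.S h.F).hom ≫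
      g.F ◁ h.τ ≫ (α_ g.F h.F P.S).inv) = ((α_ M.S f.F h.F).inv ≫ f.τ ▷ h.F ≫
      (α_ f.F N.S h.F).hom ≫ f.F ◁ h.τ ≫ (α_ f.F h.F P.S).inv) ≫ (s.σ ▷ h.F) ▷ P.S
    calc _ = (α_ _ _ _).inv ≫ (M.S ◁ s.σ ≫ g.τ) ▷ h.F ≫ (α_ g.F _ h.F).hom ≫ g.F ◁ h.τ ≫
          (α_ g.F h.F _).inv := by bicategory
      _ = 𝟙 _ ⊗≫ f.τ ▷ h.F ⊗≫ (s.σ ▷ (N.S ≫ h.F) ≫ g.F ◁ h.τ) ⊗≫ 𝟙 _ := by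
          rw [s.comm]; bicategory
      _ = _ := by rw [← whisker_exchange]; bicategory

/-- The associator. -/
def Hom.associator {M N P Q : MndOp D} (f : Hom M N) (g : Hom N P) (h : Hom P Q) :
    (f.comp g).comp h ≅ f.comp (g.comp h) :=
  isoMk (α_ f.F g.F h.F) (by
    change M.S ◁ (α_ f.F g.F h.F).hom ≫ ((α_ _ _ _).inv ≫ f.τ ▷ (g.F ≫ h.F) ≫ (α_ _ _ _).hom ≫
        f.F ◁ ((α_ _ _ _).inv ≫ g.τ ▷ h.F ≫ (α_ _ _ _).hom ≫ g.F ◁ h.τ ≫ (α_ _ _ _).inv) ≫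
        (α_ _ _ _).inv) = ((α_ _ _ _).inv ≫ ((α_ _ _ _).inv ≫ f.τ ▷ g.F ≫ (α_ _ _ _).hom ≫
        f.F ◁ g.τ ≫ (α_ _ _ _).inv) ▷ h.F ≫ (α_ _ _ _).hom ≫ (f.F ≫ g.F) ◁ h.τ ≫
        (α_ _ _ _).inv) ≫ (α_ f.F g.F h.F).hom ▷ Q.S
    bicategory)

/-- The left unitor. -/
def Hom.leftUnitor {M N : MndOp D} (f : Hom M N) : (Hom.id M).comp f ≅ f :=
  isoMk (λ_ f.F) (by
    change M.S ◁ (λ_ f.F).hom ≫ f.τ = ((α_ _ _ _).inv ≫ ((ρ_ M.S).hom ≫ (λ_ M.S).inv) ▷ f.F ≫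
      (α_ _ _ _).hom ≫ 𝟙 _ ◁ f.τ ≫ (α_ _ _ _).inv) ≫ (λ_ f.F).hom ▷ N.S
    bicategory)

/-- The right unitor. -/
def Hom.rightUnitor {M N : MndOp D} (f : Hom M N) : f.comp (Hom.id N) ≅ f :=
  isoMk (ρ_ f.F) (by
    change M.S ◁ (ρ_ f.F).hom ≫ f.τ = ((α_ _ _ _).inv ≫ f.τ ▷ 𝟙 _ ≫ (α_ _ _ _).hom ≫
      f.F ◁ ((ρ_ N.S).hom ≫ (λ_ N.S).inv) ≫ (α_ _ _ _).inv) ≫ (ρ_ f.F).hom ▷ N.S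
    bicategory)

/-- The `2`-category of monads, oplax morphisms of monads and their transformations. -/
instance : Bicategory (MndOp D) where
  Hom M N := Hom M N
  id M := Hom.id M
  comp f g := Hom.comp f g
  whiskerLeft f _ _ s := Hom.whiskerLeft f s
  whiskerRight s h := Hom.whiskerRight s h
  associator f g h := Hom.associator f g h
  leftUnitor f := Hom.leftUnitor f
  rightUnitor f := Hom.rightUnitor f
  whiskerLeft_id f g := hom₂_ext (Bicategory.whiskerLeft_id f.F g.F)
  whiskerLeft_comp f _ _ _ (s : Hom₂ _ _) (t : Hom₂ _ _) :=
    hom₂_ext (Bicategory.whiskerLeft_comp f.F s.σ t.σ)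
  id_whiskerLeft (s : Hom₂ _ _) := hom₂_ext (Bicategory.id_whiskerLeft s.σ)
  comp_whiskerLeft f g _ _ (s : Hom₂ _ _) := hom₂_ext (Bicategory.comp_whiskerLeft f.F g.F s.σ)
  id_whiskerRight f g := hom₂_ext (Bicategory.id_whiskerRight f.F g.F)
  comp_whiskerRight (s : Hom₂ _ _) (t : Hom₂ _ _) f :=
    hom₂_ext (Bicategory.comp_whiskerRight s.σ t.σ f.F)
  whiskerRight_id (s : Hom₂ _ _) := hom₂_ext (Bicategory.whiskerRight_id s.σ)
  whiskerRight_comp (s : Hom₂ _ _) f g := hom₂_ext (Bicategory.whiskerRight_comp s.σ f.F g.F)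
  whisker_assoc f _ _ (s : Hom₂ _ _) g := hom₂_ext (Bicategory.whisker_assoc f.F s.σ g.F)
  whisker_exchange (s : Hom₂ _ _) (t : Hom₂ _ _) :=
    hom₂_ext (Bicategory.whisker_exchange s.σ t.σ)
  pentagon f g h i := hom₂_ext (Bicategory.pentagon f.F g.F h.F i.F)
  triangle f g := hom₂_ext (Bicategory.triangle f.F g.F)

theorem eqToHom_σ {M N : MndOp D} {f g : Hom M N} (h : f = g) :
    Hom₂.σ (eqToHom h) = eqToHom (congrArg Hom.F h) := by
  cases h; rfl

theorem hom_ext {M N : MndOp D} {f g : Hom M N} (h : f.F = g.F) (hτ : f.τ ≍ g.τ) : f = g := by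
  cases f; cases g; cases h; cases hτ; rfl

/-- Two oplax morphisms agree if their underlying `1`-cells agree and the identification of these
is a transformation. -/
theorem hom_ext_of_hom₂ {M N : MndOp D} {f g : Hom M N} (s : Hom₂ f g) (h : f.F = g.F)
    (hs : s.σ = eqToHom h) : f = g := by
  apply hom_ext h
  have := s.comm
  rw [hs] at this
  cases f; cases g; cases h; simpa using this.symm

theorem iso_eq_eqToIso {M N : MndOp D} {f g : Hom M N} (e : f ≅ g) (h : f = g)
    (hs : Hom₂.σ e.hom = eqToHom (congrArg Hom.F h)) : e = eqToIso h := by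
  ext
  rw [hs, eqToIso.hom, eqToHom_σ]

instance [Strict D] : Strict (MndOp D) where
  id_comp (f : Hom _ _) := hom_ext_of_hom₂ (Hom.leftUnitor f).hom (Strict.id_comp f.F)
    (congrArg Iso.hom (Strict.leftUnitor_eqToIso f.F))
  comp_id (f : Hom _ _) := hom_ext_of_hom₂ (Hom.rightUnitor f).hom (Strict.comp_id f.F)
    (congrArg Iso.hom (Strict.rightUnitor_eqToIso f.F))
  assoc (f : Hom _ _) (g : Hom _ _) (h : Hom _ _) :=
    hom_ext_of_hom₂ (Hom.associator f g h).hom (Strict.assoc f.F g.F h.F)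
      (congrArg Iso.hom (Strict.associator_eqToIso f.F g.F h.F))
  leftUnitor_eqToIso (f : Hom _ _) := iso_eq_eqToIso (Hom.leftUnitor f) _
    (congrArg Iso.hom (Strict.leftUnitor_eqToIso f.F))
  rightUnitor_eqToIso (f : Hom _ _) := iso_eq_eqToIso (Hom.rightUnitor f) _
    (congrArg Iso.hom (Strict.rightUnitor_eqToIso f.F))
  associator_eqToIso (f : Hom _ _) (g : Hom _ _) (h : Hom _ _) :=
    iso_eq_eqToIso (Hom.associator f g h) _
      (congrArg Iso.hom (Strict.associator_eqToIso f.F g.F h.F))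

end MndOp

section Functoriality

open MndOp

/-- The identity monad on a `0`-cell. -/
def idMonad {B : Type u} [Bicategory.{w, v} B] (X : B) : MndOp B where
  C := X
  S := 𝟙 X
  η := 𝟙 (𝟙 X)
  μ := (λ_ (𝟙 X)).hom
  η_left := by simp
  η_right := by simp [unitors_equal]
  μ_assoc := by simp

/-- A `1`-cell as an oplax morphism of identity monads. -/
def idMonadMap {B : Type u} [Bicategory.{w, v} B] {X Y : B} (f : X ⟶ Y) :
    MndOp.Hom (idMonad X) (idMonad Y) where
  F := f
  τ := (λ_ f).hom ≫ (ρ_ f).inv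
  τ_η := by
    change (λ_ f).inv ≫ 𝟙 (𝟙 X) ▷ f ≫ (λ_ f).hom ≫ (ρ_ f).inv = (ρ_ f).inv ≫ f ◁ 𝟙 (𝟙 Y)
    simp
  τ_μ := by
    change (λ_ (𝟙 X)).hom ▷ f ≫ (λ_ f).hom ≫ (ρ_ f).inv =
      (α_ (𝟙 X) (𝟙 X) f).hom ≫ (𝟙 X) ◁ ((λ_ f).hom ≫ (ρ_ f).inv) ≫ (α_ (𝟙 X) f (𝟙 Y)).inv ≫
        ((λ_ f).hom ≫ (ρ_ f).inv) ▷ (𝟙 Y) ≫ (α_ f (𝟙 Y) (𝟙 Y)).hom ≫ f ◁ (λ_ (𝟙 Y)).hom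
    bicategory

/-- A `2`-cell as a transformation of oplax morphisms of identity monads. -/
def idMonadMap₂ {B : Type u} [Bicategory.{w, v} B] {X Y : B} {f g : X ⟶ Y} (θ : f ⟶ g) :
    Hom₂ (idMonadMap f) (idMonadMap g) where
  σ := θ
  comm := by
    change 𝟙 X ◁ θ ≫ (λ_ g).hom ≫ (ρ_ g).inv = ((λ_ f).hom ≫ (ρ_ f).inv) ≫ θ ▷ 𝟙 Y
    simp

theorem eq_sandwich {B : Type u} [Bicategory.{w, v} B] {M N : MndOp B} {f f' g g' : Hom M N}
    (s : Hom₂ f g) (t : Hom₂ f' g') (p : f = f') (q : g = g') (h : s.σ ≍ t.σ) :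
    (show f ⟶ g from s) = eqToHom p ≫ (show f' ⟶ g' from t) ≫ eqToHom q.symm := by
  cases p; cases q
  cases s; cases t; cases h
  simp

theorem idMonadMap_comp {B : Type u} [Bicategory.{w, v} B] {X Y Z : B} (f : X ⟶ Y) (g : Y ⟶ Z) :
    idMonadMap (f ≫ g) = (idMonadMap f).comp (idMonadMap g) :=
  MndOp.hom_ext rfl (heq_of_eq (by
    change (λ_ (f ≫ g)).hom ≫ (ρ_ (f ≫ g)).inv = (α_ (𝟙 X) f g).inv ≫
      ((λ_ f).hom ≫ (ρ_ f).inv) ▷ g ≫ (α_ f (𝟙 Y) g).hom ≫ f ◁ ((λ_ g).hom ≫ (ρ_ g).inv) ≫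
      (α_ f g (𝟙 Z)).inv
    bicategory))

/-- The embedding `2`-functor `D ⟶ Mnd_op(D)` sending a `0`-cell to its identity monad. -/
def iota (D : Type u) [Bicategory.{w, v} D] [Strict D] : StrictPseudofunctor D (MndOp D) :=
  StrictPseudofunctor.mk''
    { obj := idMonad
      map := idMonadMap
      map₂ := idMonadMap₂
      map₂_id := fun _ => rfl
      map₂_comp := fun _ _ => rfl
      map_id := fun X => MndOp.hom_ext (f := idMonadMap (𝟙 X)) (g := Hom.id (idMonad X)) rfl
        (heq_of_eq (by
          change (λ_ (𝟙 X)).hom ≫ (ρ_ (𝟙 X)).inv = (ρ_ (𝟙 X)).hom ≫ (λ_ (𝟙 X)).inv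
          simp [unitors_equal, unitors_inv_equal]))
      map_comp := idMonadMap_comp
      map₂_whisker_left := fun f g h θ => eq_sandwich (idMonadMap₂ (f ◁ θ))
        ((idMonadMap f).whiskerLeft (idMonadMap₂ θ)) (idMonadMap_comp f g)
        (idMonadMap_comp f h) HEq.rfl
      map₂_whisker_right := fun {_ _ _ f g} θ h => eq_sandwich (idMonadMap₂ (θ ▷ h))
        (Hom.whiskerRight (idMonadMap₂ θ) (idMonadMap h)) (idMonadMap_comp f h)
        (idMonadMap_comp g h) HEq.rfl }

variable {B : Type u₁} [Bicategory.{w₁, v₁} B] {C : Type u₂} [Bicategory.{w₂, v₂} C]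

/-- The image of a monad under a `2`-functor. -/
def mapMonad (G : StrictPseudofunctor B C) (M : MndOp B) : MndOp C where
  C := G.obj M.C
  S := G.map M.S
  η := (G.mapId M.C).inv ≫ G.map₂ M.η
  μ := (G.mapComp M.S M.S).inv ≫ G.map₂ M.μ
  η_left := by
    have := congrArg G.map₂ M.η_left
    simp at this
    simp [this]
  η_right := by
    have := congrArg G.map₂ M.η_right
    simp at this
    simp [this]
  μ_assoc := by
    have := congrArg G.map₂ M.μ_assoc
    simp at this
    simp [this]

theorem map₂_associator_inv_aux (G : StrictPseudofunctor B C) {a b c d : B} (f : a ⟶ b)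
    (g : b ⟶ c) (h : c ⟶ d) : (G.mapComp f (g ≫ h)).inv ≫ G.map₂ (α_ f g h).inv ≫
      (G.mapComp (f ≫ g) h).hom = G.map f ◁ (G.mapComp g h).hom ≫
      (α_ (G.map f) (G.map g) (G.map h)).inv ≫ (G.mapComp f g).inv ▷ G.map h := by
  rw [Iso.inv_comp_eq, Pseudofunctor.mapComp_assoc_right_hom_assoc]
  simp

/-- The image of an oplax morphism of monads under a `2`-functor. -/
def mapMonadHom (G : StrictPseudofunctor B C) {M N : MndOp B} (f : MndOp.Hom M N) :
    MndOp.Hom (mapMonad G M) (mapMonad G N) where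
  F := G.map f.F
  τ := (G.mapComp M.S f.F).inv ≫ G.map₂ f.τ ≫ (G.mapComp f.F N.S).hom
  τ_η := by
    change (λ_ _).inv ≫ ((G.mapId M.C).inv ≫ G.map₂ M.η) ▷ G.map f.F ≫
      (G.mapComp M.S f.F).inv ≫ G.map₂ f.τ ≫ (G.mapComp f.F N.S).hom = (ρ_ _).inv ≫
      G.map f.F ◁ ((G.mapId N.C).inv ≫ G.map₂ N.η)
    have := congrArg G.map₂ f.τ_η
    simp at this
    simp [Pseudofunctor.whiskerRight_mapId_inv_assoc, Pseudofunctor.whiskerLeft_mapId_inv_assoc,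
      reassoc_of% this]
  τ_μ := by
    change ((G.mapComp M.S M.S).inv ≫ G.map₂ M.μ) ▷ G.map f.F ≫ (G.mapComp M.S f.F).inv ≫
      G.map₂ f.τ ≫ (G.mapComp f.F N.S).hom = (α_ (G.map M.S) (G.map M.S) (G.map f.F)).hom ≫
      G.map M.S ◁ ((G.mapComp M.S f.F).inv ≫ G.map₂ f.τ ≫ (G.mapComp f.F N.S).hom) ≫
      (α_ _ _ _).inv ≫ ((G.mapComp M.S f.F).inv ≫ G.map₂ f.τ ≫ (G.mapComp f.F N.S).hom) ▷
      G.map N.S ≫ (α_ _ _ _).hom ≫ G.map f.F ◁ ((G.mapComp N.S N.S).inv ≫ G.map₂ N.μ)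
    have := congrArg G.map₂ f.τ_μ
    simp at this
    simp [reassoc_of% this, reassoc_of% (map₂_associator_inv_aux G M.S f.F N.S)]

/-- The image of a transformation of oplax morphisms under a `2`-functor. -/
def mapMonadHom₂ (G : StrictPseudofunctor B C) {M N : MndOp B} {f g : MndOp.Hom M N}
    (s : Hom₂ f g) : Hom₂ (mapMonadHom G f) (mapMonadHom G g) where
  σ := G.map₂ s.σ
  comm := by
    change G.map M.S ◁ G.map₂ s.σ ≫ (G.mapComp M.S g.F).inv ≫ G.map₂ g.τ ≫
      (G.mapComp g.F N.S).hom = ((G.mapComp M.S f.F).inv ≫ G.map₂ f.τ ≫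
      (G.mapComp f.F N.S).hom) ≫ G.map₂ s.σ ▷ G.map N.S
    have := congrArg G.map₂ s.comm
    simp at this
    rw [← cancel_epi (G.mapComp M.S f.F).hom]
    simp [reassoc_of% this]

/-- `mapMonadHom` preserves identities. -/
def mapMonadId (G : StrictPseudofunctor B C) (M : MndOp B) :
    Hom₂ (mapMonadHom G (Hom.id M)) (Hom.id (mapMonad G M)) where
  σ := (G.mapId M.C).hom
  comm := by
    change G.map M.S ◁ (G.mapId M.C).hom ≫ (ρ_ (G.map M.S)).hom ≫ (λ_ (G.map M.S)).inv =
      ((G.mapComp M.S (𝟙 M.C)).inv ≫ G.map₂ ((ρ_ M.S).hom ≫ (λ_ M.S).inv) ≫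
      (G.mapComp (𝟙 M.C) M.S).hom) ≫ (G.mapId M.C).hom ▷ G.map M.S
    have h : G.map₂ (λ_ M.S).inv ≫ (G.mapComp (𝟙 M.C) M.S).hom ≫
        (G.mapId M.C).hom ▷ G.map M.S = (λ_ (G.map M.S)).inv := by
      rw [← cancel_mono (λ_ (G.map M.S)).hom, Category.assoc, Category.assoc,
        ← G.map₂_left_unitor, ← G.map₂_comp, Iso.inv_hom_id, Iso.inv_hom_id, G.map₂_id]
    simp [h]

/-- `mapMonadHom` preserves composition. -/
def mapMonadComp (G : StrictPseudofunctor B C) {M N P : MndOp B} (f : MndOp.Hom M N)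
    (g : MndOp.Hom N P) :
    Hom₂ (mapMonadHom G (f.comp g)) ((mapMonadHom G f).comp (mapMonadHom G g)) where
  σ := (G.mapComp f.F g.F).hom
  comm := by
    change G.map M.S ◁ (G.mapComp f.F g.F).hom ≫ ((α_ (G.map M.S) (G.map f.F) (G.map g.F)).inv ≫
        ((G.mapComp M.S f.F).inv ≫ G.map₂ f.τ ≫ (G.mapComp f.F N.S).hom) ▷ G.map g.F ≫
        (α_ (G.map f.F) (G.map N.S) (G.map g.F)).hom ≫ G.map f.F ◁ ((G.mapComp N.S g.F).inv ≫
        G.map₂ g.τ ≫ (G.mapComp g.F P.S).hom) ≫ (α_ (G.map f.F) (G.map g.F) (G.map P.S)).inv) =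
      ((G.mapComp M.S (f.F ≫ g.F)).inv ≫ G.map₂ ((α_ M.S f.F g.F).inv ≫ f.τ ▷ g.F ≫
        (α_ f.F N.S g.F).hom ≫ f.F ◁ g.τ ≫ (α_ f.F g.F P.S).inv) ≫
        (G.mapComp (f.F ≫ g.F) P.S).hom) ≫ (G.mapComp f.F g.F).hom ▷ G.map P.S
    simp [reassoc_of% (map₂_associator_inv_aux G M.S f.F g.F),
      reassoc_of% (map₂_associator_inv_aux G f.F g.F P.S)]

theorem mapMonadHom_comp (G : StrictPseudofunctor B C) {M N P : MndOp B} (f : MndOp.Hom M N)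
    (g : MndOp.Hom N P) :
    mapMonadHom G (f.comp g) = (mapMonadHom G f).comp (mapMonadHom G g) :=
  hom_ext_of_hom₂ (mapMonadComp G f g) (G.map_comp f.F g.F)
    (congrArg Iso.hom (G.mapComp_eq_eqToIso f.F g.F))

/-- The `2`-functor `Mnd_op(G) : Mnd_op(B) ⟶ Mnd_op(C)` induced by a `2`-functor `G : B ⟶ C`. -/
def mapMndOp [Strict B] [Strict C] (G : StrictPseudofunctor B C) :
    StrictPseudofunctor (MndOp B) (MndOp C) :=
  StrictPseudofunctor.mk''
    { obj := mapMonad G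
      map := mapMonadHom G
      map₂ := mapMonadHom₂ G
      map₂_id := fun f => hom₂_ext (G.map₂_id (Hom.F f))
      map₂_comp := fun s t => hom₂_ext (G.map₂_comp (Hom₂.σ s) (Hom₂.σ t))
      map_id := fun M => hom_ext_of_hom₂ (mapMonadId G M) (G.map_id M.C)
        (congrArg Iso.hom (G.mapId_eq_eqToIso M.C))
      map_comp := mapMonadHom_comp G
      map₂_whisker_left := fun f g h s => eq_sandwich (mapMonadHom₂ G (Hom.whiskerLeft f s))
        ((mapMonadHom G f).whiskerLeft (mapMonadHom₂ G s)) (mapMonadHom_comp G f g)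
        (mapMonadHom_comp G f h) (by
          change G.map₂ (Hom.F f ◁ Hom₂.σ s) ≍ G.map (Hom.F f) ◁ G.map₂ (Hom₂.σ s)
          simp [G.map₂_whisker_left, G.mapComp_eq_eqToIso])
      map₂_whisker_right := fun {_ _ _ f g} s h => eq_sandwich
        (mapMonadHom₂ G (Hom.whiskerRight s h))
        (Hom.whiskerRight (mapMonadHom₂ G s) (mapMonadHom G h)) (mapMonadHom_comp G f h)
        (mapMonadHom_comp G g h) (by
          change G.map₂ (Hom₂.σ s ▷ Hom.F h) ≍ G.map₂ (Hom₂.σ s) ▷ G.map (Hom.F h)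
          simp [G.map₂_whisker_right, G.mapComp_eq_eqToIso]) }

end Functoriality

section Kleisli

/-- A `2`-category admits Kleisli objects if `D ⟶ Mnd_op(D)` has a left `2`-adjoint. -/
def AdmitsKleisli (D : Type u) [Bicategory.{w, v} D] [Strict D] : Prop :=
  ∃ K : StrictPseudofunctor (MndOp D) D, Nonempty (TwoAdjunction K (iota D))

variable {B : Type u₁} [Bicategory.{w₁, v₁} B] [Strict B] {C : Type u₂} [Bicategory.{w₂, v₂} C]
  [Strict C]

/-- The canonical identification of the image under `G` of the identity monad on `X` with the
identity monad on `G X`; its underlying `1`-cell is an identity. -/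
def mapIdMonad (G : StrictPseudofunctor B C) (X : B) :
    MndOp.Hom (mapMonad G (idMonad X)) (idMonad (G.obj X)) where
  F := 𝟙 (G.obj X)
  τ := (ρ_ (G.map (𝟙 X))).hom ≫ (G.mapId X).hom ≫ (λ_ (𝟙 (G.obj X))).inv
  τ_η := by
    change (λ_ (𝟙 (G.obj X))).inv ≫ ((G.mapId X).inv ≫ G.map₂ (𝟙 (𝟙 X))) ▷ 𝟙 (G.obj X) ≫
      (ρ_ (G.map (𝟙 X))).hom ≫ (G.mapId X).hom ≫ (λ_ (𝟙 (G.obj X))).inv =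
      (ρ_ (𝟙 (G.obj X))).inv ≫ 𝟙 (G.obj X) ◁ 𝟙 (𝟙 (G.obj X))
    simp [unitors_inv_equal]
  τ_μ := by
    change ((G.mapComp (𝟙 X) (𝟙 X)).inv ≫ G.map₂ (λ_ (𝟙 X)).hom) ▷ 𝟙 (G.obj X) ≫
      (ρ_ (G.map (𝟙 X))).hom ≫ (G.mapId X).hom ≫ (λ_ (𝟙 (G.obj X))).inv =
      (α_ (G.map (𝟙 X)) (G.map (𝟙 X)) (𝟙 (G.obj X))).hom ≫ G.map (𝟙 X) ◁
      ((ρ_ (G.map (𝟙 X))).hom ≫ (G.mapId X).hom ≫ (λ_ (𝟙 (G.obj X))).inv) ≫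
      (α_ (G.map (𝟙 X)) (𝟙 (G.obj X)) (𝟙 (G.obj X))).inv ≫
      ((ρ_ (G.map (𝟙 X))).hom ≫ (G.mapId X).hom ≫ (λ_ (𝟙 (G.obj X))).inv) ▷ 𝟙 (G.obj X) ≫
      (α_ (𝟙 (G.obj X)) (𝟙 (G.obj X)) (𝟙 (G.obj X))).hom ≫
      𝟙 (G.obj X) ◁ (λ_ (𝟙 (G.obj X))).hom
    have h : (G.mapComp (𝟙 X) (𝟙 X)).inv ≫ G.map₂ (λ_ (𝟙 X)).hom =
        (G.mapId X).hom ▷ G.map (𝟙 X) ≫ (λ_ (G.map (𝟙 X))).hom := by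
      rw [Iso.inv_comp_eq, G.map₂_left_unitor]
    rw [h]
    generalize (G.mapId X).hom = e
    calc _ = 𝟙 _ ⊗≫ (e ▷ G.map (𝟙 X) ≫ 𝟙 _ ◁ e) ⊗≫ 𝟙 _ := by bicategory
      _ = _ := by rw [← whisker_exchange]; bicategory

/-- For a `2`-functor `G : B ⟶ C` between `2`-categories that admit Kleisli objects, the component
`K_C (Mnd_op(G) M) ⟶ G (K_B M)` of the canonical `2`-natural transformation. It is the transpose,
under `K_C ⊣ ι`, of the image under `Mnd_op(G)` of the unit `M ⟶ ι (K_B M)`. -/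
def kleisliComparison (G : StrictPseudofunctor B C) {KB : StrictPseudofunctor (MndOp B) B}
    (adjB : TwoAdjunction KB (iota B)) {KC : StrictPseudofunctor (MndOp C) C}
    (adjC : TwoAdjunction KC (iota C)) (M : MndOp B) :
    KC.obj ((mapMndOp G).obj M) ⟶ G.obj (KB.obj M) :=
  KC.map ((mapMonadHom G (adjB.unit.app M)).comp (mapIdMonad G (KB.obj M))) ≫
    adjC.counit.app (G.obj (KB.obj M))

/-- `B` has standard Kleisli objects with respect to `G : B ⟶ C`: the canonical transformation
`K_C ∘ Mnd_op(G) ⟶ G ∘ K_B` is a `2`-natural isomorphism. -/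
def StandardKleisli (G : StrictPseudofunctor B C) {KB : StrictPseudofunctor (MndOp B) B}
    (adjB : TwoAdjunction KB (iota B)) {KC : StrictPseudofunctor (MndOp C) C}
    (adjC : TwoAdjunction KC (iota C)) : Prop :=
  ∃ θ : TwoNatIso ((mapMndOp G).comp KC) (KB.comp G),
    ∀ M : MndOp B, θ.hom.app M = kleisliComparison G adjB adjC M

end Kleisli

end Monads

section HEqLemmas

variable {D : Type u} [Bicategory.{w, v} D]

theorem comp_heq {a b : D} {f g h f' g' h' : a ⟶ b} (hf : f = f') (hg : g = g') (hh : h = h')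
    {σ : f ⟶ g} {τ : g ⟶ h} {σ' : f' ⟶ g'} {τ' : g' ⟶ h'} (hσ : σ ≍ σ') (hτ : τ ≍ τ') :
    σ ≫ τ ≍ σ' ≫ τ' := by
  cases hf; cases hg; cases hh; cases hσ; cases hτ; rfl

theorem whiskerLeft_heq {a b c : D} {f f' : a ⟶ b} {g h g' h' : b ⟶ c} (hf : f = f')
    (hg : g = g') (hh : h = h') {σ : g ⟶ h} {σ' : g' ⟶ h'} (hσ : σ ≍ σ') :
    f ◁ σ ≍ f' ◁ σ' := by
  cases hf; cases hg; cases hh; cases hσ; rfl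

theorem whiskerRight_heq {a b c : D} {f g f' g' : a ⟶ b} {h h' : b ⟶ c} (hf : f = f')
    (hg : g = g') (hh : h = h') {σ : f ⟶ g} {σ' : f' ⟶ g'} (hσ : σ ≍ σ') :
    σ ▷ h ≍ σ' ▷ h' := by
  cases hf; cases hg; cases hh; cases hσ; rfl

theorem id_heq {a b : D} {f g : a ⟶ b} (h : f = g) : 𝟙 f ≍ 𝟙 g := by cases h; rfl

theorem conj_heq {a b : D} {f g f' g' : a ⟶ b} (p : f' = f) (σ : f ⟶ g) (q : g = g') :
    eqToHom p ≫ σ ≫ eqToHom q ≍ σ := by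
  cases p; cases q; simp

theorem comp_eqToHom_eqToHom_heq {a b : D} {f g h k : a ⟶ b} (σ : f ⟶ g) (p : g = h) (q : h = k) :
    σ ≫ eqToHom p ≫ eqToHom q ≍ σ := by
  cases p; cases q; simp

theorem eqToHom_eqToHom_comp_heq {a b : D} {f g h k : a ⟶ b} (p : f = g) (q : g = h) (σ : h ⟶ k) :
    eqToHom p ≫ eqToHom q ≫ σ ≍ σ := by
  cases p; cases q; simp

theorem eqToHom_heq {a b : D} {f g f' g' : a ⟶ b} (p : f = g) (q : f' = g') (h : f = f') :
    eqToHom p ≍ eqToHom q := by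
  cases p; cases q; cases h; rfl

theorem conj_comp_heq {a b : D} {f g h f' h' : a ⟶ b} (p : f' = f) (σ : f ⟶ g) (τ : g ⟶ h)
    (q : h = h') : eqToHom p ≫ σ ≫ τ ≫ eqToHom q ≍ σ ≫ τ := by
  cases p; cases q; simp

theorem id_comp_heq {a b : D} {f f' g : a ⟶ b} (p : f = f') (σ : f' ⟶ g) {τ : f ⟶ f'}
    (h : τ = eqToHom p) : τ ≫ σ ≍ σ := by
  cases p; subst h; simp

theorem comp_id_heq {a b : D} {f g g' : a ⟶ b} (p : g = g') (σ : f ⟶ g) {τ : g ⟶ g'}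
    (h : τ = eqToHom p) : σ ≫ τ ≍ σ := by
  cases p; subst h; simp

variable [Strict D]

theorem comp_whiskerLeft_heq {a b c d : D} (f : a ⟶ b) (g : b ⟶ c) {h k : c ⟶ d} (σ : h ⟶ k) :
    (f ≫ g) ◁ σ ≍ f ◁ g ◁ σ := by
  simp [Strict.associator_eqToIso]

theorem whiskerRight_comp_heq {a b c d : D} {f g : a ⟶ b} (σ : f ⟶ g) (h : b ⟶ c) (k : c ⟶ d) :
    σ ▷ (h ≫ k) ≍ σ ▷ h ▷ k := by
  simp [Strict.associator_eqToIso]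

theorem whisker_assoc_heq {a b c d : D} (f : a ⟶ b) {g h : b ⟶ c} (σ : g ⟶ h) (k : c ⟶ d) :
    (f ◁ σ) ▷ k ≍ f ◁ σ ▷ k := by
  simp [Strict.associator_eqToIso]

theorem id_whiskerLeft_heq {a b : D} {f g : a ⟶ b} (σ : f ⟶ g) : 𝟙 a ◁ σ ≍ σ := by
  simp [Strict.leftUnitor_eqToIso]

theorem whiskerRight_id_heq {a b : D} {f g : a ⟶ b} (σ : f ⟶ g) : σ ▷ 𝟙 b ≍ σ := by
  simp [Strict.rightUnitor_eqToIso]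

end HEqLemmas

/-! ### Monoidal objects and lax monoidal `1`-cells -/

section MonoidalObjects

namespace FiniteProducts

variable {D : Type u} [Bicategory.{w, v} D] [FiniteProducts D]

/-- The pairing `⟨f, g⟩` of `1`-cells. -/
noncomputable def lift {X A B : D} (f : X ⟶ A) (g : X ⟶ B) : X ⟶ prod A B :=
  ((isBinaryProduct A B).lift_unique f g).choose

theorem lift_fst {X A B : D} (f : X ⟶ A) (g : X ⟶ B) : lift f g ≫ fst A B = f :=
  ((isBinaryProduct A B).lift_unique f g).choose_spec.1.1

theorem lift_snd {X A B : D} (f : X ⟶ A) (g : X ⟶ B) : lift f g ≫ snd A B = g :=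
  ((isBinaryProduct A B).lift_unique f g).choose_spec.1.2

theorem hom_ext {X A B : D} {h k : X ⟶ prod A B} (h₁ : h ≫ fst A B = k ≫ fst A B)
    (h₂ : h ≫ snd A B = k ≫ snd A B) : h = k :=
  ((isBinaryProduct A B).lift_unique (k ≫ fst A B) (k ≫ snd A B)).unique ⟨h₁, h₂⟩ ⟨rfl, rfl⟩

theorem hom₂_ext {X A B : D} {h k : X ⟶ prod A B} {θ θ' : h ⟶ k}
    (h₁ : θ ▷ fst A B = θ' ▷ fst A B) (h₂ : θ ▷ snd A B = θ' ▷ snd A B) : θ = θ' :=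
  ((isBinaryProduct A B).lift₂_unique (θ' ▷ fst A B) (θ' ▷ snd A B)).unique
    ⟨h₁, h₂⟩ ⟨rfl, rfl⟩

theorem hom₂_heq {X A B : D} {h k h' k' : X ⟶ prod A B} (p : h = h') (q : k = k') {θ : h ⟶ k}
    {θ' : h' ⟶ k'} (h₁ : θ ▷ fst A B ≍ θ' ▷ fst A B) (h₂ : θ ▷ snd A B ≍ θ' ▷ snd A B) :
    θ ≍ θ' := by
  cases p; cases q
  exact heq_of_eq (hom₂_ext (eq_of_heq h₁) (eq_of_heq h₂))

/-- The pairing `⟨σ, τ⟩` of `2`-cells. -/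
noncomputable def lift₂ {X A B : D} {f f' : X ⟶ A} {g g' : X ⟶ B} (σ : f ⟶ f') (τ : g ⟶ g') :
    lift f g ⟶ lift f' g' :=
  ((isBinaryProduct A B).lift₂_unique
    (eqToHom (lift_fst f g) ≫ σ ≫ eqToHom (lift_fst f' g').symm)
    (eqToHom (lift_snd f g) ≫ τ ≫ eqToHom (lift_snd f' g').symm)).choose

theorem lift₂_fst {X A B : D} {f f' : X ⟶ A} {g g' : X ⟶ B} (σ : f ⟶ f') (τ : g ⟶ g') :
    lift₂ σ τ ▷ fst A B ≍ σ := by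
  rw [lift₂, ((isBinaryProduct A B).lift₂_unique _ _).choose_spec.1.1]
  exact conj_heq _ _ _

theorem lift₂_snd {X A B : D} {f f' : X ⟶ A} {g g' : X ⟶ B} (σ : f ⟶ f') (τ : g ⟶ g') :
    lift₂ σ τ ▷ snd A B ≍ τ := by
  rw [lift₂, ((isBinaryProduct A B).lift₂_unique _ _).choose_spec.1.2]
  exact conj_heq _ _ _

theorem lift₂_id {X A B : D} (f : X ⟶ A) (g : X ⟶ B) : lift₂ (𝟙 f) (𝟙 g) = 𝟙 (lift f g) := by
  apply hom₂_ext
  · rw [id_whiskerRight]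
    exact eq_of_heq ((lift₂_fst _ _).trans (id_heq (lift_fst f g).symm))
  · rw [id_whiskerRight]
    exact eq_of_heq ((lift₂_snd _ _).trans (id_heq (lift_snd f g).symm))

theorem lift₂_comp {X A B : D} {f f' f'' : X ⟶ A} {g g' g'' : X ⟶ B} (σ : f ⟶ f')
    (σ' : f' ⟶ f'') (τ : g ⟶ g') (τ' : g' ⟶ g'') :
    lift₂ (σ ≫ σ') (τ ≫ τ') = lift₂ σ τ ≫ lift₂ σ' τ' := by
  apply hom₂_ext
  · rw [comp_whiskerRight]
    exact eq_of_heq ((lift₂_fst _ _).trans (comp_heq (lift_fst _ _) (lift_fst _ _) (lift_fst _ _)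
      (lift₂_fst _ _) (lift₂_fst _ _)).symm)
  · rw [comp_whiskerRight]
    exact eq_of_heq ((lift₂_snd _ _).trans (comp_heq (lift_snd _ _) (lift_snd _ _) (lift_snd _ _)
      (lift₂_snd _ _) (lift₂_snd _ _)).symm)

/-- The `1`-cell to the terminal `0`-cell. -/
noncomputable def bang (X : D) : X ⟶ one :=
  (isTerminal_one.unique_hom X).some.default

theorem bang_ext {X : D} (f g : X ⟶ one) : f = g := by
  have := (isTerminal_one.unique_hom X).some
  exact Subsingleton.elim f g

variable [Strict D]

theorem comp_lift {X Y A B : D} (h : X ⟶ Y) (f : Y ⟶ A) (g : Y ⟶ B) :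
    h ≫ lift f g = lift (h ≫ f) (h ≫ g) :=
  hom_ext (by rw [Strict.assoc, lift_fst, lift_fst]) (by rw [Strict.assoc, lift_snd, lift_snd])

theorem whiskerLeft_lift₂ {X Y A B : D} (h : X ⟶ Y) {f f' : Y ⟶ A} {g g' : Y ⟶ B} (σ : f ⟶ f')
    (τ : g ⟶ g') : h ◁ lift₂ σ τ ≍ lift₂ (h ◁ σ) (h ◁ τ) :=
  hom₂_heq (comp_lift _ _ _) (comp_lift _ _ _)
    ((whisker_assoc_heq _ _ _).trans ((whiskerLeft_heq rfl (lift_fst _ _) (lift_fst _ _)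
      (lift₂_fst _ _)).trans (lift₂_fst _ _).symm))
    ((whisker_assoc_heq _ _ _).trans ((whiskerLeft_heq rfl (lift_snd _ _) (lift_snd _ _)
      (lift₂_snd _ _)).trans (lift₂_snd _ _).symm))

theorem whiskerRight_lift {X Y A B : D} {h k : X ⟶ Y} (θ : h ⟶ k) (f : Y ⟶ A) (g : Y ⟶ B) :
    θ ▷ lift f g ≍ lift₂ (θ ▷ f) (θ ▷ g) :=
  hom₂_heq (comp_lift _ _ _) (comp_lift _ _ _)
    ((whiskerRight_comp_heq _ _ _).symm.trans ((whiskerRight_heq rfl rfl (lift_fst _ _)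
      HEq.rfl).trans (lift₂_fst _ _).symm))
    ((whiskerRight_comp_heq _ _ _).symm.trans ((whiskerRight_heq rfl rfl (lift_snd _ _)
      HEq.rfl).trans (lift₂_snd _ _).symm))

end FiniteProducts

open FiniteProducts

section Tensor

variable {D : Type u} [Bicategory.{w, v} D] [FiniteProducts D]

/-- For `t : C × C ⟶ C` and generalized elements `a b : X ⟶ C`, the element `t ∘ ⟨a, b⟩`. -/
noncomputable def tens {C X : D} (t : prod C C ⟶ C) (a b : X ⟶ C) : X ⟶ C := lift a b ≫ t

/-- The action of `t` on `2`-cells between generalized elements, `t ∘ ⟨σ, τ⟩`. -/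
noncomputable def tens₂ {C X : D} (t : prod C C ⟶ C) {a b a' b' : X ⟶ C} (σ : a ⟶ a')
    (τ : b ⟶ b') : tens t a b ⟶ tens t a' b' :=
  lift₂ σ τ ▷ t

theorem tens₂_id {C X : D} (t : prod C C ⟶ C) (a b : X ⟶ C) :
    tens₂ t (𝟙 a) (𝟙 b) = 𝟙 (tens t a b) := by
  rw [tens₂, lift₂_id, id_whiskerRight]; rfl

theorem tens₂_comp {C X : D} (t : prod C C ⟶ C) {a b a' b' a'' b'' : X ⟶ C} (σ : a ⟶ a')
    (σ' : a' ⟶ a'') (τ : b ⟶ b') (τ' : b' ⟶ b'') :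
    tens₂ t (σ ≫ σ') (τ ≫ τ') = tens₂ t σ τ ≫ tens₂ t σ' τ' := by
  rw [tens₂, lift₂_comp, comp_whiskerRight]; rfl

theorem tens₂_heq {C X : D} (t : prod C C ⟶ C) {a b a' b' c d c' d' : X ⟶ C} (ha : a = c)
    (hb : b = d) (ha' : a' = c') (hb' : b' = d') {σ : a ⟶ a'} {τ : b ⟶ b'} {σ' : c ⟶ c'}
    {τ' : d ⟶ d'} (hσ : σ ≍ σ') (hτ : τ ≍ τ') : tens₂ t σ τ ≍ tens₂ t σ' τ' := by
  cases ha; cases hb; cases ha'; cases hb'; cases hσ; cases hτ; rfl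

variable [Strict D]

theorem comp_tens {C X Y : D} (t : prod C C ⟶ C) (h : Y ⟶ X) (a b : X ⟶ C) :
    h ≫ tens t a b = tens t (h ≫ a) (h ≫ b) := by
  rw [tens, tens, ← comp_lift, Strict.assoc]

theorem whiskerLeft_tens₂ {C X Y : D} (t : prod C C ⟶ C) (h : Y ⟶ X) {a b a' b' : X ⟶ C}
    (σ : a ⟶ a') (τ : b ⟶ b') : h ◁ tens₂ t σ τ ≍ tens₂ t (h ◁ σ) (h ◁ τ) :=
  (whisker_assoc_heq _ _ _).symm.trans
    (whiskerRight_heq (comp_lift _ _ _) (comp_lift _ _ _) rfl (whiskerLeft_lift₂ _ _ _))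

theorem whiskerRight_tens {C X Y : D} (t : prod C C ⟶ C) {h k : Y ⟶ X} (θ : h ⟶ k)
    (a b : X ⟶ C) : θ ▷ tens t a b ≍ tens₂ t (θ ▷ a) (θ ▷ b) :=
  (whiskerRight_comp_heq _ _ _).trans
    (whiskerRight_heq (comp_lift _ _ _) (comp_lift _ _ _) rfl (whiskerRight_lift _ _ _))

end Tensor

/-- The data of a tensor product, a unit and constraint `2`-cells on a `0`-cell of a `2`-category
with finite products. The associativity constraint
`α : ⊗ ∘ (1 × ⊗) ⟶ ⊗ ∘ (⊗ × 1)` is an invertible `2`-cell on `C × (C × C)`, whose `1`-cells are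
written with the three projections. -/
structure MonoidalData (D : Type u) [Bicategory.{w, v} D] [FiniteProducts D] where
  C : D
  ten : prod C C ⟶ C
  unit : one ⟶ C
  assoc : tens ten (fst C (prod C C)) (tens ten (snd C (prod C C) ≫ fst C C)
      (snd C (prod C C) ≫ snd C C)) ≅
    tens ten (tens ten (fst C (prod C C)) (snd C (prod C C) ≫ fst C C))
      (snd C (prod C C) ≫ snd C C)
  left : tens ten (bang C ≫ unit) (𝟙 C) ≅ 𝟙 C
  right : tens ten (𝟙 C) (bang C ≫ unit) ≅ 𝟙 C

namespace MonoidalData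

variable {D : Type u} [Bicategory.{w, v} D] [Strict D] [FiniteProducts D] (M : MonoidalData D)

/-- The unit as a generalized element `X ⟶ 1 ⟶ C`. -/
noncomputable def unitAt (X : D) : X ⟶ M.C := bang X ≫ M.unit

theorem comp_unitAt {X Y : D} (h : X ⟶ Y) : h ≫ M.unitAt Y = M.unitAt X := by
  rw [unitAt, ← Strict.assoc, bang_ext (h ≫ bang Y) (bang X), unitAt]

theorem assocAt_dom {X : D} (a b c : X ⟶ M.C) :
    lift a (lift b c) ≫ tens M.ten (fst M.C (prod M.C M.C)) (tens M.ten
      (snd M.C (prod M.C M.C) ≫ fst M.C M.C) (snd M.C (prod M.C M.C) ≫ snd M.C M.C)) =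
      tens M.ten a (tens M.ten b c) := by
  simp only [comp_tens, ← Strict.assoc, lift_fst, lift_snd]

theorem assocAt_cod {X : D} (a b c : X ⟶ M.C) :
    lift a (lift b c) ≫ tens M.ten (tens M.ten (fst M.C (prod M.C M.C))
      (snd M.C (prod M.C M.C) ≫ fst M.C M.C)) (snd M.C (prod M.C M.C) ≫ snd M.C M.C) =
      tens M.ten (tens M.ten a b) c := by
  simp only [comp_tens, ← Strict.assoc, lift_fst, lift_snd]

/-- The associativity constraint at generalized elements, `α_{⟨a, b, c⟩}`. -/
noncomputable def assocAt {X : D} (a b c : X ⟶ M.C) :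
    tens M.ten a (tens M.ten b c) ⟶ tens M.ten (tens M.ten a b) c :=
  eqToHom (M.assocAt_dom a b c).symm ≫ lift a (lift b c) ◁ M.assoc.hom ≫
    eqToHom (M.assocAt_cod a b c)

theorem leftAt_dom {X : D} (a : X ⟶ M.C) :
    a ≫ tens M.ten (bang M.C ≫ M.unit) (𝟙 M.C) = tens M.ten (M.unitAt X) a := by
  rw [comp_tens, Strict.comp_id, ← unitAt, comp_unitAt]

theorem rightAt_dom {X : D} (a : X ⟶ M.C) :
    a ≫ tens M.ten (𝟙 M.C) (bang M.C ≫ M.unit) = tens M.ten a (M.unitAt X) := by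
  rw [comp_tens, Strict.comp_id, ← unitAt, comp_unitAt]

/-- The left unit constraint at a generalized element, `λ_a`. -/
noncomputable def leftAt {X : D} (a : X ⟶ M.C) : tens M.ten (M.unitAt X) a ⟶ a :=
  eqToHom (M.leftAt_dom a).symm ≫ a ◁ M.left.hom ≫ eqToHom (Strict.comp_id a)

/-- The right unit constraint at a generalized element, `ρ_a`. -/
noncomputable def rightAt {X : D} (a : X ⟶ M.C) : tens M.ten a (M.unitAt X) ⟶ a :=
  eqToHom (M.rightAt_dom a).symm ≫ a ◁ M.right.hom ≫ eqToHom (Strict.comp_id a)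

theorem whiskerLeft_assocAt {X Y : D} (h : Y ⟶ X) {a b c : X ⟶ M.C} {a' b' c' : Y ⟶ M.C}
    (ha : h ≫ a = a') (hb : h ≫ b = b') (hc : h ≫ c = c') :
    h ◁ M.assocAt a b c ≍ M.assocAt a' b' c' := by
  subst ha hb hc
  refine (whiskerLeft_heq rfl (M.assocAt_dom a b c).symm (M.assocAt_cod a b c).symm
    (conj_heq _ _ _)).trans (HEq.trans ?_ (conj_heq _ _ _).symm)
  exact (comp_whiskerLeft_heq _ _ _).symm.trans (whiskerLeft_heq (by simp only [comp_lift]) rfl rfl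
    HEq.rfl)

theorem whiskerLeft_leftAt {X Y : D} (h : Y ⟶ X) {a : X ⟶ M.C} {a' : Y ⟶ M.C}
    (ha : h ≫ a = a') : h ◁ M.leftAt a ≍ M.leftAt a' := by
  subst ha
  refine (whiskerLeft_heq rfl (M.leftAt_dom a).symm (Strict.comp_id a).symm
    (conj_heq _ _ _)).trans (HEq.trans ?_ (conj_heq _ _ _).symm)
  exact (comp_whiskerLeft_heq _ _ _).symm

theorem whiskerLeft_rightAt {X Y : D} (h : Y ⟶ X) {a : X ⟶ M.C} {a' : Y ⟶ M.C}
    (ha : h ≫ a = a') : h ◁ M.rightAt a ≍ M.rightAt a' := by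
  subst ha
  refine (whiskerLeft_heq rfl (M.rightAt_dom a).symm (Strict.comp_id a).symm
    (conj_heq _ _ _)).trans (HEq.trans ?_ (conj_heq _ _ _).symm)
  exact (comp_whiskerLeft_heq _ _ _).symm

end MonoidalData

/-- The pentagon equation for `2`-cells at four generalized elements. -/
def MonoidalData.PentagonAt {D : Type u} [Bicategory.{w, v} D] [Strict D] [FiniteProducts D]
    (M : MonoidalData D) {X : D} (a b c d : X ⟶ M.C) : Prop :=
  tens₂ M.ten (𝟙 a) (M.assocAt b c d) ≫ M.assocAt a (tens M.ten b c) d ≫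
      tens₂ M.ten (M.assocAt a b c) (𝟙 d) =
    M.assocAt a b (tens M.ten c d) ≫ M.assocAt (tens M.ten a b) c d

/-- A monoidal object in a `2`-category with finite products. The pentagon is an equation between
`2`-cells on `C × (C × (C × C))` and the triangle one between `2`-cells on `C × C`, written at the
projections. -/
structure MonoidalObject (D : Type u) [Bicategory.{w, v} D] [Strict D] [FiniteProducts D] extends
    MonoidalData D where
  pentagon : toMonoidalData.PentagonAt (fst C (prod C (prod C C)))
    (snd C (prod C (prod C C)) ≫ fst C (prod C C))
    (snd C (prod C (prod C C)) ≫ snd C (prod C C) ≫ fst C C)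
    (snd C (prod C (prod C C)) ≫ snd C (prod C C) ≫ snd C C)
  triangle : toMonoidalData.assocAt (fst C C) (toMonoidalData.unitAt (prod C C)) (snd C C) ≫
      tens₂ ten (toMonoidalData.rightAt (fst C C)) (𝟙 (snd C C)) =
    tens₂ ten (𝟙 (fst C C)) (toMonoidalData.leftAt (snd C C))

namespace MonoidalObject

variable {D : Type u} [Bicategory.{w, v} D] [Strict D] [FiniteProducts D]

/-- The underlying data `(F, φ, φ₀)` of a lax monoidal `1`-cell. Composites are written in
diagrammatic order: `φ : ⊗' ∘ (F × F) ⟶ F ∘ ⊗` and `φ₀ : I' ⟶ F ∘ I`. -/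
structure LaxData (M N : MonoidalObject D) where
  F : M.C ⟶ N.C
  φ : tens N.ten (fst M.C M.C ≫ F) (snd M.C M.C ≫ F) ⟶ M.ten ≫ F
  φ₀ : N.unit ⟶ M.unit ≫ F

namespace LaxData

variable {M N : MonoidalObject D} (f : LaxData M N)

theorem phiAt_dom {X : D} (a b : X ⟶ M.C) :
    lift a b ≫ tens N.ten (fst M.C M.C ≫ f.F) (snd M.C M.C ≫ f.F) =
      tens N.ten (a ≫ f.F) (b ≫ f.F) := by
  simp only [comp_tens, ← Strict.assoc, lift_fst, lift_snd]

/-- The tensor constraint at generalized elements, `φ_{⟨a, b⟩}`. -/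
noncomputable def phiAt {X : D} (a b : X ⟶ M.C) :
    tens N.ten (a ≫ f.F) (b ≫ f.F) ⟶ tens M.ten a b ≫ f.F :=
  eqToHom (f.phiAt_dom a b).symm ≫ lift a b ◁ f.φ ≫
    eqToHom (Strict.assoc (lift a b) M.ten f.F).symm

/-- The unit constraint over `X`, the `2`-cell `φ₀` precomposed with `X ⟶ 1`. -/
noncomputable def phi₀At (X : D) : N.unitAt X ⟶ M.unitAt X ≫ f.F :=
  bang X ◁ f.φ₀ ≫ eqToHom (Strict.assoc (bang X) M.unit f.F).symm

theorem phiAt_heq {X : D} (a b : X ⟶ M.C) : f.phiAt a b ≍ lift a b ◁ f.φ := conj_heq _ _ _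

theorem phi₀At_heq (X : D) : f.phi₀At X ≍ bang X ◁ f.φ₀ := by
  have := conj_heq rfl (bang X ◁ f.φ₀) (Strict.assoc (bang X) M.unit f.F).symm
  rwa [eqToHom_refl, Category.id_comp] at this

theorem whiskerLeft_phiAt {X Y : D} (h : Y ⟶ X) {a b : X ⟶ M.C} {a' b' : Y ⟶ M.C}
    (ha : h ≫ a = a') (hb : h ≫ b = b') : h ◁ f.phiAt a b ≍ f.phiAt a' b' := by
  subst ha hb
  refine (whiskerLeft_heq rfl (f.phiAt_dom a b).symm (Strict.assoc _ _ _)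
    (f.phiAt_heq a b)).trans (HEq.trans ?_ (f.phiAt_heq _ _).symm)
  exact (comp_whiskerLeft_heq _ _ _).symm.trans (whiskerLeft_heq (by simp only [comp_lift]) rfl rfl
    HEq.rfl)

theorem whiskerLeft_phi₀At {X Y : D} (h : Y ⟶ X) : h ◁ f.phi₀At X ≍ f.phi₀At Y := by
  refine (whiskerLeft_heq rfl rfl (Strict.assoc _ _ _)
    (f.phi₀At_heq X)).trans (HEq.trans ?_ (f.phi₀At_heq _).symm)
  exact (comp_whiskerLeft_heq _ _ _).symm.trans (whiskerLeft_heq (bang_ext _ _) rfl rfl HEq.rfl)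

theorem phiAt_universal : f.phiAt (fst M.C M.C) (snd M.C M.C) ≍ f.φ := by
  have h : lift (fst M.C M.C) (snd M.C M.C) = 𝟙 _ := FiniteProducts.hom_ext
    (by rw [lift_fst, Strict.id_comp]) (by rw [lift_snd, Strict.id_comp])
  exact (f.phiAt_heq _ _).trans ((whiskerLeft_heq h rfl rfl HEq.rfl).trans (id_whiskerLeft_heq _))

/-- Naturality of the tensor constraint in generalized elements. -/
theorem phiAt_natural {X : D} {a b a' b' : X ⟶ M.C} (σ : a ⟶ a') (τ : b ⟶ b') :
    tens₂ N.ten (σ ▷ f.F) (τ ▷ f.F) ≫ f.phiAt a' b' =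
      f.phiAt a b ≫ tens₂ M.ten σ τ ▷ f.F := by
  apply eq_of_heq
  have h := whisker_exchange (lift₂ σ τ) f.φ
  refine (comp_heq (f.phiAt_dom a b).symm (f.phiAt_dom a' b').symm (Strict.assoc _ _ _) ?_
    (f.phiAt_heq a' b')).trans ((heq_of_eq h.symm).trans
    (comp_heq (f.phiAt_dom a b) (Strict.assoc _ _ _).symm (Strict.assoc _ _ _).symm
      (f.phiAt_heq a b).symm (whiskerRight_comp_heq _ _ _)))
  refine HEq.trans ?_ (whiskerRight_tens _ _ _ _).symm
  refine tens₂_heq _ ?_ ?_ ?_ ?_ ?_ ?_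
  iterate 4 simp only [← Strict.assoc, lift_fst, lift_snd]
  · exact ((whiskerRight_comp_heq _ _ _).trans
      (whiskerRight_heq (lift_fst _ _) (lift_fst _ _) rfl (lift₂_fst _ _))).symm
  · exact ((whiskerRight_comp_heq _ _ _).trans
      (whiskerRight_heq (lift_snd _ _) (lift_snd _ _) rfl (lift₂_snd _ _))).symm

/-- Compatibility of a lax monoidal `1`-cell with associativity at generalized elements. -/
def AssocAt {X : D} (a b c : X ⟶ M.C) : Prop :=
  N.assocAt (a ≫ f.F) (b ≫ f.F) (c ≫ f.F) ≫ tens₂ N.ten (f.phiAt a b) (𝟙 (c ≫ f.F)) ≫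
      f.phiAt (tens M.ten a b) c =
    tens₂ N.ten (𝟙 (a ≫ f.F)) (f.phiAt b c) ≫ f.phiAt a (tens M.ten b c) ≫
      M.assocAt a b c ▷ f.F

/-- Compatibility of a lax monoidal `1`-cell with the right unit at a generalized element. -/
def RightAt {X : D} (a : X ⟶ M.C) : Prop :=
  N.rightAt (a ≫ f.F) = tens₂ N.ten (𝟙 (a ≫ f.F)) (f.phi₀At X) ≫ f.phiAt a (M.unitAt X) ≫
    M.rightAt a ▷ f.F

/-- Compatibility of a lax monoidal `1`-cell with the left unit at a generalized element. -/
def LeftAt {X : D} (a : X ⟶ M.C) : Prop :=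
  N.leftAt (a ≫ f.F) = tens₂ N.ten (f.phi₀At X) (𝟙 (a ≫ f.F)) ≫ f.phiAt (M.unitAt X) a ≫
    M.leftAt a ▷ f.F

variable {f}

theorem AssocAt.whisker {X Y : D} {a b c : X ⟶ M.C} (H : f.AssocAt a b c) (h : Y ⟶ X)
    {a' b' c' : Y ⟶ M.C} (ha : h ≫ a = a') (hb : h ≫ b = b') (hc : h ≫ c = c') :
    f.AssocAt a' b' c' := by
  have hF : ∀ {x : X ⟶ M.C} {x' : Y ⟶ M.C}, h ≫ x = x' → h ≫ x ≫ f.F = x' ≫ f.F := by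
    rintro x _ rfl; rw [Strict.assoc]
  have hab : h ≫ tens M.ten a b = tens M.ten a' b' := by rw [comp_tens, ha, hb]
  have hbc : h ≫ tens M.ten b c = tens M.ten b' c' := by rw [comp_tens, hb, hc]
  have H' := congrArg (fun t => h ◁ t) H
  simp only [whiskerLeft_comp] at H'
  have e1 : h ≫ tens N.ten (a ≫ f.F) (tens N.ten (b ≫ f.F) (c ≫ f.F)) =
      tens N.ten (a' ≫ f.F) (tens N.ten (b' ≫ f.F) (c' ≫ f.F)) := by
    simp only [comp_tens, hF ha, hF hb, hF hc]
  have e2 : h ≫ tens N.ten (tens N.ten (a ≫ f.F) (b ≫ f.F)) (c ≫ f.F) =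
      tens N.ten (tens N.ten (a' ≫ f.F) (b' ≫ f.F)) (c' ≫ f.F) := by
    simp only [comp_tens, hF ha, hF hb, hF hc]
  have e3 : h ≫ tens N.ten (tens M.ten a b ≫ f.F) (c ≫ f.F) =
      tens N.ten (tens M.ten a' b' ≫ f.F) (c' ≫ f.F) := by
    rw [comp_tens, hF hab, hF hc]
  have e4 : h ≫ tens M.ten (tens M.ten a b) c ≫ f.F = tens M.ten (tens M.ten a' b') c' ≫ f.F :=
    hF (by rw [comp_tens, hab, hc])
  have e5 : h ≫ tens N.ten (a ≫ f.F) (tens M.ten b c ≫ f.F) =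
      tens N.ten (a' ≫ f.F) (tens M.ten b' c' ≫ f.F) := by
    rw [comp_tens, hF ha, hF hbc]
  have e6 : h ≫ tens M.ten a (tens M.ten b c) ≫ f.F = tens M.ten a' (tens M.ten b' c') ≫ f.F :=
    hF (by rw [comp_tens, ha, hbc])
  have eab : h ≫ tens N.ten (a ≫ f.F) (b ≫ f.F) = tens N.ten (a' ≫ f.F) (b' ≫ f.F) := by
    rw [comp_tens, hF ha, hF hb]
  have ebc : h ≫ tens N.ten (b ≫ f.F) (c ≫ f.F) = tens N.ten (b' ≫ f.F) (c' ≫ f.F) := by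
    rw [comp_tens, hF hb, hF hc]
  have id_whisker : ∀ {x : X ⟶ M.C} {x' : Y ⟶ M.C}, h ≫ x = x' →
      h ◁ 𝟙 (x ≫ f.F) ≍ 𝟙 (x' ≫ f.F) := by
    intro x x' hx
    rw [whiskerLeft_id]
    exact id_heq (hF hx)
  apply eq_of_heq
  refine ((comp_heq e1 e2 e4 (N.whiskerLeft_assocAt h (hF ha) (hF hb) (hF hc))
    (comp_heq e2 e3 e4 ((whiskerLeft_tens₂ _ _ _ _).trans
      (tens₂_heq _ eab (hF hc) (hF hab) (hF hc) (f.whiskerLeft_phiAt h ha hb) (id_whisker hc)))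
      (f.whiskerLeft_phiAt h hab hc))).symm.trans (heq_of_eq H')).trans
    (comp_heq e1 e5 e4 ((whiskerLeft_tens₂ _ _ _ _).trans
      (tens₂_heq _ (hF ha) ebc (hF ha) (hF hbc) (id_whisker ha) (f.whiskerLeft_phiAt h hb hc)))
      (comp_heq e5 e6 e4 (f.whiskerLeft_phiAt h ha hbc)
        ((whisker_assoc_heq _ _ _).symm.trans (whiskerRight_heq (by rw [comp_tens, ha, hbc])
          (by rw [comp_tens, hab, hc]) rfl (M.whiskerLeft_assocAt h ha hb hc)))))

theorem RightAt.whisker {X Y : D} {a : X ⟶ M.C} (H : f.RightAt a) (h : Y ⟶ X)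
    {a' : Y ⟶ M.C} (ha : h ≫ a = a') : f.RightAt a' := by
  have hF : ∀ {x : X ⟶ M.C} {x' : Y ⟶ M.C}, h ≫ x = x' → h ≫ x ≫ f.F = x' ≫ f.F := by
    rintro x _ rfl; rw [Strict.assoc]
  have hu := M.comp_unitAt h
  have hu' := N.comp_unitAt h
  have H' := congrArg (fun t => h ◁ t) H
  simp only [whiskerLeft_comp] at H'
  have e1 : h ≫ tens N.ten (a ≫ f.F) (N.unitAt X) = tens N.ten (a' ≫ f.F) (N.unitAt Y) := by
    rw [comp_tens, hF ha, hu']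
  have e2 : h ≫ tens N.ten (a ≫ f.F) (M.unitAt X ≫ f.F) =
      tens N.ten (a' ≫ f.F) (M.unitAt Y ≫ f.F) := by
    rw [comp_tens, hF ha, hF hu]
  have e3 : h ≫ tens M.ten a (M.unitAt X) = tens M.ten a' (M.unitAt Y) := by
    rw [comp_tens, ha, hu]
  apply eq_of_heq
  refine ((N.whiskerLeft_rightAt h (hF ha)).symm.trans (heq_of_eq H')).trans
    (comp_heq e1 e2 (hF ha) ((whiskerLeft_tens₂ _ _ _ _).trans (tens₂_heq _ (hF ha) hu' (hF ha)
      (hF hu) ?_ (f.whiskerLeft_phi₀At h)))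
      (comp_heq e2 (hF e3) (hF ha) (f.whiskerLeft_phiAt h ha hu)
        ((whisker_assoc_heq _ _ _).symm.trans
          (whiskerRight_heq e3 ha rfl (M.whiskerLeft_rightAt h ha)))))
  rw [whiskerLeft_id]
  exact id_heq (hF ha)

theorem LeftAt.whisker {X Y : D} {a : X ⟶ M.C} (H : f.LeftAt a) (h : Y ⟶ X)
    {a' : Y ⟶ M.C} (ha : h ≫ a = a') : f.LeftAt a' := by
  have hF : ∀ {x : X ⟶ M.C} {x' : Y ⟶ M.C}, h ≫ x = x' → h ≫ x ≫ f.F = x' ≫ f.F := by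
    rintro x _ rfl; rw [Strict.assoc]
  have hu := M.comp_unitAt h
  have hu' := N.comp_unitAt h
  have H' := congrArg (fun t => h ◁ t) H
  simp only [whiskerLeft_comp] at H'
  have e1 : h ≫ tens N.ten (N.unitAt X) (a ≫ f.F) = tens N.ten (N.unitAt Y) (a' ≫ f.F) := by
    rw [comp_tens, hF ha, hu']
  have e2 : h ≫ tens N.ten (M.unitAt X ≫ f.F) (a ≫ f.F) =
      tens N.ten (M.unitAt Y ≫ f.F) (a' ≫ f.F) := by
    rw [comp_tens, hF ha, hF hu]
  have e3 : h ≫ tens M.ten (M.unitAt X) a = tens M.ten (M.unitAt Y) a' := by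
    rw [comp_tens, ha, hu]
  apply eq_of_heq
  refine ((N.whiskerLeft_leftAt h (hF ha)).symm.trans (heq_of_eq H')).trans
    (comp_heq e1 e2 (hF ha) ((whiskerLeft_tens₂ _ _ _ _).trans (tens₂_heq _ hu' (hF ha)
      (hF hu) (hF ha) (f.whiskerLeft_phi₀At h) ?_))
      (comp_heq e2 (hF e3) (hF ha) (f.whiskerLeft_phiAt h hu ha)
        ((whisker_assoc_heq _ _ _).symm.trans
          (whiskerRight_heq e3 ha rfl (M.whiskerLeft_leftAt h ha)))))
  rw [whiskerLeft_id]
  exact id_heq (hF ha)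

end LaxData

/-- Lax monoidal `1`-cells between monoidal objects. The three diagrams are equations between
`2`-cells on `C × (C × C)` and on `C`. -/
structure Hom (M N : MonoidalObject D) extends LaxData M N where
  assoc : toLaxData.AssocAt (fst M.C (prod M.C M.C)) (snd M.C (prod M.C M.C) ≫ fst M.C M.C)
    (snd M.C (prod M.C M.C) ≫ snd M.C M.C)
  right : toLaxData.RightAt (𝟙 M.C)
  left : toLaxData.LeftAt (𝟙 M.C)

namespace Hom

theorem assocAt {M N : MonoidalObject D} (f : Hom M N) {X : D} (a b c : X ⟶ M.C) :
    f.AssocAt a b c :=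
  f.assoc.whisker (lift a (lift b c)) (lift_fst _ _)
    (by rw [← Strict.assoc, lift_snd, lift_fst]) (by rw [← Strict.assoc, lift_snd, lift_snd])

theorem rightAt {M N : MonoidalObject D} (f : Hom M N) {X : D} (a : X ⟶ M.C) : f.RightAt a :=
  f.right.whisker a (Strict.comp_id a)

theorem leftAt {M N : MonoidalObject D} (f : Hom M N) {X : D} (a : X ⟶ M.C) : f.LeftAt a :=
  f.left.whisker a (Strict.comp_id a)

end Hom

theorem tens₂_eqToHom {C X : D} (t : prod C C ⟶ C) {a b a' b' : X ⟶ C} (p : a = a') (q : b = b') :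
    tens₂ t (eqToHom p) (eqToHom q) = eqToHom (by rw [p, q]) := by
  cases p; cases q; simp [tens₂_id]

namespace LaxData

theorem id_φ_eq (M : MonoidalObject D) :
    tens M.ten (fst M.C M.C ≫ 𝟙 M.C) (snd M.C M.C ≫ 𝟙 M.C) = M.ten ≫ 𝟙 M.C := by
  rw [Strict.comp_id, Strict.comp_id, Strict.comp_id, tens,
    FiniteProducts.hom_ext (h := lift (fst M.C M.C) (snd M.C M.C)) (k := 𝟙 _)
      (by rw [lift_fst, Strict.id_comp]) (by rw [lift_snd, Strict.id_comp]), Strict.id_comp]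

/-- The data of the identity lax monoidal `1`-cell. -/
noncomputable def id (M : MonoidalObject D) : LaxData M M where
  F := 𝟙 M.C
  φ := eqToHom (id_φ_eq M)
  φ₀ := eqToHom (Strict.comp_id M.unit).symm

theorem id_phiAt {M : MonoidalObject D} {X : D} (a b : X ⟶ M.C) :
    (LaxData.id M).phiAt a b = eqToHom (by
      change tens M.ten (a ≫ 𝟙 _) (b ≫ 𝟙 _) = tens M.ten a b ≫ 𝟙 _
      simp only [Strict.comp_id]) := by
  refine eq_of_heq (((LaxData.id M).phiAt_heq a b).trans ?_)
  change _ ◁ eqToHom (id_φ_eq M) ≍ _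
  rw [whiskerLeft_eqToHom]
  exact eqToHom_heq _ _ ((LaxData.id M).phiAt_dom a b)

theorem id_phi₀At {M : MonoidalObject D} (X : D) :
    (LaxData.id M).phi₀At X = eqToHom (show M.unitAt X = M.unitAt X ≫ (LaxData.id M).F from
      (Strict.comp_id (M.unitAt X)).symm) := by
  refine eq_of_heq (((LaxData.id M).phi₀At_heq X).trans ?_)
  change _ ◁ eqToHom (Strict.comp_id M.unit).symm ≍ _
  rw [whiskerLeft_eqToHom]
  exact eqToHom_heq _ _ rfl

/-- The data of the composite of lax monoidal `1`-cells. -/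
noncomputable def comp {M N P : MonoidalObject D} (f : LaxData M N) (g : LaxData N P) :
    LaxData M P where
  F := f.F ≫ g.F
  φ := eqToHom (by rw [Strict.assoc, Strict.assoc]) ≫
    g.phiAt (fst M.C M.C ≫ f.F) (snd M.C M.C ≫ f.F) ≫ f.φ ▷ g.F ≫
      eqToHom (Strict.assoc M.ten f.F g.F)
  φ₀ := g.φ₀ ≫ f.φ₀ ▷ g.F ≫ eqToHom (Strict.assoc M.unit f.F g.F)

variable {M N P : MonoidalObject D} (f : LaxData M N) (g : LaxData N P)

theorem comp_φ_heq : (f.comp g).φ ≍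
    g.phiAt (fst M.C M.C ≫ f.F) (snd M.C M.C ≫ f.F) ≫ f.φ ▷ g.F :=
  conj_comp_heq _ _ _ (Strict.assoc M.ten f.F g.F)

theorem comp_φ₀_heq : (f.comp g).φ₀ ≍ g.φ₀ ≫ f.φ₀ ▷ g.F := by
  have := conj_comp_heq rfl g.φ₀ (f.φ₀ ▷ g.F) (Strict.assoc M.unit f.F g.F)
  rwa [eqToHom_refl, Category.id_comp] at this

theorem comp_phiAt_heq {X : D} (a b : X ⟶ M.C) :
    (f.comp g).phiAt a b ≍ g.phiAt (a ≫ f.F) (b ≫ f.F) ≫ f.phiAt a b ▷ g.F := by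
  have h1 : lift a b ≫ fst M.C M.C ≫ f.F = a ≫ f.F := by rw [← Strict.assoc, lift_fst]
  have h2 : lift a b ≫ snd M.C M.C ≫ f.F = b ≫ f.F := by rw [← Strict.assoc, lift_snd]
  refine ((f.comp g).phiAt_heq a b).trans ?_
  refine (whiskerLeft_heq (σ' := g.phiAt (fst M.C M.C ≫ f.F) (snd M.C M.C ≫ f.F) ≫ f.φ ▷ g.F)
    rfl ?_ ?_ (comp_φ_heq f g)).trans ?_
  · change tens P.ten (_ ≫ f.F ≫ g.F) (_ ≫ f.F ≫ g.F) = _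
    rw [Strict.assoc, Strict.assoc]
  · exact (Strict.assoc _ _ _).symm
  · rw [whiskerLeft_comp]
    exact comp_heq (by simp only [comp_tens, ← Strict.assoc, lift_fst, lift_snd])
      (by rw [← Strict.assoc, phiAt_dom]) (by simp only [tens, Strict.assoc])
      (g.whiskerLeft_phiAt _ h1 h2)
      ((whisker_assoc_heq _ _ _).symm.trans (whiskerRight_heq (f.phiAt_dom a b)
        (Strict.assoc _ _ _).symm rfl (f.phiAt_heq a b).symm))

theorem comp_phi₀At_heq (X : D) :
    (f.comp g).phi₀At X ≍ g.phi₀At X ≫ f.phi₀At X ▷ g.F := by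
  refine ((f.comp g).phi₀At_heq X).trans ?_
  refine (whiskerLeft_heq (σ' := g.φ₀ ≫ f.φ₀ ▷ g.F) rfl rfl (Strict.assoc _ _ _).symm
    (comp_φ₀_heq f g)).trans ?_
  rw [whiskerLeft_comp]
  exact comp_heq rfl (Strict.assoc _ _ _).symm
    (by simp only [MonoidalData.unitAt, Strict.assoc]) (g.phi₀At_heq X).symm
    ((whisker_assoc_heq _ _ _).symm.trans (whiskerRight_heq rfl
        (Strict.assoc _ _ _).symm rfl (f.phi₀At_heq X).symm))

end LaxData

theorem assocAt_heq (M : MonoidalObject D) {X : D} {a b c a' b' c' : X ⟶ M.C} (ha : a = a')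
    (hb : b = b') (hc : c = c') : M.assocAt a b c ≍ M.assocAt a' b' c' := by
  cases ha; cases hb; cases hc; rfl

theorem leftAt_heq (M : MonoidalObject D) {X : D} {a a' : X ⟶ M.C} (ha : a = a') :
    M.leftAt a ≍ M.leftAt a' := by
  cases ha; rfl

theorem rightAt_heq (M : MonoidalObject D) {X : D} {a a' : X ⟶ M.C} (ha : a = a') :
    M.rightAt a ≍ M.rightAt a' := by
  cases ha; rfl

theorem id_assocAt (M : MonoidalObject D) {X : D} (a b c : X ⟶ M.C) :
    (LaxData.id M).AssocAt a b c := by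
  have ha : a ≫ (LaxData.id M).F = a := Strict.comp_id a
  have hb : b ≫ (LaxData.id M).F = b := Strict.comp_id b
  have hc : c ≫ (LaxData.id M).F = c := Strict.comp_id c
  rw [LaxData.AssocAt, LaxData.id_phiAt, LaxData.id_phiAt, LaxData.id_phiAt, LaxData.id_phiAt,
    ← eqToHom_refl (c ≫ (LaxData.id M).F) rfl, ← eqToHom_refl (a ≫ (LaxData.id M).F) rfl,
    tens₂_eqToHom, tens₂_eqToHom]
  exact eq_of_heq ((comp_eqToHom_eqToHom_heq _ _ _).trans ((assocAt_heq M ha hb hc).trans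
    ((whiskerRight_id_heq _).symm.trans (eqToHom_eqToHom_comp_heq _ _ _).symm)))

theorem id_rightAt (M : MonoidalObject D) {X : D} (a : X ⟶ M.C) :
    (LaxData.id M).RightAt a := by
  have ha : a ≫ (LaxData.id M).F = a := Strict.comp_id a
  rw [LaxData.RightAt, LaxData.id_phiAt, LaxData.id_phi₀At,
    ← eqToHom_refl (a ≫ (LaxData.id M).F) rfl, tens₂_eqToHom]
  exact eq_of_heq ((rightAt_heq M ha).trans
    ((whiskerRight_id_heq _).symm.trans (eqToHom_eqToHom_comp_heq _ _ _).symm))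

theorem id_leftAt (M : MonoidalObject D) {X : D} (a : X ⟶ M.C) :
    (LaxData.id M).LeftAt a := by
  have ha : a ≫ (LaxData.id M).F = a := Strict.comp_id a
  rw [LaxData.LeftAt, LaxData.id_phiAt, LaxData.id_phi₀At,
    ← eqToHom_refl (a ≫ (LaxData.id M).F) rfl, tens₂_eqToHom]
  exact eq_of_heq ((leftAt_heq M ha).trans
    ((whiskerRight_id_heq _).symm.trans (eqToHom_eqToHom_comp_heq _ _ _).symm))

/-- The identity lax monoidal `1`-cell. -/
noncomputable def Hom.id (M : MonoidalObject D) : Hom M M where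
  toLaxData := LaxData.id M
  assoc := id_assocAt M _ _ _
  right := id_rightAt M _
  left := id_leftAt M _

theorem comp_assocAt {M N P : MonoidalObject D} (f : Hom M N) (g : Hom N P) {X : D}
    (a b c : X ⟶ M.C) : (f.toLaxData.comp g.toLaxData).AssocAt a b c := by
  have e : ∀ x : X ⟶ M.C, x ≫ f.F ≫ g.F = (x ≫ f.F) ≫ g.F := fun x => (Strict.assoc _ _ _).symm
  have hf := congrArg (fun t => t ▷ g.F) (f.assocAt a b c)
  have hg := g.assocAt (a ≫ f.F) (b ≫ f.F) (c ≫ f.F)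
  have n1 := g.phiAt_natural (f.phiAt a b) (𝟙 (c ≫ f.F))
  have n2 := g.phiAt_natural (𝟙 (a ≫ f.F)) (f.phiAt b c)
  simp only [comp_whiskerRight, id_whiskerRight] at hf n1 n2
  rw [LaxData.AssocAt] at hg
  have t1 : tens₂ P.ten ((f.toLaxData.comp g.toLaxData).phiAt a b) (𝟙 (c ≫ f.F ≫ g.F)) ≍
      tens₂ P.ten (g.phiAt (a ≫ f.F) (b ≫ f.F)) (𝟙 ((c ≫ f.F) ≫ g.F)) ≫
        tens₂ P.ten (f.phiAt a b ▷ g.F) (𝟙 ((c ≫ f.F) ≫ g.F)) := by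
    rw [← tens₂_comp, Category.comp_id]
    exact tens₂_heq _ (by change tens _ (a ≫ f.F ≫ g.F) (b ≫ f.F ≫ g.F) = _; rw [e, e]) (e c)
      (e _) (e c) (LaxData.comp_phiAt_heq _ _ a b) (id_heq (e c))
  have t2 : tens₂ P.ten (𝟙 (a ≫ f.F ≫ g.F)) ((f.toLaxData.comp g.toLaxData).phiAt b c) ≍
      tens₂ P.ten (𝟙 ((a ≫ f.F) ≫ g.F)) (g.phiAt (b ≫ f.F) (c ≫ f.F)) ≫
        tens₂ P.ten (𝟙 ((a ≫ f.F) ≫ g.F)) (f.phiAt b c ▷ g.F) := by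
    rw [← tens₂_comp, Category.comp_id]
    exact tens₂_heq _ (e a) (by change tens _ (b ≫ f.F ≫ g.F) (c ≫ f.F ≫ g.F) = _; rw [e, e])
      (e a) (e _) (id_heq (e a)) (LaxData.comp_phiAt_heq _ _ b c)
  have d1 : tens P.ten (a ≫ f.F ≫ g.F) (tens P.ten (b ≫ f.F ≫ g.F) (c ≫ f.F ≫ g.F)) =
      tens P.ten ((a ≫ f.F) ≫ g.F) (tens P.ten ((b ≫ f.F) ≫ g.F) ((c ≫ f.F) ≫ g.F)) := by
    rw [e, e, e]
  have d2 : tens P.ten (tens P.ten (a ≫ f.F ≫ g.F) (b ≫ f.F ≫ g.F)) (c ≫ f.F ≫ g.F) =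
      tens P.ten (tens P.ten ((a ≫ f.F) ≫ g.F) ((b ≫ f.F) ≫ g.F)) ((c ≫ f.F) ≫ g.F) := by
    rw [e, e, e]
  have d3 : tens P.ten (tens M.ten a b ≫ f.F ≫ g.F) (c ≫ f.F ≫ g.F) =
      tens P.ten ((tens M.ten a b ≫ f.F) ≫ g.F) ((c ≫ f.F) ≫ g.F) := by rw [e, e]
  have d4 : tens P.ten (a ≫ f.F ≫ g.F) (tens M.ten b c ≫ f.F ≫ g.F) =
      tens P.ten ((a ≫ f.F) ≫ g.F) ((tens M.ten b c ≫ f.F) ≫ g.F) := by rw [e, e]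
  apply eq_of_heq
  refine (comp_heq d1 d2 (e _) (assocAt_heq P (e a) (e b) (e c))
    (comp_heq d2 d3 (e _) t1 (LaxData.comp_phiAt_heq _ _ _ _))).trans
    (HEq.trans (heq_of_eq ?_) (comp_heq d1 d4 (e _) t2 (comp_heq d4 (e _) (e _)
      (LaxData.comp_phiAt_heq _ _ _ _) (whiskerRight_comp_heq _ _ _))).symm)
  simp only [Category.assoc]
  rw [reassoc_of% n1, reassoc_of% n2, ← hf, reassoc_of% hg]

theorem comp_rightAt {M N P : MonoidalObject D} (f : Hom M N) (g : Hom N P) {X : D}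
    (a : X ⟶ M.C) : (f.toLaxData.comp g.toLaxData).RightAt a := by
  have e : ∀ x : X ⟶ M.C, x ≫ f.F ≫ g.F = (x ≫ f.F) ≫ g.F := fun x => (Strict.assoc _ _ _).symm
  have hf := congrArg (fun t => t ▷ g.F) (f.rightAt a)
  have hg := g.rightAt (a ≫ f.F)
  have n := g.phiAt_natural (𝟙 (a ≫ f.F)) (f.phi₀At X)
  simp only [comp_whiskerRight, id_whiskerRight] at hf n
  rw [LaxData.RightAt] at hg
  have t : tens₂ P.ten (𝟙 (a ≫ f.F ≫ g.F)) ((f.toLaxData.comp g.toLaxData).phi₀At X) ≍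
      tens₂ P.ten (𝟙 ((a ≫ f.F) ≫ g.F)) (g.phi₀At X) ≫
        tens₂ P.ten (𝟙 ((a ≫ f.F) ≫ g.F)) (f.phi₀At X ▷ g.F) := by
    rw [← tens₂_comp, Category.comp_id]
    exact tens₂_heq _ (e a) rfl (e a) (e _) (id_heq (e a)) (LaxData.comp_phi₀At_heq _ _ X)
  have d1 : tens P.ten (a ≫ f.F ≫ g.F) (P.unitAt X) =
      tens P.ten ((a ≫ f.F) ≫ g.F) (P.unitAt X) := by rw [e]
  have d2 : tens P.ten (a ≫ f.F ≫ g.F) (M.unitAt X ≫ f.F ≫ g.F) =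
      tens P.ten ((a ≫ f.F) ≫ g.F) ((M.unitAt X ≫ f.F) ≫ g.F) := by rw [e, e]
  apply eq_of_heq
  refine (rightAt_heq P (e a)).trans (HEq.trans (heq_of_eq ?_) (comp_heq d1 d2 (e _) t
    (comp_heq d2 (e _) (e _) (LaxData.comp_phiAt_heq _ _ _ _)
      (whiskerRight_comp_heq _ _ _))).symm)
  simp only [Category.assoc]
  rw [reassoc_of% n, ← hf, hg]

theorem comp_leftAt {M N P : MonoidalObject D} (f : Hom M N) (g : Hom N P) {X : D}
    (a : X ⟶ M.C) : (f.toLaxData.comp g.toLaxData).LeftAt a := by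
  have e : ∀ x : X ⟶ M.C, x ≫ f.F ≫ g.F = (x ≫ f.F) ≫ g.F := fun x => (Strict.assoc _ _ _).symm
  have hf := congrArg (fun t => t ▷ g.F) (f.leftAt a)
  have hg := g.leftAt (a ≫ f.F)
  have n := g.phiAt_natural (f.phi₀At X) (𝟙 (a ≫ f.F))
  simp only [comp_whiskerRight, id_whiskerRight] at hf n
  rw [LaxData.LeftAt] at hg
  have t : tens₂ P.ten ((f.toLaxData.comp g.toLaxData).phi₀At X) (𝟙 (a ≫ f.F ≫ g.F)) ≍
      tens₂ P.ten (g.phi₀At X) (𝟙 ((a ≫ f.F) ≫ g.F)) ≫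
        tens₂ P.ten (f.phi₀At X ▷ g.F) (𝟙 ((a ≫ f.F) ≫ g.F)) := by
    rw [← tens₂_comp, Category.comp_id]
    exact tens₂_heq _ rfl (e a) (e _) (e a) (LaxData.comp_phi₀At_heq _ _ X) (id_heq (e a))
  have d1 : tens P.ten (P.unitAt X) (a ≫ f.F ≫ g.F) =
      tens P.ten (P.unitAt X) ((a ≫ f.F) ≫ g.F) := by rw [e]
  have d2 : tens P.ten (M.unitAt X ≫ f.F ≫ g.F) (a ≫ f.F ≫ g.F) =
      tens P.ten ((M.unitAt X ≫ f.F) ≫ g.F) ((a ≫ f.F) ≫ g.F) := by rw [e, e]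
  apply eq_of_heq
  refine (leftAt_heq P (e a)).trans (HEq.trans (heq_of_eq ?_) (comp_heq d1 d2 (e _) t
    (comp_heq d2 (e _) (e _) (LaxData.comp_phiAt_heq _ _ _ _)
      (whiskerRight_comp_heq _ _ _))).symm)
  simp only [Category.assoc]
  rw [reassoc_of% n, ← hf, hg]

/-- Composition of lax monoidal `1`-cells. -/
noncomputable def Hom.comp {M N P : MonoidalObject D} (f : Hom M N) (g : Hom N P) : Hom M P where
  toLaxData := f.toLaxData.comp g.toLaxData
  assoc := comp_assocAt f g _ _ _
  right := comp_rightAt f g _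
  left := comp_leftAt f g _

/-- Monoidal `2`-cells: transformations of lax monoidal `1`-cells. -/
structure Hom₂ {M N : MonoidalObject D} (f g : Hom M N) where
  σ : f.F ⟶ g.F
  tensor : tens₂ N.ten (fst M.C M.C ◁ σ) (snd M.C M.C ◁ σ) ≫ g.φ = f.φ ≫ M.ten ◁ σ
  unit : f.φ₀ ≫ M.unit ◁ σ = g.φ₀

namespace Hom₂

variable {M N P : MonoidalObject D}

theorem ext {f g : Hom M N} {s t : Hom₂ f g} (h : s.σ = t.σ) : s = t := by
  cases s; cases t; cases h; rfl

theorem tensorAt {f g : Hom M N} (s : Hom₂ f g) {X : D} (a b : X ⟶ M.C) :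
    tens₂ N.ten (a ◁ s.σ) (b ◁ s.σ) ≫ g.phiAt a b = f.phiAt a b ≫ tens M.ten a b ◁ s.σ := by
  have h := congrArg (fun t => lift a b ◁ t) s.tensor
  simp only [whiskerLeft_comp] at h
  have e : ∀ k : M.C ⟶ N.C, lift a b ≫ M.ten ≫ k = tens M.ten a b ≫ k :=
    fun k => (Strict.assoc _ _ _).symm
  have e1 : ∀ k : M.C ⟶ N.C, lift a b ≫ fst M.C M.C ≫ k = a ≫ k :=
    fun k => by rw [← Strict.assoc, lift_fst]
  have e2 : ∀ k : M.C ⟶ N.C, lift a b ≫ snd M.C M.C ≫ k = b ≫ k :=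
    fun k => by rw [← Strict.assoc, lift_snd]
  apply eq_of_heq
  refine ((comp_heq (f.phiAt_dom a b) (g.phiAt_dom a b) (e _) ?_ (g.phiAt_heq a b).symm).symm.trans
    (heq_of_eq h)).trans (comp_heq (f.phiAt_dom a b) (e _) (e _) (f.phiAt_heq a b).symm
      (comp_whiskerLeft_heq _ _ _).symm)
  refine (whiskerLeft_tens₂ _ _ _ _).trans (tens₂_heq _ (e1 _) (e2 _) (e1 _) (e2 _) ?_ ?_)
  · exact (comp_whiskerLeft_heq _ _ _).symm.trans (whiskerLeft_heq (lift_fst _ _) rfl rfl HEq.rfl)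
  · exact (comp_whiskerLeft_heq _ _ _).symm.trans (whiskerLeft_heq (lift_snd _ _) rfl rfl HEq.rfl)

theorem unitAt {f g : Hom M N} (s : Hom₂ f g) (X : D) :
    f.phi₀At X ≫ M.unitAt X ◁ s.σ = g.phi₀At X := by
  have h := congrArg (fun t => bang X ◁ t) s.unit
  simp only [whiskerLeft_comp] at h
  have e : ∀ k : M.C ⟶ N.C, bang X ≫ M.unit ≫ k = M.unitAt X ≫ k :=
    fun k => (Strict.assoc _ _ _).symm
  apply eq_of_heq
  exact ((comp_heq rfl (e _) (e _) (f.phi₀At_heq X).symm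
    (comp_whiskerLeft_heq _ _ _).symm).symm.trans (heq_of_eq h)).trans (g.phi₀At_heq X).symm

/-- The identity `2`-cell. -/
def id (f : Hom M N) : Hom₂ f f where
  σ := 𝟙 f.F
  tensor := by simp only [whiskerLeft_id, tens₂_id, Category.id_comp, Category.comp_id]
  unit := by simp only [whiskerLeft_id, Category.comp_id]

/-- Vertical composition. -/
def comp {f g h : Hom M N} (s : Hom₂ f g) (t : Hom₂ g h) : Hom₂ f h where
  σ := s.σ ≫ t.σ
  tensor := by
    rw [whiskerLeft_comp, whiskerLeft_comp, whiskerLeft_comp, tens₂_comp, Category.assoc,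
      t.tensor, ← Category.assoc, s.tensor, Category.assoc]
  unit := by rw [whiskerLeft_comp, ← Category.assoc, s.unit, t.unit]

/-- Left whiskering. -/
def whiskerLeft (f : Hom M N) {g h : Hom N P} (s : Hom₂ g h) : Hom₂ (f.comp g) (f.comp h) where
  σ := f.F ◁ s.σ
  tensor := by
    have ha : ∀ k : N.C ⟶ P.C, fst M.C M.C ≫ f.F ≫ k = (fst M.C M.C ≫ f.F) ≫ k :=
      fun k => (Strict.assoc _ _ _).symm
    have hb : ∀ k : N.C ⟶ P.C, snd M.C M.C ≫ f.F ≫ k = (snd M.C M.C ≫ f.F) ≫ k :=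
      fun k => (Strict.assoc _ _ _).symm
    have hc : ∀ k : N.C ⟶ P.C, M.ten ≫ f.F ≫ k = (M.ten ≫ f.F) ≫ k :=
      fun k => (Strict.assoc _ _ _).symm
    have hd : ∀ k : N.C ⟶ P.C, tens P.ten (fst M.C M.C ≫ f.F ≫ k) (snd M.C M.C ≫ f.F ≫ k) =
      tens P.ten ((fst M.C M.C ≫ f.F) ≫ k) ((snd M.C M.C ≫ f.F) ≫ k) := fun k => by
        rw [ha, hb]
    apply eq_of_heq
    refine (comp_heq (hd _) (hd _) (hc _)
      (tens₂_heq _ (ha _) (hb _) (ha _) (hb _) (comp_whiskerLeft_heq _ _ _).symm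
        (comp_whiskerLeft_heq _ _ _).symm) (LaxData.comp_φ_heq _ _)).trans
      (HEq.trans (heq_of_eq ?_) (comp_heq (hd _) (hc _) (hc _) (LaxData.comp_φ_heq _ _)
        (comp_whiskerLeft_heq _ _ _).symm).symm)
    have h1 := s.tensorAt (fst M.C M.C ≫ f.F) (snd M.C M.C ≫ f.F)
    rw [reassoc_of% h1, whisker_exchange, Category.assoc (g.phiAt _ _)]
  unit := by
    have hc : ∀ k : N.C ⟶ P.C, M.unit ≫ f.F ≫ k = (M.unit ≫ f.F) ≫ k :=
      fun k => (Strict.assoc _ _ _).symm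
    apply eq_of_heq
    refine (comp_heq rfl (hc _) (hc _) (LaxData.comp_φ₀_heq _ _)
      (comp_whiskerLeft_heq _ _ _).symm).trans
      (HEq.trans (heq_of_eq ?_) (LaxData.comp_φ₀_heq _ _).symm)
    rw [Category.assoc g.φ₀, ← whisker_exchange, reassoc_of% s.unit]

/-- Right whiskering. -/
def whiskerRight {f g : Hom M N} (s : Hom₂ f g) (h : Hom N P) : Hom₂ (f.comp h) (g.comp h) where
  σ := s.σ ▷ h.F
  tensor := by
    have ha : ∀ k : M.C ⟶ N.C, fst M.C M.C ≫ k ≫ h.F = (fst M.C M.C ≫ k) ≫ h.F :=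
      fun k => (Strict.assoc _ _ _).symm
    have hb : ∀ k : M.C ⟶ N.C, snd M.C M.C ≫ k ≫ h.F = (snd M.C M.C ≫ k) ≫ h.F :=
      fun k => (Strict.assoc _ _ _).symm
    have hc : ∀ k : M.C ⟶ N.C, M.ten ≫ k ≫ h.F = (M.ten ≫ k) ≫ h.F :=
      fun k => (Strict.assoc _ _ _).symm
    have hd : ∀ k : M.C ⟶ N.C, tens P.ten (fst M.C M.C ≫ k ≫ h.F) (snd M.C M.C ≫ k ≫ h.F) =
      tens P.ten ((fst M.C M.C ≫ k) ≫ h.F) ((snd M.C M.C ≫ k) ≫ h.F) := fun k => by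
        rw [ha, hb]
    apply eq_of_heq
    refine (comp_heq (hd _) (hd _) (hc _)
      (tens₂_heq _ (ha _) (hb _) (ha _) (hb _) (whisker_assoc_heq _ _ _).symm
        (whisker_assoc_heq _ _ _).symm) (LaxData.comp_φ_heq _ _)).trans
      (HEq.trans (heq_of_eq ?_) (comp_heq (hd _) (hc _) (hc _) (LaxData.comp_φ_heq _ _)
        (whisker_assoc_heq _ _ _).symm).symm)
    have h1 := h.phiAt_natural (fst M.C M.C ◁ s.σ) (snd M.C M.C ◁ s.σ)
    rw [reassoc_of% h1, Category.assoc (h.phiAt _ _), ← comp_whiskerRight,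
      ← comp_whiskerRight, s.tensor]
  unit := by
    have hc : ∀ k : M.C ⟶ N.C, M.unit ≫ k ≫ h.F = (M.unit ≫ k) ≫ h.F :=
      fun k => (Strict.assoc _ _ _).symm
    apply eq_of_heq
    refine (comp_heq rfl (hc _) (hc _) (LaxData.comp_φ₀_heq _ _)
      (whisker_assoc_heq _ _ _).symm).trans
      (HEq.trans (heq_of_eq ?_) (LaxData.comp_φ₀_heq _ _).symm)
    rw [Category.assoc h.φ₀, ← comp_whiskerRight, s.unit]

end Hom₂

instance {M N : MonoidalObject D} : Category (Hom M N) where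
  Hom f g := Hom₂ f g
  id f := Hom₂.id f
  comp s t := Hom₂.comp s t
  id_comp s := Hom₂.ext (Category.id_comp (Hom₂.σ s))
  comp_id s := Hom₂.ext (Category.comp_id (Hom₂.σ s))
  assoc s t r := Hom₂.ext (Category.assoc (Hom₂.σ s) (Hom₂.σ t) (Hom₂.σ r))

theorem hom_ext {M N : MonoidalObject D} {f g : Hom M N} (h : f.F = g.F) (hφ : f.φ ≍ g.φ)
    (hφ₀ : f.φ₀ ≍ g.φ₀) : f = g := by
  obtain ⟨⟨F, φ, φ₀⟩, _, _, _⟩ := f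
  obtain ⟨⟨F', φ', φ₀'⟩, _, _, _⟩ := g
  cases h; cases hφ; cases hφ₀; rfl

theorem eqToHom_σ {M N : MonoidalObject D} {f g : Hom M N} (h : f = g) :
    Hom₂.σ (eqToHom h) = eqToHom (congrArg (fun k : Hom M N => k.F) h) := by
  cases h; rfl

theorem phiAt_congr {M N : MonoidalObject D} (f : LaxData M N) {X : D} {a b a' b' : X ⟶ M.C}
    (ha : a = a') (hb : b = b') : f.phiAt a b ≍ f.phiAt a' b' := by
  cases ha; cases hb; rfl

theorem Hom.id_comp {M N : MonoidalObject D} (f : Hom M N) : (Hom.id M).comp f = f := by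
  refine hom_ext (Strict.id_comp f.F) ((LaxData.comp_φ_heq _ _).trans ?_)
    ((LaxData.comp_φ₀_heq _ _).trans ?_)
  · refine (comp_id_heq (by rw [LaxData.id_φ_eq]) _ (eqToHom_whiskerRight (LaxData.id_φ_eq M) _)).trans
      ((phiAt_congr _ (Strict.comp_id _) (Strict.comp_id _)).trans f.phiAt_universal)
  · exact comp_id_heq (congrArg (fun k => k ≫ f.F) (Strict.comp_id M.unit).symm) _
      (eqToHom_whiskerRight (Strict.comp_id M.unit).symm _)

theorem Hom.comp_id {M N : MonoidalObject D} (f : Hom M N) : f.comp (Hom.id N) = f := by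
  refine hom_ext (Strict.comp_id f.F) ((LaxData.comp_φ_heq _ _).trans ?_)
    ((LaxData.comp_φ₀_heq _ _).trans ?_)
  · exact (id_comp_heq _ _ (LaxData.id_phiAt _ _)).trans (whiskerRight_id_heq _)
  · exact (id_comp_heq (Strict.comp_id N.unit).symm _ rfl).trans (whiskerRight_id_heq _)

theorem Hom.comp_assoc {M N P Q : MonoidalObject D} (f : Hom M N) (g : Hom N P) (h : Hom P Q) :
    (f.comp g).comp h = f.comp (g.comp h) := by
  have e : ∀ {X : D} (x : X ⟶ M.C), x ≫ f.F ≫ g.F = (x ≫ f.F) ≫ g.F :=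
    fun x => (Strict.assoc _ _ _).symm
  have e' : ∀ {X : D} (x : X ⟶ N.C), x ≫ g.F ≫ h.F = (x ≫ g.F) ≫ h.F :=
    fun x => (Strict.assoc _ _ _).symm
  refine hom_ext (Strict.assoc f.F g.F h.F) ((LaxData.comp_φ_heq _ _).trans ?_)
    ((LaxData.comp_φ₀_heq _ _).trans ?_)
  · refine HEq.trans ?_ (LaxData.comp_φ_heq _ _).symm
    refine (comp_heq (g := tens P.ten (fst M.C M.C ≫ f.F ≫ g.F) (snd M.C M.C ≫ f.F ≫ g.F) ≫ h.F)
      (g' := tens P.ten ((fst M.C M.C ≫ f.F) ≫ g.F) ((snd M.C M.C ≫ f.F) ≫ g.F) ≫ h.F)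
      (by rw [e, e]) (by rw [e, e])
      (congrArg (fun k => k ≫ h.F) (e M.ten))
      (phiAt_congr _ (e _) (e _)) (whiskerRight_heq (by rw [e, e]) (e _) rfl
        (LaxData.comp_φ_heq f.toLaxData g.toLaxData))).trans ?_
    rw [comp_whiskerRight, ← Category.assoc (h.phiAt _ _)]
    exact comp_heq (by rw [← e', ← e']; rfl) (e' _).symm (e' _).symm
      (LaxData.comp_phiAt_heq _ _ _ _).symm (whiskerRight_comp_heq _ _ _).symm
  · refine HEq.trans ?_ (LaxData.comp_φ₀_heq _ _).symm
    refine (comp_heq rfl rfl (congrArg (fun k => k ≫ h.F) (e M.unit)) HEq.rfl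
      (whiskerRight_heq rfl (e _) rfl (LaxData.comp_φ₀_heq f.toLaxData g.toLaxData))).trans ?_
    rw [comp_whiskerRight, ← Category.assoc h.φ₀]
    exact comp_heq rfl (e' _).symm (e' _).symm
      (LaxData.comp_φ₀_heq _ _).symm (whiskerRight_comp_heq _ _ _).symm

theorem eq_sandwich {M N : MonoidalObject D} {f f' g g' : Hom M N} (s : Hom₂ f g) (t : Hom₂ f' g')
    (p : f = f') (q : g = g') (h : s.σ ≍ t.σ) :
    (show f ⟶ g from s) = eqToHom p ≫ (show f' ⟶ g' from t) ≫ eqToHom q.symm := by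
  cases p; cases q
  cases s; cases t; cases h
  simp

theorem associator_σ {M N P Q : MonoidalObject D} (f : Hom M N) (g : Hom N P) (h : Hom P Q) :
    Hom₂.σ (eqToHom (Hom.comp_assoc f g h)) = (α_ f.F g.F h.F).hom := by
  rw [eqToHom_σ, Strict.associator_eqToIso]; rfl

/-- The `2`-category of monoidal objects, lax monoidal `1`-cells and monoidal `2`-cells. -/
noncomputable instance : Bicategory (MonoidalObject D) where
  Hom M N := Hom M N
  id M := Hom.id M
  comp f g := Hom.comp f g
  whiskerLeft f _ _ s := Hom₂.whiskerLeft f s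
  whiskerRight s h := Hom₂.whiskerRight s h
  associator f g h := eqToIso (Hom.comp_assoc f g h)
  leftUnitor f := eqToIso (Hom.id_comp f)
  rightUnitor f := eqToIso (Hom.comp_id f)
  whiskerLeft_id f g := Hom₂.ext (Bicategory.whiskerLeft_id f.F g.F)
  whiskerLeft_comp f _ _ _ (s : Hom₂ _ _) (t : Hom₂ _ _) :=
    Hom₂.ext (Bicategory.whiskerLeft_comp f.F s.σ t.σ)
  id_whiskerLeft (s : Hom₂ _ _) := eq_sandwich (Hom₂.whiskerLeft (Hom.id _) s) s
    (Hom.id_comp _) (Hom.id_comp _) (id_whiskerLeft_heq s.σ)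
  comp_whiskerLeft f g _ _ (s : Hom₂ _ _) := eq_sandwich (Hom₂.whiskerLeft (Hom.comp f g) s)
    (Hom₂.whiskerLeft f (Hom₂.whiskerLeft g s)) (Hom.comp_assoc _ _ _) (Hom.comp_assoc _ _ _)
    (comp_whiskerLeft_heq f.F g.F s.σ)
  id_whiskerRight f g := Hom₂.ext (Bicategory.id_whiskerRight f.F g.F)
  comp_whiskerRight (s : Hom₂ _ _) (t : Hom₂ _ _) f :=
    Hom₂.ext (Bicategory.comp_whiskerRight s.σ t.σ f.F)
  whiskerRight_id (s : Hom₂ _ _) := eq_sandwich (Hom₂.whiskerRight s (Hom.id _)) s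
    (Hom.comp_id _) (Hom.comp_id _) (whiskerRight_id_heq s.σ)
  whiskerRight_comp (s : Hom₂ _ _) f g := eq_sandwich (Hom₂.whiskerRight s (Hom.comp f g))
    (Hom₂.whiskerRight (Hom₂.whiskerRight s f) g) (Hom.comp_assoc _ _ _).symm
    (Hom.comp_assoc _ _ _).symm (whiskerRight_comp_heq s.σ f.F g.F)
  whisker_assoc f _ _ (s : Hom₂ _ _) g := eq_sandwich
    (Hom₂.whiskerRight (Hom₂.whiskerLeft f s) g) (Hom₂.whiskerLeft f (Hom₂.whiskerRight s g))
    (Hom.comp_assoc _ _ _) (Hom.comp_assoc _ _ _) (whisker_assoc_heq f.F s.σ g.F)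
  whisker_exchange (s : Hom₂ _ _) (t : Hom₂ _ _) :=
    Hom₂.ext (Bicategory.whisker_exchange s.σ t.σ)
  pentagon f g h i := by
    refine Hom₂.ext ?_
    change Hom₂.σ (eqToHom (Hom.comp_assoc f g h)) ▷ i.F ≫
      Hom₂.σ (eqToHom (Hom.comp_assoc f (g.comp h) i)) ≫
        f.F ◁ Hom₂.σ (eqToHom (Hom.comp_assoc g h i)) =
      Hom₂.σ (eqToHom (Hom.comp_assoc (f.comp g) h i)) ≫
        Hom₂.σ (eqToHom (Hom.comp_assoc f g (h.comp i)))
    simp only [associator_σ]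
    exact Bicategory.pentagon f.F g.F h.F i.F
  triangle f g := by
    refine Hom₂.ext ?_
    change Hom₂.σ (eqToHom (Hom.comp_assoc f (Hom.id _) g)) ≫
      f.F ◁ Hom₂.σ (eqToHom (Hom.id_comp g)) = Hom₂.σ (eqToHom (Hom.comp_id f)) ▷ g.F
    rw [associator_σ, eqToHom_σ, eqToHom_σ]
    have := Bicategory.triangle f.F g.F
    rw [Strict.leftUnitor_eqToIso, Strict.rightUnitor_eqToIso] at this
    exact this

instance : Strict (MonoidalObject D) where
  id_comp f := Hom.id_comp f
  comp_id f := Hom.comp_id f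
  assoc f g h := Hom.comp_assoc f g h
  leftUnitor_eqToIso _ := rfl
  rightUnitor_eqToIso _ := rfl
  associator_eqToIso _ _ _ := rfl

end MonoidalObject

section Forget

open MonoidalObject

/-- The forgetful `2`-functor from monoidal objects to their underlying `0`-cells. -/
noncomputable def forget (D : Type u) [Bicategory.{w, v} D] [Strict D]
    [FiniteProducts D] : StrictPseudofunctor (MonoidalObject D) D :=
  StrictPseudofunctor.mk''
    { obj := fun M => M.C
      map := fun f => LaxData.F (Hom.toLaxData f)
      map₂ := fun s => Hom₂.σ s
      map₂_id := fun _ => rfl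
      map₂_comp := fun _ _ => rfl
      map_id := fun _ => rfl
      map_comp := fun _ _ => rfl
      map₂_whisker_left := fun f _ _ s => by
        change LaxData.F (Hom.toLaxData f) ◁ Hom₂.σ s = 𝟙 _ ≫ _ ◁ Hom₂.σ s ≫ 𝟙 _
        rw [Category.id_comp, Category.comp_id]
      map₂_whisker_right := fun s h => by
        change Hom₂.σ s ▷ LaxData.F (Hom.toLaxData h) = 𝟙 _ ≫ Hom₂.σ s ▷ _ ≫ 𝟙 _
        rw [Category.id_comp, Category.comp_id] }

end Forget

end MonoidalObjects

end TwoCat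

/-!
A left `2`-adjoint of a `2`-functor `R` is the same thing as a universal arrow `u : b ⟶ R c` from
every `0`-cell `b` (`TwoAdjunction.isUniversalArrow_unit`, `IsUniversalArrow.adjunction`), and
universal arrows from the same `b` differ by an isomorphism (`IsUniversalArrow.exists_iso`). So it
suffices to find, for a monad `M` in `Mon(D)` with underlying monad `S` in `D`, a universal arrow
from `M` to `ι` whose underlying arrow is a given universal arrow `u : S ⟶ ι X` in `Mnd_op(D)`.

`Mnd_op(D)` has finite products, computed on underlying `0`-cells. As `K` preserves them, the
products `u × u`, `u × (u × u)`, … are again universal (`TwoAdjunction.isUniversalArrow_prod`,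
`isUniversalArrow_iotaProd`). That `M` is a monad in `Mon(D)` says that the tensor product
and the unit of the underlying monoidal object are oplax morphisms of monads `S × S ⟶ S` and
`ι 1 ⟶ S` (`MndOp.tensHom`, `MndOp.unitHom`), and that its constraints are `2`-cells between the
evident composites of these (`MndOp.exists_assocE` and its companions). The universal properties of
`u × u`, `u × (u × u)` and `u` therefore carry tensor product and constraints over to `X`, in the
only way that makes `u` strict monoidal; the unit of `X` is the composite of the old unit with `u`.
The pentagon and the triangle for `X` hold because they hold after whiskering with a product of
copies of `u`, and such a product is cofaithful, being universal (`kleisliMonoidal`).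

An arrow `g : M ⟶ ι Y` in `Mnd_op(Mon(D))` has an underlying arrow in `Mnd_op(D)`, which factors
through `u` by a unique `h : X ⟶ Y`. Its lax structure `2`-cell `φ` is a `2`-cell of monads, since
the structure `2`-cell of `g` is monoidal; so `φ` descends along `u × u` and makes `h` lax
monoidal, the axioms being tested once more along products of copies of `u` (`exists_φ`, `liftHom`).
Hence `u` is universal in `Mnd_op(Mon(D))` (`isUniversalArrow_arrowTo`), and `Mon(D)` admits Kleisli
objects.

For an arbitrary left `2`-adjoint of `ι`, its unit differs from the arrow just constructed by an
isomorphism, so the forgetful `2`-functor sends it to a universal arrow; the canonical comparison is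
then an isomorphism between two universal arrows from `S` (`standardKleisli_of_universal`).

Composition of `1`-cells is strictly associative and unital only up to propositional equality, so
`2`-cells to be compared often lie between `1`-cells that are not syntactically equal. They are
compared by heterogeneous equality `≍`, for which the coherence `2`-cells are invisible.
-/

namespace TwoCat

/-! ### Universal arrows and `2`-adjunctions -/

section UniversalArrows

variable {B : Type u₁} [Bicategory.{w₁, v₁} B] {C : Type u₂} [Bicategory.{w₂, v₂} C]

/-- `u : b ⟶ R c` is a universal arrow from `b` to the `2`-functor `R`: for every `d`, the functor
`h ↦ u ≫ R h` is an isomorphism of categories `C(c, d) ≅ B(b, R d)`, bijective on `1`-cells (first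
field) and on `2`-cells (second field). -/
structure IsUniversalArrow (R : StrictPseudofunctor C B) {b : B} {c : C} (u : b ⟶ R.obj c) :
    Prop where
  lift_unique : ∀ {d : C} (f : b ⟶ R.obj d), ∃! h : c ⟶ d, u ≫ R.map h = f
  lift₂_unique : ∀ {d : C} {h k : c ⟶ d} (θ : u ≫ R.map h ⟶ u ≫ R.map k),
    ∃! ψ : h ⟶ k, u ◁ R.map₂ ψ = θ

theorem map₂_whiskerLeft_heq (R : StrictPseudofunctor C B) {a b c : C} (f : a ⟶ b) {g h : b ⟶ c}
    (θ : g ⟶ h) : R.map₂ (f ◁ θ) ≍ R.map f ◁ R.map₂ θ := by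
  simp [R.map₂_whisker_left, R.mapComp_eq_eqToIso]

theorem map₂_whiskerRight_heq (R : StrictPseudofunctor C B) {a b c : C} {f g : a ⟶ b} (θ : f ⟶ g)
    (h : b ⟶ c) : R.map₂ (θ ▷ h) ≍ R.map₂ θ ▷ R.map h := by
  simp [R.map₂_whisker_right, R.mapComp_eq_eqToIso]

theorem TwoNatTrans.naturality₂_heq {F G : StrictPseudofunctor B C} (t : TwoNatTrans F G) {a b : B}
    {f g : a ⟶ b} (θ : f ⟶ g) : F.map₂ θ ▷ t.app b ≍ t.app a ◁ G.map₂ θ := by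
  have h := t.naturality₂ θ
  have h1 : F.map₂ θ ▷ t.app b ≍ F.map₂ θ ▷ t.app b ≫ eqToHom (t.naturality g) :=
    (comp_id_heq _ _ rfl).symm
  have h2 : eqToHom (t.naturality f) ≫ t.app a ◁ G.map₂ θ ≍ t.app a ◁ G.map₂ θ :=
    id_comp_heq _ _ rfl
  exact h1.trans ((heq_of_eq h).trans h2)

/-- The form in which `TwoNatTrans` states naturality on `2`-cells, from a heterogeneous
equality. -/
theorem naturality₂_of_heq {a b : B} {f g f' g' : a ⟶ b} {θ : f ⟶ g} {θ' : f' ⟶ g'}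
    (p : g = g') (q : f = f') (h : θ ≍ θ') : θ ≫ eqToHom p = eqToHom q ≫ θ' := by
  cases p; cases q; cases h; simp

namespace IsUniversalArrow

variable {R : StrictPseudofunctor C B} {b : B} {c : C} {u : b ⟶ R.obj c}
  (hu : IsUniversalArrow R u)
include hu

theorem hom_ext {d : C} {h k : c ⟶ d} (e : u ≫ R.map h = u ≫ R.map k) : h = k :=
  (hu.lift_unique (u ≫ R.map k)).unique e rfl

theorem hom₂_ext {d : C} {h k : c ⟶ d} {ψ ψ' : h ⟶ k} (e : u ◁ R.map₂ ψ = u ◁ R.map₂ ψ') :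
    ψ = ψ' :=
  (hu.lift₂_unique (u ◁ R.map₂ ψ')).unique e rfl

end IsUniversalArrow

/-- Factorization of a `2`-cell whose source and target are only propositionally of the form
`u ≫ R h`. -/
theorem IsUniversalArrow.exists_map₂_heq {R : StrictPseudofunctor C B} {b : B} {c : C}
    {u : b ⟶ R.obj c} (hu : IsUniversalArrow R u) {d : C} {h k : c ⟶ d} {f g : b ⟶ R.obj d}
    (hf : u ≫ R.map h = f) (hg : u ≫ R.map k = g) (θ : f ⟶ g) : ∃ ψ : h ⟶ k, u ◁ R.map₂ ψ ≍ θ := by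
  subst hf hg
  obtain ⟨ψ, hψ, -⟩ := hu.lift₂_unique θ
  exact ⟨ψ, heq_of_eq hψ⟩

namespace TwoAdjunction

variable {L : StrictPseudofunctor B C} {R : StrictPseudofunctor C B} (adj : TwoAdjunction L R)

/-- The component of the unit, as a `1`-cell `b ⟶ R (L b)`. -/
def unitAt (b : B) : b ⟶ R.obj (L.obj b) := adj.unit.app b

theorem unit_naturality {a b : B} (f : a ⟶ b) :
    f ≫ adj.unitAt b = adj.unitAt a ≫ R.map (L.map f) :=
  adj.unit.naturality f

theorem unit_naturality₂ {a b : B} {f g : a ⟶ b} (θ : f ⟶ g) :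
    θ ▷ adj.unitAt b ≍ adj.unitAt a ◁ R.map₂ (L.map₂ θ) :=
  adj.unit.naturality₂_heq θ

theorem counit_naturality {a b : C} (f : a ⟶ b) :
    L.map (R.map f) ≫ adj.counit.app b = adj.counit.app a ≫ f :=
  adj.counit.naturality f

theorem counit_naturality₂ {a b : C} {f g : a ⟶ b} (θ : f ⟶ g) :
    L.map₂ (R.map₂ θ) ▷ adj.counit.app b ≍ adj.counit.app a ◁ θ :=
  adj.counit.naturality₂_heq θ

variable [Strict B] [Strict C]

/-- The components of the unit of a `2`-adjunction are universal arrows; the inverse of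
`h ↦ u ≫ R h` is transposition `f ↦ L f ≫ ε`. -/
theorem isUniversalArrow_unit (b : B) :
    IsUniversalArrow R (adj.unitAt b) := by
  set u : ∀ b : B, b ⟶ R.obj (L.obj b) := adj.unitAt with hu
  set e : ∀ c : C, L.obj (R.obj c) ⟶ c := adj.counit.app with he
  have n : ∀ {a b : B} (f : a ⟶ b), f ≫ u b = u a ≫ R.map (L.map f) := adj.unit_naturality
  have n₂ : ∀ {a b : B} {f g : a ⟶ b} (θ : f ⟶ g), θ ▷ u b ≍ u a ◁ R.map₂ (L.map₂ θ) :=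
    adj.unit_naturality₂
  have m : ∀ {a b : C} (f : a ⟶ b), L.map (R.map f) ≫ e b = e a ≫ f := adj.counit_naturality
  have m₂ : ∀ {a b : C} {f g : a ⟶ b} (θ : f ⟶ g), L.map₂ (R.map₂ θ) ▷ e b ≍ e a ◁ θ :=
    adj.counit_naturality₂
  have tl : L.map (u b) ≫ e (L.obj b) = 𝟙 (L.obj b) := adj.left_triangle b
  have tr : ∀ c : C, u (R.obj c) ≫ R.map (e c) = 𝟙 (R.obj c) := adj.right_triangle
  have key : ∀ {d : C} (h : L.obj b ⟶ d), L.map (u b ≫ R.map h) ≫ e d = h := by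
    intro d h
    rw [L.map_comp, Strict.assoc, m, ← Strict.assoc, tl, Strict.id_comp]
  have key' : ∀ {d : C} (f : b ⟶ R.obj d), u b ≫ R.map (L.map f ≫ e d) = f := by
    intro d f
    rw [R.map_comp, ← Strict.assoc, ← n, Strict.assoc, tr, Strict.comp_id]
  refine ⟨fun {d} f => ⟨L.map f ≫ e d, key' f, ?_⟩, fun {d h k} θ => ?_⟩
  · rintro h rfl
    exact (key h).symm
  -- On `2`-cells the inverse is `θ ↦ L θ ▷ ε`, conjugated by the equalities `key`.
  · have key₂ : ∀ ψ : h ⟶ k, L.map₂ (u b ◁ R.map₂ ψ) ▷ e d ≍ ψ := by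
      intro ψ
      have h1 := map₂_whiskerLeft_heq L (u b) (R.map₂ ψ)
      have h2 := m₂ ψ
      have h3 := id_whiskerLeft_heq ψ
      have h4 := whisker_assoc_heq (L.map (u b)) (L.map₂ (R.map₂ ψ)) (e d)
      have h5 := comp_whiskerLeft_heq (L.map (u b)) (e _) ψ
      have e1 := L.map_comp (u b) (R.map h)
      have e2 := L.map_comp (u b) (R.map k)
      have e3 := m h
      have e4 := m k
      grind [Strict.assoc, Strict.id_comp]
    refine ⟨eqToHom (key h).symm ≫ L.map₂ θ ▷ e d ≫ eqToHom (key k), ?_, ?_⟩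
    · have c := conj_heq (key h).symm (L.map₂ θ ▷ e d) (key k)
      generalize eqToHom (key h).symm ≫ L.map₂ θ ▷ e d ≫ eqToHom (key k) = ψ at c
      have h1 := map₂_whiskerRight_heq R (L.map₂ θ) (e d)
      have h2 := n₂ θ
      have h3 := whiskerRight_id_heq θ
      have h4 := whisker_assoc_heq (u b) (R.map₂ (L.map₂ θ)) (R.map (e d))
      have h5 := whiskerRight_comp_heq θ (u _) (R.map (e d))
      have e1 := R.map_comp (L.map (u b ≫ R.map h)) (e d)
      have e2 := R.map_comp (L.map (u b ≫ R.map k)) (e d)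
      have e3 := n (u b ≫ R.map h)
      have e4 := n (u b ≫ R.map k)
      have e5 := key h
      have e6 := key k
      grind [Strict.assoc, Strict.comp_id]
    · rintro ψ rfl
      exact eq_of_heq ((key₂ ψ).symm.trans (conj_heq _ _ _).symm)

end TwoAdjunction

namespace IsUniversalArrow

variable [Strict B] [Strict C] {R : StrictPseudofunctor C B}

/-- Universal arrows are stable under composition with isomorphisms of the target. -/
theorem comp_iso {b : B} {c d : C} {u : b ⟶ R.obj c} (hu : IsUniversalArrow R u) {e : c ⟶ d}
    {e' : d ⟶ c} (h₁ : e ≫ e' = 𝟙 c) (h₂ : e' ≫ e = 𝟙 d) :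
    IsUniversalArrow R (u ≫ R.map e) := by
  have key : ∀ {x : C} (k : d ⟶ x), (u ≫ R.map e) ≫ R.map k = u ≫ R.map (e ≫ k) := fun k => by
    rw [R.map_comp, Strict.assoc]
  have key₂ : ∀ {x : C} {k l : d ⟶ x} (ψ : k ⟶ l),
      (u ≫ R.map e) ◁ R.map₂ ψ ≍ u ◁ R.map₂ (e ◁ ψ) := by
    intro x k l ψ
    have h1 := map₂_whiskerLeft_heq R e ψ
    have h2 := comp_whiskerLeft_heq u (R.map e) (R.map₂ ψ)
    have e1 := R.map_comp e k
    have e2 := R.map_comp e l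
    grind
  have canc : ∀ {x : C} (k : c ⟶ x), e ≫ e' ≫ k = k := fun k => by
    rw [← Strict.assoc, h₁, Strict.id_comp]
  have canc' : ∀ {x : C} (k : d ⟶ x), e' ≫ e ≫ k = k := fun k => by
    rw [← Strict.assoc, h₂, Strict.id_comp]
  have canc₂' : ∀ {x : C} {k l : d ⟶ x} (ψ : k ⟶ l), e' ◁ e ◁ ψ ≍ ψ := by
    intro x k l ψ
    have h1 := comp_whiskerLeft_heq e' e ψ
    have h2 := id_whiskerLeft_heq ψ
    grind
  have canc₂ : ∀ {x : C} {k l : c ⟶ x} (ψ : k ⟶ l), e ◁ e' ◁ ψ ≍ ψ := by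
    intro x k l ψ
    have h1 := comp_whiskerLeft_heq e e' ψ
    have h2 := id_whiskerLeft_heq ψ
    grind
  refine ⟨fun {x} f => ?_, fun {x k l} θ => ?_⟩
  · obtain ⟨h, rfl, -⟩ := hu.lift_unique f
    refine ⟨e' ≫ h, (key _).trans (by rw [canc]), fun k hk => ?_⟩
    rw [← hu.hom_ext ((key _).symm.trans hk), canc']
  · obtain ⟨ψ, hψ⟩ := hu.exists_map₂_heq (key k).symm (key l).symm θ
    refine ⟨eqToHom (canc' k).symm ≫ e' ◁ ψ ≫ eqToHom (canc' l), ?_, fun ψ' h' => ?_⟩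
    · have c := conj_heq (canc' k).symm (e' ◁ ψ) (canc' l)
      generalize eqToHom (canc' k).symm ≫ e' ◁ ψ ≫ eqToHom (canc' l) = χ at c
      have h1 := key₂ χ
      have h2 := canc₂ ψ
      have e1 := canc' k
      have e2 := canc' l
      grind
    · have c := conj_heq (canc' k).symm (e' ◁ ψ) (canc' l)
      generalize eqToHom (canc' k).symm ≫ e' ◁ ψ ≫ eqToHom (canc' l) = χ at c
      have h1 := key₂ ψ'
      have h3 : e ◁ ψ' = ψ := hu.hom₂_ext (by subst h'; exact eq_of_heq (h1.symm.trans hψ.symm))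
      have h2 := canc₂' ψ'
      grind

/-- Universal arrows from the same `0`-cell differ by an isomorphism. -/
theorem exists_iso {b : B} {c d : C} {u : b ⟶ R.obj c} {v : b ⟶ R.obj d}
    (hu : IsUniversalArrow R u) (hv : IsUniversalArrow R v) :
    ∃ (e : c ⟶ d) (e' : d ⟶ c), e ≫ e' = 𝟙 c ∧ e' ≫ e = 𝟙 d ∧ u ≫ R.map e = v := by
  obtain ⟨e, he, -⟩ := hu.lift_unique v
  obtain ⟨e', he', -⟩ := hv.lift_unique u
  refine ⟨e, e', hu.hom_ext ?_, hv.hom_ext ?_, he⟩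
  · rw [R.map_comp, R.map_id, ← Strict.assoc, he, he', Strict.comp_id]
  · rw [R.map_comp, R.map_id, ← Strict.assoc, he', he, Strict.comp_id]

section LeftAdjoint

variable {obj : B → C} {u : ∀ b, b ⟶ R.obj (obj b)} (hu : ∀ b, IsUniversalArrow R (u b))

/-- The action on `1`-cells of the left `2`-adjoint determined by universal arrows. -/
noncomputable def leftMap {a b : B} (f : a ⟶ b) : obj a ⟶ obj b :=
  ((hu a).lift_unique (f ≫ u b)).choose

theorem leftMap_spec {a b : B} (f : a ⟶ b) : u a ≫ R.map (leftMap hu f) = f ≫ u b :=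
  ((hu a).lift_unique (f ≫ u b)).choose_spec.1

/-- The action on `2`-cells of the left `2`-adjoint determined by universal arrows. -/
noncomputable def leftMap₂ {a b : B} {f g : a ⟶ b} (θ : f ⟶ g) : leftMap hu f ⟶ leftMap hu g :=
  ((hu a).exists_map₂_heq (leftMap_spec hu f) (leftMap_spec hu g) (θ ▷ u b)).choose

theorem leftMap₂_spec {a b : B} {f g : a ⟶ b} (θ : f ⟶ g) :
    u a ◁ R.map₂ (leftMap₂ hu θ) ≍ θ ▷ u b :=
  ((hu a).exists_map₂_heq (leftMap_spec hu f) (leftMap_spec hu g) (θ ▷ u b)).choose_spec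

theorem leftMap_id (a : B) : leftMap hu (𝟙 a) = 𝟙 (obj a) :=
  (hu a).hom_ext (by rw [leftMap_spec, R.map_id, Strict.id_comp, Strict.comp_id])

theorem leftMap_comp {a b c : B} (f : a ⟶ b) (g : b ⟶ c) :
    leftMap hu (f ≫ g) = leftMap hu f ≫ leftMap hu g :=
  (hu a).hom_ext (by
    rw [leftMap_spec, R.map_comp, ← Strict.assoc, leftMap_spec, Strict.assoc, Strict.assoc,
      leftMap_spec])

/-- The left `2`-adjoint determined by universal arrows. -/
noncomputable def leftAdjoint : StrictPseudofunctor B C :=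
  StrictPseudofunctor.mk''
    { obj := obj
      map := leftMap hu
      map₂ := leftMap₂ hu
      map₂_id := fun {a b} f => (hu a).hom₂_ext (eq_of_heq (by
        refine (leftMap₂_spec hu _).trans ?_
        rw [id_whiskerRight, R.map₂_id, whiskerLeft_id, leftMap_spec]))
      map₂_comp := fun {a b f g h} θ θ' => (hu a).hom₂_ext (eq_of_heq (by
        refine (leftMap₂_spec hu _).trans ?_
        rw [comp_whiskerRight, R.map₂_comp, whiskerLeft_comp]
        exact comp_heq (leftMap_spec hu _).symm (leftMap_spec hu _).symm (leftMap_spec hu _).symm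
          (leftMap₂_spec hu _).symm (leftMap₂_spec hu _).symm))
      map_id := leftMap_id hu
      map_comp := leftMap_comp hu
      map₂_whisker_left := fun {a b c} f g h θ => (hu a).hom₂_ext (eq_of_heq (by
        have c := conj_heq (leftMap_comp hu f g) (leftMap hu f ◁ leftMap₂ hu θ)
          (leftMap_comp hu f h).symm
        generalize eqToHom (leftMap_comp hu f g) ≫ leftMap hu f ◁ leftMap₂ hu θ ≫
          eqToHom (leftMap_comp hu f h).symm = χ at c
        have h1 := leftMap₂_spec hu (f ◁ θ)
        have h2 := leftMap₂_spec hu θ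
        have h3 := map₂_whiskerLeft_heq R (leftMap hu f) (leftMap₂ hu θ)
        have h4 := comp_whiskerLeft_heq (u a) (R.map (leftMap hu f)) (R.map₂ (leftMap₂ hu θ))
        have h5 := comp_whiskerLeft_heq f (u _) (R.map₂ (leftMap₂ hu θ))
        have h6 := whisker_assoc_heq f θ (u _)
        have e0 := leftMap_spec hu f
        have e1 := leftMap_comp hu f g
        have e2 := leftMap_comp hu f h
        have e3 := R.map_comp (leftMap hu f) (leftMap hu g)
        have e4 := R.map_comp (leftMap hu f) (leftMap hu h)
        have e5 := leftMap_spec hu g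
        have e6 := leftMap_spec hu h
        grind [Strict.assoc]))
      map₂_whisker_right := fun {a b c f g} θ h => (hu a).hom₂_ext (eq_of_heq (by
        have c := conj_heq (leftMap_comp hu f h) (leftMap₂ hu θ ▷ leftMap hu h)
          (leftMap_comp hu g h).symm
        generalize eqToHom (leftMap_comp hu f h) ≫ leftMap₂ hu θ ▷ leftMap hu h ≫
          eqToHom (leftMap_comp hu g h).symm = χ at c
        have h1 := leftMap₂_spec hu (θ ▷ h)
        have h2 := leftMap₂_spec hu θ
        have h3 := map₂_whiskerRight_heq R (leftMap₂ hu θ) (leftMap hu h)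
        have h4 := whisker_assoc_heq (u a) (R.map₂ (leftMap₂ hu θ)) (R.map (leftMap hu h))
        have h5 := whiskerRight_comp_heq θ (u _) (R.map (leftMap hu h))
        have h6 := whiskerRight_comp_heq θ h (u _)
        have e0 := leftMap_spec hu f
        have e1 := leftMap_comp hu f h
        have e2 := leftMap_comp hu g h
        have e3 := R.map_comp (leftMap hu f) (leftMap hu h)
        have e4 := R.map_comp (leftMap hu g) (leftMap hu h)
        have e5 := leftMap_spec hu g
        have e6 := leftMap_spec hu h
        grind [Strict.assoc])) }

/-- The counit of the `2`-adjunction determined by universal arrows. -/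
noncomputable def counitApp (c : C) : obj (R.obj c) ⟶ c :=
  ((hu (R.obj c)).lift_unique (𝟙 (R.obj c))).choose

theorem counitApp_spec (c : C) : u (R.obj c) ≫ R.map (counitApp hu c) = 𝟙 (R.obj c) :=
  ((hu (R.obj c)).lift_unique (𝟙 (R.obj c))).choose_spec.1

theorem counitApp_naturality {c d : C} (f : c ⟶ d) :
    leftMap hu (R.map f) ≫ counitApp hu d = counitApp hu c ≫ f :=
  (hu _).hom_ext (by
    rw [R.map_comp, ← Strict.assoc, leftMap_spec, Strict.assoc, counitApp_spec, R.map_comp,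
      ← Strict.assoc, counitApp_spec, Strict.id_comp, Strict.comp_id])

theorem counitApp_naturality₂ {c d : C} {f g : c ⟶ d} (θ : f ⟶ g) :
    leftMap₂ hu (R.map₂ θ) ▷ counitApp hu d ≍ counitApp hu c ◁ θ := by
  have e1 := counitApp_naturality hu f
  have e2 := counitApp_naturality hu g
  refine HEq.trans (conj_heq e1.symm _ e2).symm (heq_of_eq ?_)
  have c1 := conj_heq e1.symm (leftMap₂ hu (R.map₂ θ) ▷ counitApp hu d) e2
  generalize eqToHom e1.symm ≫ leftMap₂ hu (R.map₂ θ) ▷ counitApp hu d ≫ eqToHom e2 = χ at c1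
  refine (hu _).hom₂_ext (eq_of_heq ?_)
  have h1 := map₂_whiskerRight_heq R (leftMap₂ hu (R.map₂ θ)) (counitApp hu d)
  have h2 := map₂_whiskerLeft_heq R (counitApp hu c) θ
  have h3 := leftMap₂_spec hu (R.map₂ θ)
  have h4 := whisker_assoc_heq (u _) (R.map₂ (leftMap₂ hu (R.map₂ θ))) (R.map (counitApp hu d))
  have h5 := whiskerRight_comp_heq (R.map₂ θ) (u _) (R.map (counitApp hu d))
  have h6 := comp_whiskerLeft_heq (u _) (R.map (counitApp hu c)) (R.map₂ θ)
  have h7 := id_whiskerLeft_heq (R.map₂ θ)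
  have h8 := whiskerRight_id_heq (R.map₂ θ)
  have e3 := counitApp_spec hu c
  have e4 := counitApp_spec hu d
  have e5 := R.map_comp (counitApp hu c) f
  have e6 := R.map_comp (counitApp hu c) g
  have e7 := R.map_comp (leftMap hu (R.map f)) (counitApp hu d)
  have e8 := R.map_comp (leftMap hu (R.map g)) (counitApp hu d)
  have e9 := leftMap_spec hu (R.map f)
  have e10 := leftMap_spec hu (R.map g)
  grind [Strict.assoc]

/-- A choice of universal arrows from all `0`-cells to `R` determines a left `2`-adjoint. -/
noncomputable def adjunction : TwoAdjunction (leftAdjoint hu) R where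
  unit :=
    { app := u
      naturality := fun f => (leftMap_spec hu f).symm
      naturality₂ := fun θ => naturality₂_of_heq _ _ (leftMap₂_spec hu θ).symm }
  counit :=
    { app := counitApp hu
      naturality := counitApp_naturality hu
      naturality₂ := fun θ => naturality₂_of_heq _ _ (counitApp_naturality₂ hu θ) }
  left_triangle b := (hu b).hom_ext (by
    change u b ≫ R.map (leftMap hu (u b) ≫ counitApp hu (obj b)) = u b ≫ R.map (𝟙 (obj b))
    rw [R.map_comp, ← Strict.assoc, leftMap_spec, Strict.assoc, counitApp_spec, R.map_id])
  right_triangle := counitApp_spec hu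

end LeftAdjoint

end IsUniversalArrow

end UniversalArrows

/-! ### Coherence in strict bicategories -/

section StrictCoherence

variable {D : Type u} [Bicategory.{w, v} D] [Strict D]

theorem leftUnitor_hom_heq {a b : D} (f : a ⟶ b) : (λ_ f).hom ≍ 𝟙 f := by
  rw [Strict.leftUnitor_eqToIso]
  exact eqToHom_heq (Strict.id_comp f) rfl (Strict.id_comp f)

theorem rightUnitor_hom_heq {a b : D} (f : a ⟶ b) : (ρ_ f).hom ≍ 𝟙 f := by
  rw [Strict.rightUnitor_eqToIso]
  exact eqToHom_heq (Strict.comp_id f) rfl (Strict.comp_id f)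

theorem associator_hom_comp_heq {a b c d : D} (f : a ⟶ b) (g : b ⟶ c) (h : c ⟶ d) {k : a ⟶ d}
    (θ : f ≫ g ≫ h ⟶ k) : (α_ f g h).hom ≫ θ ≍ θ :=
  id_comp_heq (Strict.assoc f g h) θ (by rw [Strict.associator_eqToIso]; rfl)

theorem associator_inv_comp_heq {a b c d : D} (f : a ⟶ b) (g : b ⟶ c) (h : c ⟶ d) {k : a ⟶ d}
    (θ : (f ≫ g) ≫ h ⟶ k) : (α_ f g h).inv ≫ θ ≍ θ :=
  id_comp_heq (Strict.assoc f g h).symm θ (by rw [Strict.associator_eqToIso]; rfl)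

theorem comp_associator_inv_heq {a b c d : D} (f : a ⟶ b) (g : b ⟶ c) (h : c ⟶ d) {k : a ⟶ d}
    (θ : k ⟶ f ≫ g ≫ h) : θ ≫ (α_ f g h).inv ≍ θ :=
  comp_id_heq (Strict.assoc f g h).symm θ (by rw [Strict.associator_eqToIso]; rfl)

theorem leftUnitor_inv_comp_heq {a b : D} (f : a ⟶ b) {k : a ⟶ b}
    (θ : 𝟙 a ≫ f ⟶ k) : (λ_ f).inv ≫ θ ≍ θ :=
  id_comp_heq (Strict.id_comp f).symm θ (by rw [Strict.leftUnitor_eqToIso]; rfl)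

theorem rightUnitor_inv_comp_heq {a b : D} (f : a ⟶ b) {k : a ⟶ b}
    (θ : f ≫ 𝟙 b ⟶ k) : (ρ_ f).inv ≫ θ ≍ θ :=
  id_comp_heq (Strict.comp_id f).symm θ (by rw [Strict.rightUnitor_eqToIso]; rfl)

/-- Retyping of a `2`-cell along equalities of its source and target. -/
theorem exists_heq {a b : D} {f g f' g' : a ⟶ b} (p : f = f') (q : g = g') (σ : f ⟶ g) :
    ∃ σ' : f' ⟶ g', σ' ≍ σ := by
  subst p q
  exact ⟨σ, HEq.rfl⟩

end StrictCoherence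

namespace MndOp

variable {D : Type u} [Bicategory.{w, v} D]

theorem τ_heq_of_eq {M N : MndOp D} {f g : Hom M N} (h : f = g) : f.τ ≍ g.τ := by
  cases h; rfl

variable [Strict D]

theorem Hom.heq_η {M N : MndOp D} (f : Hom M N) : M.η ▷ f.F ≫ f.τ ≍ f.F ◁ N.η := by
  have h := f.τ_η
  have h1 := leftUnitor_inv_comp_heq _ (M.η ▷ f.F ≫ f.τ)
  have h2 := rightUnitor_inv_comp_heq _ (f.F ◁ N.η)
  grind

/-- The structure `2`-cell of a composite of oplax morphisms, with the two whiskered factors retyped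
so that they compose without associators. -/
theorem Hom.heq_comp_τ {M N P : MndOp D} (f : Hom M N) (g : Hom N P) {k : M.C ⟶ P.C}
    {σ : M.S ≫ f.F ≫ g.F ⟶ k} {σ' : k ⟶ f.F ≫ g.F ≫ P.S} (h : k = f.F ≫ N.S ≫ g.F)
    (h1 : σ ≍ f.τ ▷ g.F) (h2 : σ' ≍ f.F ◁ g.τ) : (f.comp g).τ ≍ σ ≫ σ' := by
  subst h
  have e := Hom.comp_τ f g
  have c1 := associator_inv_comp_heq M.S f.F g.F (f.τ ▷ g.F ≫ (α_ f.F N.S g.F).hom ≫ f.F ◁ g.τ ≫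
    (α_ f.F g.F P.S).inv)
  have c2 := associator_hom_comp_heq f.F N.S g.F (f.F ◁ g.τ ≫ (α_ f.F g.F P.S).inv)
  have c3 := comp_associator_inv_heq f.F g.F P.S (f.F ◁ g.τ)
  grind [Strict.assoc]

/-- The multiplicativity equation with the two composable factors retyped along strict
associativity. -/
theorem hom_τ_μ_iff {M N : MndOp D} {F : M.C ⟶ N.C} {τ : M.S ≫ F ⟶ F ≫ N.S}
    {σ : M.S ≫ M.S ≫ F ⟶ (M.S ≫ F) ≫ N.S} {σ' : (M.S ≫ F) ≫ N.S ⟶ F ≫ N.S ≫ N.S}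
    (h1 : σ ≍ M.S ◁ τ) (h2 : σ' ≍ τ ▷ N.S) : (M.μ ▷ F ≫ τ = (α_ M.S M.S F).hom ≫ M.S ◁ τ ≫
      (α_ M.S F N.S).inv ≫ τ ▷ N.S ≫ (α_ F N.S N.S).hom ≫ F ◁ N.μ) ↔
      M.μ ▷ F ≫ τ ≍ σ ≫ σ' ≫ F ◁ N.μ := by
  have c1 := associator_hom_comp_heq M.S M.S F (M.S ◁ τ ≫
      (α_ M.S F N.S).inv ≫ τ ▷ N.S ≫ (α_ F N.S N.S).hom ≫ F ◁ N.μ)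
  have c2 := associator_inv_comp_heq M.S F N.S (τ ▷ N.S ≫ (α_ F N.S N.S).hom ≫ F ◁ N.μ)
  have c3 := associator_hom_comp_heq F N.S N.S (F ◁ N.μ)
  have : (α_ M.S M.S F).hom ≫ M.S ◁ τ ≫
      (α_ M.S F N.S).inv ≫ τ ▷ N.S ≫ (α_ F N.S N.S).hom ≫ F ◁ N.μ ≍ σ ≫ σ' ≫ F ◁ N.μ := by
    grind [Strict.assoc]
  constructor
  · intro h; exact (heq_of_eq h).trans this
  · intro h; exact eq_of_heq (h.trans this.symm)

end MndOp

/-! ### Products of monads -/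

namespace FiniteProducts

variable {D : Type u} [Bicategory.{w, v} D] [FiniteProducts D]

/-- The `2`-cell into a product with the given components, whose sources and targets are allowed to
be only propositionally the projections of the `1`-cells it lies between. -/
noncomputable def mkHom₂ {X A B : D} {h k : X ⟶ prod A B} {f f' : X ⟶ A} {g g' : X ⟶ B}
    (p : h ≫ fst A B = f) (p' : k ≫ fst A B = f') (q : h ≫ snd A B = g) (q' : k ≫ snd A B = g')
    (σ : f ⟶ f') (τ : g ⟶ g') : h ⟶ k :=
  ((isBinaryProduct A B).lift₂_unique (eqToHom p ≫ σ ≫ eqToHom p'.symm)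
    (eqToHom q ≫ τ ≫ eqToHom q'.symm)).choose

variable {X A B : D} {h k : X ⟶ prod A B} {f f' : X ⟶ A} {g g' : X ⟶ B}
    (p : h ≫ fst A B = f) (p' : k ≫ fst A B = f') (q : h ≫ snd A B = g) (q' : k ≫ snd A B = g')
    (σ : f ⟶ f') (τ : g ⟶ g')

theorem mkHom₂_fst : mkHom₂ p p' q q' σ τ ▷ fst A B ≍ σ := by
  rw [mkHom₂, ((isBinaryProduct A B).lift₂_unique _ _).choose_spec.1.1]
  exact conj_heq _ _ _

theorem mkHom₂_snd : mkHom₂ p p' q q' σ τ ▷ snd A B ≍ τ := by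
  rw [mkHom₂, ((isBinaryProduct A B).lift₂_unique _ _).choose_spec.1.2]
  exact conj_heq _ _ _

/-- The `2`-cell between two `1`-cells into the terminal `0`-cell. -/
noncomputable def bang₂ {X : D} (f g : X ⟶ one) : f ⟶ g :=
  (isTerminal_one.unique_hom₂ f g).some.default

theorem bang₂_ext {X : D} {f g : X ⟶ one} (σ τ : f ⟶ g) : σ = τ := by
  have := (isTerminal_one.unique_hom₂ f g).some
  exact Subsingleton.elim σ τ

end FiniteProducts

namespace MndOp

open FiniteProducts

variable {D : Type u} [Bicategory.{w, v} D] [Strict D]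

/-- The unit laws are transported along a `1`-cell that commutes strictly with the data. -/
theorem unit_laws_of_strict_hom {A P : D} (p : P ⟶ A) {S : P ⟶ P} {η : 𝟙 P ⟶ S} {μ : S ≫ S ⟶ S}
    {T : A ⟶ A} {η' : 𝟙 A ⟶ T} {μ' : T ≫ T ⟶ T} (hS : S ≫ p = p ≫ T) (hη : η ▷ p ≍ p ◁ η')
    (hμ : μ ▷ p ≍ p ◁ μ') :
    (η ▷ S ≫ μ) ▷ p ≍ p ◁ (η' ▷ T ≫ μ') ∧ (S ◁ η ≫ μ) ▷ p ≍ p ◁ (T ◁ η' ≫ μ') := by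
  have a1 := whiskerRight_comp_heq η S p
  have a2 := whiskerRight_comp_heq η p T
  have a3 := whisker_assoc_heq p η' T
  have a4 := whisker_assoc_heq S η p
  have a5 := comp_whiskerLeft_heq S p η'
  have a6 := comp_whiskerLeft_heq p T η'
  rw [comp_whiskerRight, comp_whiskerRight, whiskerLeft_comp, whiskerLeft_comp]
  constructor <;> grind [Strict.assoc, Strict.comp_id, Strict.id_comp]

/-- The two sides of the associativity law are transported along a `1`-cell that commutes strictly
with the data. -/
theorem assoc_law_of_strict_hom {A P : D} (p : P ⟶ A) {S : P ⟶ P} {μ : S ≫ S ⟶ S}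
    {T : A ⟶ A} {μ' : T ≫ T ⟶ T} (hS : S ≫ p = p ≫ T) (hμ : μ ▷ p ≍ p ◁ μ') :
    (μ ▷ S ≫ μ) ▷ p ≍ p ◁ (μ' ▷ T ≫ μ') ∧
      ((α_ S S S).hom ≫ S ◁ μ ≫ μ) ▷ p ≍ p ◁ ((α_ T T T).hom ≫ T ◁ μ' ≫ μ') := by
  have a1 := whiskerRight_comp_heq μ S p
  have a2 := whiskerRight_comp_heq μ p T
  have a3 := whisker_assoc_heq p μ' T
  have a4 := whisker_assoc_heq S μ p
  have a5 := comp_whiskerLeft_heq S p μ'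
  have a6 := comp_whiskerLeft_heq p T μ'
  have hSS : (S ≫ S) ≫ p = p ≫ T ≫ T := by
    rw [Strict.assoc, hS, ← Strict.assoc, hS, Strict.assoc]
  obtain ⟨σ, hσ⟩ := exists_heq (Strict.assoc S S S).symm rfl (S ◁ μ)
  obtain ⟨σ', hσ'⟩ := exists_heq (Strict.assoc T T T).symm rfl (T ◁ μ')
  have c1 : (α_ S S S).hom ≫ S ◁ μ ≫ μ = σ ≫ μ := eq_of_heq
    ((associator_hom_comp_heq _ _ _ _).trans
      (comp_heq (Strict.assoc S S S).symm rfl rfl hσ.symm HEq.rfl))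
  have c2 : (α_ T T T).hom ≫ T ◁ μ' ≫ μ' = σ' ≫ μ' := eq_of_heq
    ((associator_hom_comp_heq _ _ _ _).trans
      (comp_heq (Strict.assoc T T T).symm rfl rfl hσ'.symm HEq.rfl))
  rw [c1, c2, comp_whiskerRight, comp_whiskerRight, whiskerLeft_comp, whiskerLeft_comp]
  constructor <;> grind [Strict.assoc]

theorem leftUnitor_of_strict_hom {A P : D} (p : P ⟶ A) {S : P ⟶ P} {T : A ⟶ A}
    (hS : S ≫ p = p ≫ T) : (λ_ S).hom ▷ p ≍ p ◁ (λ_ T).hom := by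
  have a1 := whiskerRight_heq (Strict.id_comp S) rfl (rfl : p = p) (leftUnitor_hom_heq S)
  have a2 := whiskerLeft_heq (rfl : p = p) (Strict.id_comp T) rfl (leftUnitor_hom_heq T)
  rw [id_whiskerRight] at a1
  rw [whiskerLeft_id] at a2
  exact a1.trans ((id_heq hS).trans a2.symm)

theorem rightUnitor_of_strict_hom {A P : D} (p : P ⟶ A) {S : P ⟶ P} {T : A ⟶ A}
    (hS : S ≫ p = p ≫ T) : (ρ_ S).hom ▷ p ≍ p ◁ (ρ_ T).hom := by
  have a1 := whiskerRight_heq (Strict.comp_id S) rfl (rfl : p = p) (rightUnitor_hom_heq S)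
  have a2 := whiskerLeft_heq (rfl : p = p) (Strict.comp_id T) rfl (rightUnitor_hom_heq T)
  rw [id_whiskerRight] at a1
  rw [whiskerLeft_id] at a2
  exact a1.trans ((id_heq hS).trans a2.symm)

/-- A `1`-cell that commutes strictly with the data of two monads, as an oplax morphism. -/
def homOfStrict {P A : MndOp D} (p : P.C ⟶ A.C) (hS : P.S ≫ p = p ≫ A.S) (hη : P.η ▷ p ≍ p ◁ A.η)
    (hμ : P.μ ▷ p ≍ p ◁ A.μ) : Hom P A where
  F := p
  τ := eqToHom hS
  τ_η := by
    have c1 := leftUnitor_inv_comp_heq _ (P.η ▷ p ≫ eqToHom hS)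
    have c2 := rightUnitor_inv_comp_heq _ (p ◁ A.η)
    have c3 := comp_id_heq hS (P.η ▷ p) rfl
    exact eq_of_heq (c1.trans (c3.trans (hη.trans c2.symm)))
  τ_μ := by
    have hSS : P.S ≫ P.S ≫ p = (P.S ≫ p) ≫ A.S := by rw [hS, ← Strict.assoc, hS]
    have hSS' : (P.S ≫ p) ≫ A.S = p ≫ A.S ≫ A.S := by rw [hS, Strict.assoc]
    refine (hom_τ_μ_iff (σ := eqToHom hSS) (σ' := eqToHom hSS') ?_ ?_).2 ?_
    · rw [whiskerLeft_eqToHom]; exact eqToHom_heq _ _ rfl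
    · rw [eqToHom_whiskerRight]; exact eqToHom_heq _ _ rfl
    · exact (comp_id_heq hS (P.μ ▷ p) rfl).trans
        (hμ.trans (eqToHom_eqToHom_comp_heq hSS hSS' _).symm)

theorem comp_homOfStrict_τ {Z P A : MndOp D} (f : Hom Z P) (p : P.C ⟶ A.C)
    (hS : P.S ≫ p = p ≫ A.S) (hη : P.η ▷ p ≍ p ◁ A.η) (hμ : P.μ ▷ p ≍ p ◁ A.μ) :
    (f.comp (homOfStrict p hS hη hμ)).τ ≍ f.τ ▷ p := by
  have e : f.F ≫ P.S ≫ p = f.F ≫ p ≫ A.S := by rw [hS]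
  obtain ⟨σ, hσ⟩ := exists_heq (Strict.assoc Z.S f.F p) (Strict.assoc f.F P.S p) (f.τ ▷ p)
  refine (Hom.heq_comp_τ f (homOfStrict p hS hη hμ) (σ' := eqToHom e) rfl hσ ?_).trans
    ((comp_id_heq e _ rfl).trans hσ)
  change _ ≍ f.F ◁ eqToHom hS
  rw [whiskerLeft_eqToHom]; exact eqToHom_heq _ _ rfl

/-- The unit law of an oplax morphism into `P` holds after whiskering with a `1`-cell `p` that
commutes strictly with the data, if the composite with `p` underlies an oplax morphism. For `p` the
two projections of a product, this yields the unit law of a pairing. -/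
theorem η_law_along_strict_hom {Z P A : MndOp D} {p : P.C ⟶ A.C} (hS : P.S ≫ p = p ≫ A.S)
    (hη : P.η ▷ p ≍ p ◁ A.η) {F : Z.C ⟶ P.C} {τ : Z.S ≫ F ⟶ F ≫ P.S} (f : Hom Z A)
    (hF : F ≫ p = f.F) (hτ : τ ▷ p ≍ f.τ) :
    (Z.η ▷ F ≫ τ) ▷ p ≍ (F ◁ P.η) ▷ p := by
  have h := f.heq_η
  have a1 := whiskerRight_comp_heq Z.η F p
  have a2 := whisker_assoc_heq F P.η p
  have a3 := comp_whiskerLeft_heq F p A.η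
  rw [comp_whiskerRight]
  grind [Strict.assoc, Strict.comp_id, Strict.id_comp]

/-- The analogue of `η_law_along_strict_hom` for the multiplicativity law. -/
theorem μ_law_along_strict_hom {Z P A : MndOp D} {p : P.C ⟶ A.C} (hS : P.S ≫ p = p ≫ A.S)
    (hμ : P.μ ▷ p ≍ p ◁ A.μ) {F : Z.C ⟶ P.C} {τ : Z.S ≫ F ⟶ F ≫ P.S}
    {σ : Z.S ≫ Z.S ≫ F ⟶ (Z.S ≫ F) ≫ P.S} {σ' : (Z.S ≫ F) ≫ P.S ⟶ F ≫ P.S ≫ P.S}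
    (h1 : σ ≍ Z.S ◁ τ) (h2 : σ' ≍ τ ▷ P.S) (f : Hom Z A)
    (hF : F ≫ p = f.F) (hτ : τ ▷ p ≍ f.τ) :
    (Z.μ ▷ F ≫ τ) ▷ p ≍ (σ ≫ σ' ≫ F ◁ P.μ) ▷ p := by
  obtain ⟨ω, hω⟩ := exists_heq rfl (Strict.assoc Z.S f.F A.S).symm (Z.S ◁ f.τ)
  obtain ⟨ω', hω'⟩ := exists_heq rfl (Strict.assoc f.F A.S A.S) (f.τ ▷ A.S)
  have h := (hom_τ_μ_iff hω hω').1 f.τ_μ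
  have a1 := whiskerRight_comp_heq Z.μ F p
  have a2 := whisker_assoc_heq F P.μ p
  have a3 := comp_whiskerLeft_heq F p A.μ
  have a4 := whisker_assoc_heq Z.S τ p
  have a5 := whiskerRight_comp_heq τ P.S p
  have a6 := whiskerRight_comp_heq τ p A.S
  rw [comp_whiskerRight, comp_whiskerRight, comp_whiskerRight]
  grind [Strict.assoc]

/-- The analogue of `η_law_along_strict_hom` for the equation of a transformation. -/
theorem comm_along_strict_hom {Z P A : MndOp D} {p : P.C ⟶ A.C} (hS : P.S ≫ p = p ≫ A.S)
    (hη : P.η ▷ p ≍ p ◁ A.η) (hμ : P.μ ▷ p ≍ p ◁ A.μ) {h k : Hom Z P} (θ : h.F ⟶ k.F)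
    (σ : Hom₂ (h.comp (homOfStrict p hS hη hμ)) (k.comp (homOfStrict p hS hη hμ)))
    (hσ : θ ▷ p = σ.σ) : (Z.S ◁ θ ≫ k.τ) ▷ p = (h.τ ≫ θ ▷ P.S) ▷ p := by
  have c := σ.comm
  rw [← hσ] at c
  have e : ∀ t : Z.C ⟶ P.C, (t ≫ p) ≫ A.S = (t ≫ P.S) ≫ p := fun t => by
    rw [Strict.assoc, ← hS, Strict.assoc]
  rw [comp_whiskerRight, comp_whiskerRight]
  apply eq_of_heq
  exact (comp_heq (Strict.assoc _ _ _) (Strict.assoc _ _ _) (e _).symm (whisker_assoc_heq _ _ _)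
    (comp_homOfStrict_τ k p hS hη hμ).symm).trans ((heq_of_eq c).trans
      (comp_heq (Strict.assoc _ _ _).symm (e _) (e _) (comp_homOfStrict_τ h p hS hη hμ)
        ((whiskerRight_comp_heq _ _ _).symm.trans ((whiskerRight_heq rfl rfl hS.symm HEq.rfl).trans
          (whiskerRight_comp_heq _ _ _)))))

variable [FiniteProducts D] (M N : MndOp D)

/-- The underlying `1`-cell `S × T` of the product of two monads. -/
noncomputable def prodS : prod M.C N.C ⟶ prod M.C N.C :=
  lift (fst M.C N.C ≫ M.S) (snd M.C N.C ≫ N.S)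

theorem prodS_fst : prodS M N ≫ fst M.C N.C = fst M.C N.C ≫ M.S := lift_fst _ _

theorem prodS_snd : prodS M N ≫ snd M.C N.C = snd M.C N.C ≫ N.S := lift_snd _ _

theorem prodS_prodS_fst : (prodS M N ≫ prodS M N) ≫ fst M.C N.C = fst M.C N.C ≫ M.S ≫ M.S := by
  rw [Strict.assoc, prodS_fst, ← Strict.assoc, prodS_fst, Strict.assoc]

theorem prodS_prodS_snd : (prodS M N ≫ prodS M N) ≫ snd M.C N.C = snd M.C N.C ≫ N.S ≫ N.S := by
  rw [Strict.assoc, prodS_snd, ← Strict.assoc, prodS_snd, Strict.assoc]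

/-- The unit of the product of two monads. -/
noncomputable def prodη : 𝟙 (prod M.C N.C) ⟶ prodS M N :=
  mkHom₂ ((Strict.id_comp _).trans (Strict.comp_id _).symm) (prodS_fst M N)
    ((Strict.id_comp _).trans (Strict.comp_id _).symm) (prodS_snd M N)
    (fst M.C N.C ◁ M.η) (snd M.C N.C ◁ N.η)

theorem prodη_fst : prodη M N ▷ fst M.C N.C ≍ fst M.C N.C ◁ M.η := mkHom₂_fst ..

theorem prodη_snd : prodη M N ▷ snd M.C N.C ≍ snd M.C N.C ◁ N.η := mkHom₂_snd ..

/-- The multiplication of the product of two monads. -/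
noncomputable def prodμ : prodS M N ≫ prodS M N ⟶ prodS M N :=
  mkHom₂ (prodS_prodS_fst M N) (prodS_fst M N) (prodS_prodS_snd M N) (prodS_snd M N)
    (fst M.C N.C ◁ M.μ) (snd M.C N.C ◁ N.μ)

theorem prodμ_fst : prodμ M N ▷ fst M.C N.C ≍ fst M.C N.C ◁ M.μ := mkHom₂_fst ..

theorem prodμ_snd : prodμ M N ▷ snd M.C N.C ≍ snd M.C N.C ◁ N.μ := mkHom₂_snd ..

/-- An equation between `2`-cells into the product monad holds if both sides are carried by the
projections to the sides of equations that hold in the two factors. -/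
theorem prodS_law_ext {h : prod M.C N.C ⟶ prod M.C N.C} {σ τ : h ⟶ prodS M N}
    {a : M.C ⟶ M.C} {σ₁ τ₁ : a ⟶ M.S} {b : N.C ⟶ N.C} {σ₂ τ₂ : b ⟶ N.S}
    (h1 : σ ▷ fst M.C N.C ≍ fst M.C N.C ◁ σ₁) (h1' : τ ▷ fst M.C N.C ≍ fst M.C N.C ◁ τ₁)
    (e1 : σ₁ = τ₁) (h2 : σ ▷ snd M.C N.C ≍ snd M.C N.C ◁ σ₂)
    (h2' : τ ▷ snd M.C N.C ≍ snd M.C N.C ◁ τ₂) (e2 : σ₂ = τ₂) : σ = τ := by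
  subst e1 e2
  exact FiniteProducts.hom₂_ext (eq_of_heq (h1.trans h1'.symm)) (eq_of_heq (h2.trans h2'.symm))

/-- The product of two monads. -/
noncomputable def prodMonad : MndOp D where
  C := prod M.C N.C
  S := prodS M N
  η := prodη M N
  μ := prodμ M N
  η_left := prodS_law_ext M N
    (unit_laws_of_strict_hom _ (prodS_fst M N) (prodη_fst M N) (prodμ_fst M N)).1
    (leftUnitor_of_strict_hom _ (prodS_fst M N)) M.η_left
    (unit_laws_of_strict_hom _ (prodS_snd M N) (prodη_snd M N) (prodμ_snd M N)).1
    (leftUnitor_of_strict_hom _ (prodS_snd M N)) N.η_left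
  η_right := prodS_law_ext M N
    (unit_laws_of_strict_hom _ (prodS_fst M N) (prodη_fst M N) (prodμ_fst M N)).2
    (rightUnitor_of_strict_hom _ (prodS_fst M N)) M.η_right
    (unit_laws_of_strict_hom _ (prodS_snd M N) (prodη_snd M N) (prodμ_snd M N)).2
    (rightUnitor_of_strict_hom _ (prodS_snd M N)) N.η_right
  μ_assoc := prodS_law_ext M N
    (assoc_law_of_strict_hom _ (prodS_fst M N) (prodμ_fst M N)).1
    (assoc_law_of_strict_hom _ (prodS_fst M N) (prodμ_fst M N)).2 M.μ_assoc
    (assoc_law_of_strict_hom _ (prodS_snd M N) (prodμ_snd M N)).1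
    (assoc_law_of_strict_hom _ (prodS_snd M N) (prodμ_snd M N)).2 N.μ_assoc

/-- The first projection of a product of monads. -/
noncomputable def prodFst : Hom (prodMonad M N) M :=
  homOfStrict (P := prodMonad M N) (fst M.C N.C) (prodS_fst M N) (prodη_fst M N) (prodμ_fst M N)

/-- The second projection of a product of monads. -/
noncomputable def prodSnd : Hom (prodMonad M N) N :=
  homOfStrict (P := prodMonad M N) (snd M.C N.C) (prodS_snd M N) (prodη_snd M N) (prodμ_snd M N)

theorem comp_prodFst_τ {M N Z : MndOp D} (f : Hom Z (prodMonad M N)) :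
    (f.comp (prodFst M N)).τ ≍ f.τ ▷ fst M.C N.C :=
  comp_homOfStrict_τ f _ _ _ _

theorem comp_prodSnd_τ {M N Z : MndOp D} (f : Hom Z (prodMonad M N)) :
    (f.comp (prodSnd M N)).τ ≍ f.τ ▷ snd M.C N.C :=
  comp_homOfStrict_τ f _ _ _ _

variable {M N}

section Pair

variable {Z : MndOp D} (f : Hom Z M) (g : Hom Z N)

theorem lift_prodS_fst : (lift f.F g.F ≫ prodS M N) ≫ fst M.C N.C = f.F ≫ M.S := by
  rw [Strict.assoc, prodS_fst, ← Strict.assoc, lift_fst]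

theorem lift_prodS_snd : (lift f.F g.F ≫ prodS M N) ≫ snd M.C N.C = g.F ≫ N.S := by
  rw [Strict.assoc, prodS_snd, ← Strict.assoc, lift_snd]

/-- The structure `2`-cell of the pairing of oplax morphisms of monads. -/
noncomputable def pairτ : Z.S ≫ lift f.F g.F ⟶ lift f.F g.F ≫ prodS M N :=
  mkHom₂ (by rw [Strict.assoc, lift_fst]) (lift_prodS_fst f g) (by rw [Strict.assoc, lift_snd])
    (lift_prodS_snd f g) f.τ g.τ

theorem pairτ_fst : pairτ f g ▷ fst M.C N.C ≍ f.τ := mkHom₂_fst ..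

theorem pairτ_snd : pairτ f g ▷ snd M.C N.C ≍ g.τ := mkHom₂_snd ..

/-- The pairing of oplax morphisms of monads. -/
noncomputable def pair : Hom Z (prodMonad M N) where
  F := lift f.F g.F
  τ := pairτ f g
  τ_η := by
    have c1 := leftUnitor_inv_comp_heq _ (Z.η ▷ lift f.F g.F ≫ pairτ f g)
    have c2 := rightUnitor_inv_comp_heq _ (lift f.F g.F ◁ prodη M N)
    refine eq_of_heq (c1.trans (HEq.trans ?_ c2.symm))
    exact FiniteProducts.hom₂_heq ((Strict.id_comp _).trans (Strict.comp_id _).symm) rfl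
      (η_law_along_strict_hom (P := prodMonad M N) (prodS_fst M N) (prodη_fst M N) f
        (lift_fst _ _) (pairτ_fst f g))
      (η_law_along_strict_hom (P := prodMonad M N) (prodS_snd M N) (prodη_snd M N) g
        (lift_snd _ _) (pairτ_snd f g))
  τ_μ := by
    obtain ⟨σ, hσ⟩ := exists_heq rfl (Strict.assoc Z.S (lift f.F g.F) (prodS M N)).symm
      (Z.S ◁ pairτ f g)
    obtain ⟨σ', hσ'⟩ := exists_heq rfl (Strict.assoc (lift f.F g.F) (prodS M N) (prodS M N))
      (pairτ f g ▷ prodS M N)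
    refine (hom_τ_μ_iff (N := prodMonad M N) hσ hσ').2 ?_
    exact FiniteProducts.hom₂_heq (Strict.assoc _ _ _) rfl
      (μ_law_along_strict_hom (P := prodMonad M N) (prodS_fst M N) (prodμ_fst M N) hσ hσ' f
        (lift_fst _ _) (pairτ_fst f g))
      (μ_law_along_strict_hom (P := prodMonad M N) (prodS_snd M N) (prodμ_snd M N) hσ hσ' g
        (lift_snd _ _) (pairτ_snd f g))

end Pair

variable (M N) in
/-- The product of monads is a product in the `2`-category of monads. -/
theorem isBinaryProduct_prodMonad :
    IsBinaryProduct (D := MndOp D) (prodFst M N) (prodSnd M N) where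
  lift_unique {Z} f g := by
    refine ⟨pair f g, ⟨hom_ext (lift_fst _ _) ((comp_prodFst_τ _).trans (pairτ_fst f g)),
      hom_ext (lift_snd _ _) ((comp_prodSnd_τ _).trans (pairτ_snd f g))⟩, ?_⟩
    rintro h ⟨rfl, rfl⟩
    have e : Hom.F h = lift (Hom.F h ≫ fst M.C N.C) (Hom.F h ≫ snd M.C N.C) :=
      FiniteProducts.hom_ext (lift_fst _ _).symm (lift_snd _ _).symm
    refine hom_ext e (FiniteProducts.hom₂_heq (congrArg (fun k => Z.S ≫ k) e)
      (congrArg (fun k => k ≫ prodS M N) e) ?_ ?_)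
    · exact (comp_prodFst_τ h).symm.trans
        (pairτ_fst (Hom.comp h (prodFst M N)) (Hom.comp h (prodSnd M N))).symm
    · exact (comp_prodSnd_τ h).symm.trans
        (pairτ_snd (Hom.comp h (prodFst M N)) (Hom.comp h (prodSnd M N))).symm
  lift₂_unique {Z h k} σ τ := by
    obtain ⟨θ, ⟨h1, h2⟩, hu⟩ := (isBinaryProduct M.C N.C).lift₂_unique (Hom₂.σ σ) (Hom₂.σ τ)
    refine ⟨⟨θ, FiniteProducts.hom₂_ext
      (comm_along_strict_hom (P := prodMonad M N) (prodS_fst M N) (prodη_fst M N) (prodμ_fst M N)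
        θ σ h1)
      (comm_along_strict_hom (P := prodMonad M N) (prodS_snd M N) (prodη_snd M N) (prodμ_snd M N)
        θ τ h2)⟩,
      ⟨MndOp.hom₂_ext h1, MndOp.hom₂_ext h2⟩, ?_⟩
    rintro θ' ⟨h1', h2'⟩
    exact MndOp.hom₂_ext (hu _ ⟨congrArg Hom₂.σ h1', congrArg Hom₂.σ h2'⟩)

variable (D) in
/-- The identity monad on a terminal `0`-cell is terminal. -/
theorem isTerminalCell_idMonad_one : IsTerminalCell (idMonad (one : D)) where
  unique_hom Z := by
    refine ⟨⟨⟨⟨bang Z.C, bang₂ _ _, bang₂_ext _ _, bang₂_ext _ _⟩⟩, fun f => ?_⟩⟩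
    have e : Hom.F f = bang Z.C := bang_ext _ _
    obtain ⟨σ, hσ⟩ := exists_heq (congrArg (fun k => Z.S ≫ k) e)
      (congrArg (fun k => k ≫ 𝟙 one) e) (Hom.τ f)
    exact hom_ext e (hσ.symm.trans (heq_of_eq (bang₂_ext _ _)))
  unique_hom₂ {Z} f g :=
    ⟨⟨⟨⟨bang₂ _ _, bang₂_ext _ _⟩⟩, fun s => MndOp.hom₂_ext (bang₂_ext _ _)⟩⟩

/-- The `2`-category of monads has finite products, computed on underlying `0`-cells. -/
noncomputable instance : FiniteProducts (MndOp D) where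
  one := idMonad one
  isTerminal_one := isTerminalCell_idMonad_one D
  prod := prodMonad
  fst := prodFst
  snd := prodSnd
  isBinaryProduct := isBinaryProduct_prodMonad

end MndOp

/-! ### Universal arrows and products -/

section UniversalArrowsAndProducts

variable {B : Type u₁} [Bicategory.{w₁, v₁} B] {C : Type u₂} [Bicategory.{w₂, v₂} C] [Strict B]
  [Strict C] {R : StrictPseudofunctor C B}

/-- A `2`-functor that admits universal arrows preserves products. -/
theorem map_isBinaryProduct_of_universal
    (hR : ∀ b : B, ∃ (c : C) (u : b ⟶ R.obj c), IsUniversalArrow R u) {X Y P : C} {p : P ⟶ X}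
    {q : P ⟶ Y} (h : IsBinaryProduct p q) : IsBinaryProduct (R.map p) (R.map q) where
  lift_unique {Z} f g := by
    obtain ⟨c, u, hu⟩ := hR Z
    obtain ⟨f, rfl, -⟩ := hu.lift_unique f
    obtain ⟨g, rfl, -⟩ := hu.lift_unique g
    obtain ⟨k, ⟨rfl, rfl⟩, hk⟩ := h.lift_unique f g
    refine ⟨u ≫ R.map k, ⟨by rw [R.map_comp, Strict.assoc], by rw [R.map_comp, Strict.assoc]⟩, ?_⟩
    rintro l ⟨h1, h2⟩
    obtain ⟨l, rfl, -⟩ := hu.lift_unique l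
    rw [Strict.assoc, ← R.map_comp] at h1 h2
    rw [hk l ⟨hu.hom_ext h1, hu.hom_ext h2⟩]
  lift₂_unique {Z k l} σ τ := by
    obtain ⟨c, u, hu⟩ := hR Z
    obtain ⟨k, rfl, -⟩ := hu.lift_unique k
    obtain ⟨l, rfl, -⟩ := hu.lift_unique l
    have e : ∀ {W : C} (m : c ⟶ P) (r : P ⟶ W), u ≫ R.map (m ≫ r) = (u ≫ R.map m) ≫ R.map r :=
      fun m r => by rw [R.map_comp, Strict.assoc]
    have E : ∀ {W : C} (θ : k ⟶ l) (r : P ⟶ W),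
        (u ◁ R.map₂ θ) ▷ R.map r ≍ u ◁ R.map₂ (θ ▷ r) := by
      intro W θ r
      exact (whisker_assoc_heq _ _ _).trans (whiskerLeft_heq rfl (R.map_comp _ _).symm
        (R.map_comp _ _).symm (map₂_whiskerRight_heq R θ r).symm)
    obtain ⟨σ', hσ⟩ := hu.exists_map₂_heq (e k p) (e l p) σ
    obtain ⟨τ', hτ⟩ := hu.exists_map₂_heq (e k q) (e l q) τ
    obtain ⟨θ, ⟨rfl, rfl⟩, hθ⟩ := h.lift₂_unique σ' τ'
    refine ⟨u ◁ R.map₂ θ, ⟨eq_of_heq ((E θ p).trans hσ), eq_of_heq ((E θ q).trans hτ)⟩, ?_⟩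
    rintro ω ⟨h1, h2⟩
    obtain ⟨ω, rfl, -⟩ := hu.lift₂_unique ω
    rw [hθ ω ⟨hu.hom₂_ext (eq_of_heq ((E ω p).symm.trans ((heq_of_eq h1).trans hσ.symm))),
      hu.hom₂_ext (eq_of_heq ((E ω q).symm.trans ((heq_of_eq h2).trans hτ.symm)))⟩]

/-- If the left `2`-adjoint preserves products, then universal arrows are closed under
products. -/
theorem TwoAdjunction.isUniversalArrow_prod {L : StrictPseudofunctor B C} (adj : TwoAdjunction L R)
    (hL : PreservesFiniteProducts L) {S T P : B} {p : P ⟶ S} {q : P ⟶ T}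
    (hP : IsBinaryProduct p q) {X Y Q : C} {p' : Q ⟶ X} {q' : Q ⟶ Y} (hQ : IsBinaryProduct p' q')
    {u : S ⟶ R.obj X} (hu : IsUniversalArrow R u) {u' : T ⟶ R.obj Y}
    (hu' : IsUniversalArrow R u') {v : P ⟶ R.obj Q} (h : v ≫ R.map p' = p ≫ u)
    (h' : v ≫ R.map q' = q ≫ u') : IsUniversalArrow R v := by
  have hη := adj.isUniversalArrow_unit
  obtain ⟨a, a', ha, ha', hau⟩ := (hη S).exists_iso hu
  obtain ⟨b, b', hb, hb', hbu⟩ := (hη T).exists_iso hu'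
  -- `v` factors through the unit at `P` by `k`, and `k` is invertible because `L P` is a product of
  -- `L S ≅ X` and `L T ≅ Y`.
  obtain ⟨k, rfl, -⟩ := (hη P).lift_unique v
  have hLP := hL.binaryProduct hP
  have k1 : k ≫ p' = L.map p ≫ a := (hη P).hom_ext (by
    rw [R.map_comp, ← Strict.assoc, h, R.map_comp, ← Strict.assoc, ← adj.unit_naturality,
      Strict.assoc, hau])
  have k2 : k ≫ q' = L.map q ≫ b := (hη P).hom_ext (by
    rw [R.map_comp, ← Strict.assoc, h', R.map_comp, ← Strict.assoc, ← adj.unit_naturality,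
      Strict.assoc, hbu])
  obtain ⟨l, ⟨l1, l2⟩, -⟩ := hLP.lift_unique (p' ≫ a') (q' ≫ b')
  refine (hη P).comp_iso (e := k) (e' := l) ?_ ?_
  · refine (hLP.lift_unique (L.map p) (L.map q)).unique ⟨?_, ?_⟩
      ⟨Strict.id_comp _, Strict.id_comp _⟩
    · rw [Strict.assoc, l1, ← Strict.assoc, k1, Strict.assoc, ha, Strict.comp_id]
    · rw [Strict.assoc, l2, ← Strict.assoc, k2, Strict.assoc, hb, Strict.comp_id]
  · refine (hQ.lift_unique p' q').unique ⟨?_, ?_⟩ ⟨Strict.id_comp _, Strict.id_comp _⟩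
    · rw [Strict.assoc, k1, ← Strict.assoc, l1, Strict.assoc, ha', Strict.comp_id]
    · rw [Strict.assoc, k2, ← Strict.assoc, l2, Strict.assoc, hb', Strict.comp_id]

end UniversalArrowsAndProducts

open FiniteProducts MonoidalObject

/-! ### Strict morphisms of monads -/

section StrictHoms

variable {D : Type u} [Bicategory.{w, v} D] [Strict D]

namespace MndOp

/-- An oplax morphism whose structure `2`-cell is an identity, up to retyping. -/
def IsStrictHom {Z T : MndOp D} (a : Z ⟶ T) : Prop :=
  ∃ h : Z.S ≫ a.F = a.F ≫ T.S, a.τ = eqToHom h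

theorem isStrictHom_id (Z : MndOp D) : IsStrictHom (𝟙 Z) := by
  refine ⟨(Strict.comp_id _).trans (Strict.id_comp _).symm, ?_⟩
  change (ρ_ Z.S).hom ≫ (λ_ Z.S).inv = _
  rw [Strict.leftUnitor_eqToIso, Strict.rightUnitor_eqToIso]
  exact eqToHom_trans (Strict.comp_id Z.S) (Strict.id_comp Z.S).symm

theorem IsStrictHom.comp {Z S T : MndOp D} {a : Z ⟶ S} {b : S ⟶ T} (ha : IsStrictHom a)
    (hb : IsStrictHom b) : IsStrictHom (a ≫ b) := by
  obtain ⟨ha, ha'⟩ := ha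
  obtain ⟨hb, hb'⟩ := hb
  have e1 : Z.S ≫ a.F ≫ b.F = a.F ≫ S.S ≫ b.F := by rw [← Strict.assoc, ha, Strict.assoc]
  have e2 : a.F ≫ S.S ≫ b.F = a.F ≫ b.F ≫ T.S := by rw [hb]
  refine ⟨e1.trans (e2.trans (Strict.assoc _ _ _).symm), ?_⟩
  have h := Hom.heq_comp_τ a b (σ := eqToHom e1) (σ' := eqToHom e2) rfl
    (by rw [ha', eqToHom_whiskerRight]; exact eqToHom_heq _ _ (Strict.assoc _ _ _).symm)
    (by rw [hb', whiskerLeft_eqToHom])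
  rw [eqToHom_trans] at h
  exact eq_of_heq (h.trans (eqToHom_heq _ _ rfl))

theorem IsStrictHom.τ_heq {Z T : MndOp D} {a : Z ⟶ T} (ha : IsStrictHom a) :
    a.τ ≍ 𝟙 (a.F ≫ T.S) := by
  obtain ⟨h, h'⟩ := ha
  rw [h']
  exact eqToHom_heq h rfl h

/-- An invertible `2`-cell between oplax morphisms from an invertible `2`-cell between `1`-cells
that are propositionally the underlying ones. -/
theorem exists_iso_of_heq {Z T : MndOp D} {f g : Z ⟶ T} {F G : Z.C ⟶ T.C} {p q : Z.C ⟶ T.C}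
    (hF : f.F = F) (hG : g.F = G) (e : F ≅ G) (hp : Z.S ≫ F = p) (hq : Z.S ≫ G = q)
    {τ : p ⟶ F ≫ T.S} {τ' : q ⟶ G ≫ T.S} (hτ : f.τ ≍ τ) (hτ' : g.τ ≍ τ') {s : p ⟶ q}
    (hs : Z.S ◁ e.hom ≍ s) (h : s ≫ τ' = τ ≫ e.hom ▷ T.S) :
    ∃ e' : f ≅ g, Hom₂.σ e'.hom ≍ e.hom := by
  subst hF hG hp hq hτ hτ' hs
  exact ⟨isoMk e h, HEq.rfl⟩

end MndOp

end StrictHoms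

/-! ### Monads in the `2`-category of monoidal objects -/

section MonoidalMonads

variable {D : Type u} [Bicategory.{w, v} D] [Strict D] [FiniteProducts D]

theorem lift_fst_snd (A B : D) : lift (fst A B) (snd A B) = 𝟙 (prod A B) :=
  FiniteProducts.hom_ext (by rw [lift_fst, Strict.id_comp]) (by rw [lift_snd, Strict.id_comp])

namespace MndOp

/-- Sufficient condition for the laws of an oplax morphism of monads, up to retyping. -/
def mkHom {M N : MndOp D} (F : M.C ⟶ N.C) (τ : M.S ≫ F ⟶ F ≫ N.S)
    (hη : M.η ▷ F ≫ τ ≍ F ◁ N.η)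
    (hμ : ∃ (σ : M.S ≫ M.S ≫ F ⟶ (M.S ≫ F) ≫ N.S) (σ' : (M.S ≫ F) ≫ N.S ⟶ F ≫ N.S ≫ N.S),
      σ ≍ M.S ◁ τ ∧ σ' ≍ τ ▷ N.S ∧ M.μ ▷ F ≫ τ ≍ σ ≫ σ' ≫ F ◁ N.μ) : Hom M N where
  F := F
  τ := τ
  τ_η := eq_of_heq ((leftUnitor_inv_comp_heq _ _).trans
    (hη.trans (rightUnitor_inv_comp_heq _ _).symm))
  τ_μ := by
    obtain ⟨σ, σ', h1, h2, h⟩ := hμ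
    exact (hom_τ_μ_iff h1 h2).2 h

variable (M : MndOp (MonoidalObject D))

/-- The underlying monad in `D` of a monad in the `2`-category of monoidal objects. -/
noncomputable abbrev und : MndOp D := mapMonad (forget D) M

theorem und_η : (und M).η = MonoidalObject.Hom₂.σ M.η := by
  change ((forget D).mapId M.C).inv ≫ MonoidalObject.Hom₂.σ M.η = _
  rw [(forget D).mapId_eq_eqToIso]
  exact Category.id_comp _

theorem und_μ : (und M).μ = MonoidalObject.Hom₂.σ M.μ := by
  change ((forget D).mapComp M.S M.S).inv ≫ MonoidalObject.Hom₂.σ M.μ = _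
  rw [(forget D).mapComp_eq_eqToIso]
  exact Category.id_comp _

theorem prodη_heq (T : MndOp D) :
    prodη T T ≍ lift₂ (fst T.C T.C ◁ T.η) (snd T.C T.C ◁ T.η) :=
  FiniteProducts.hom₂_heq (by rw [Strict.comp_id, Strict.comp_id, lift_fst_snd]) rfl
    ((prodη_fst T T).trans (lift₂_fst _ _).symm) ((prodη_snd T T).trans (lift₂_snd _ _).symm)

theorem prodμ_heq (T : MndOp D) :
    prodμ T T ≍ lift₂ (fst T.C T.C ◁ T.μ) (snd T.C T.C ◁ T.μ) :=
  FiniteProducts.hom₂_heq (FiniteProducts.hom_ext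
    (by rw [prodS_prodS_fst, lift_fst]) (by rw [prodS_prodS_snd, lift_snd])) rfl
    ((prodμ_fst T T).trans (lift₂_fst _ _).symm) ((prodμ_snd T T).trans (lift₂_snd _ _).symm)

theorem prodS_comp_prodS (T : MndOp D) : prodS T T ≫ prodS T T =
    lift (fst T.C T.C ≫ T.S ≫ T.S) (snd T.C T.C ≫ T.S ≫ T.S) :=
  FiniteProducts.hom_ext (by rw [prodS_prodS_fst, lift_fst]) (by rw [prodS_prodS_snd, lift_snd])

theorem lift_comp_prodS {Z S T : MndOp D} (a : Hom Z S) (b : Hom Z T) :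
    lift a.F b.F ≫ prodS S T = lift (a.F ≫ S.S) (b.F ≫ T.S) :=
  FiniteProducts.hom_ext (by rw [lift_prodS_fst, lift_fst]) (by rw [lift_prodS_snd, lift_snd])

/-- The unit law of the tensor product as an oplax morphism of monads: the unit of `M` is a monoidal
`2`-cell. -/
theorem tensor_η_law : prodη (und M) (und M) ▷ M.C.ten ≫ M.S.φ ≍ M.C.ten ◁ (und M).η := by
  have e : lift (fst M.C.C M.C.C ≫ 𝟙 _) (snd M.C.C M.C.C ≫ 𝟙 _) = 𝟙 (prod M.C.C M.C.C) := by
    rw [Strict.comp_id, Strict.comp_id, lift_fst_snd]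
  have h1 := whiskerRight_heq (h := M.C.ten) (h' := M.C.ten) e.symm rfl rfl (prodη_heq (und M))
  have h2 := id_comp_heq (LaxData.id_φ_eq M.C) (M.C.ten ◁ MonoidalObject.Hom₂.σ M.η) rfl
  rw [und_η] at h1 ⊢
  exact (comp_heq (congrArg (fun k => k ≫ M.C.ten) e.symm) rfl rfl h1 HEq.rfl).trans
    ((heq_of_eq (MonoidalObject.Hom₂.tensor M.η)).trans h2)

/-- The multiplicativity law of the tensor product as an oplax morphism of monads: the
multiplication of `M` is a monoidal `2`-cell. -/
theorem tensor_μ_law : ∃ (σ : prodS (und M) (und M) ≫ prodS (und M) (und M) ≫ M.C.ten ⟶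
    (prodS (und M) (und M) ≫ M.C.ten) ≫ M.S.F)
    (σ' : (prodS (und M) (und M) ≫ M.C.ten) ≫ M.S.F ⟶ M.C.ten ≫ M.S.F ≫ M.S.F),
    σ ≍ prodS (und M) (und M) ◁ M.S.φ ∧ σ' ≍ M.S.φ ▷ M.S.F ∧
    prodμ (und M) (und M) ▷ M.C.ten ≫ M.S.φ ≍ σ ≫ σ' ≫ M.C.ten ◁ (und M).μ := by
  set P := prodS (und M) (und M) with hP
  obtain ⟨σ, hσ⟩ := exists_heq rfl (Strict.assoc P M.C.ten M.S.F).symm (P ◁ M.S.φ)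
  obtain ⟨σ', hσ'⟩ := exists_heq rfl (Strict.assoc M.C.ten M.S.F M.S.F) (M.S.φ ▷ M.S.F)
  refine ⟨σ, σ', hσ, hσ', ?_⟩
  have e : P ≫ P = lift (fst M.C.C M.C.C ≫ M.S.F ≫ M.S.F) (snd M.C.C M.C.C ≫ M.S.F ≫ M.S.F) :=
    prodS_comp_prodS (und M)
  have h1 := whiskerRight_heq (h := M.C.ten) (h' := M.C.ten) e rfl rfl (prodμ_heq (und M))
  have h2 := LaxData.comp_φ_heq M.S.toLaxData M.S.toLaxData
  have h3 := M.S.phiAt_heq (fst M.C.C M.C.C ≫ M.S.F) (snd M.C.C M.C.C ≫ M.S.F)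
  rw [und_μ] at h1 ⊢
  refine (comp_heq (congrArg (fun k => k ≫ M.C.ten) e) rfl rfl h1 HEq.rfl).trans
    ((heq_of_eq (MonoidalObject.Hom₂.tensor M.μ)).trans ?_)
  refine HEq.trans ?_ (heq_of_eq (Category.assoc _ _ _))
  refine comp_heq ((congrArg (fun k => k ≫ M.C.ten) e).symm.trans (Strict.assoc _ _ _)) rfl rfl
    (h2.trans ?_) HEq.rfl
  exact comp_heq ((M.S.phiAt_dom _ _).symm) rfl (Strict.assoc _ _ _) (h3.trans hσ.symm) hσ'.symm

/-- The tensor product as an oplax morphism of monads `S × S ⟶ S`, with structure `2`-cell the lax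
monoidal structure of `S`. -/
noncomputable def tensHom : Hom (prodMonad (und M) (und M)) (und M) :=
  mkHom (M := prodMonad (und M) (und M)) (N := und M) M.C.ten M.S.φ (tensor_η_law M)
    (tensor_μ_law M)

/-- The unit law of the unit `1`-cell as an oplax morphism of monads. -/
theorem unit_η_law {τ : 𝟙 one ≫ M.C.unit ⟶ M.C.unit ≫ M.S.F} (hτ : τ ≍ M.S.φ₀) :
    (idMonad one).η ▷ M.C.unit ≫ τ ≍ M.C.unit ◁ (und M).η := by
  have h1 := id_comp_heq (Strict.comp_id M.C.unit).symm (M.C.unit ◁ MonoidalObject.Hom₂.σ M.η) rfl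
  have h2 := MonoidalObject.Hom₂.unit M.η
  rw [und_η]
  exact (id_comp_heq rfl τ (id_whiskerRight _ _)).trans
    (hτ.trans ((heq_of_eq h2.symm).trans h1))

/-- The multiplicativity law of the unit `1`-cell as an oplax morphism of monads. -/
theorem unit_μ_law {τ : 𝟙 one ≫ M.C.unit ⟶ M.C.unit ≫ M.S.F} (hτ : τ ≍ M.S.φ₀) :
    ∃ (σ : 𝟙 one ≫ 𝟙 one ≫ M.C.unit ⟶ (𝟙 one ≫ M.C.unit) ≫ M.S.F)
    (σ' : (𝟙 one ≫ M.C.unit) ≫ M.S.F ⟶ M.C.unit ≫ M.S.F ≫ M.S.F),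
    σ ≍ 𝟙 one ◁ τ ∧ σ' ≍ τ ▷ M.S.F ∧
    (idMonad one).μ ▷ M.C.unit ≫ τ ≍ σ ≫ σ' ≫ M.C.unit ◁ (und M).μ := by
  obtain ⟨σ, hσ⟩ := exists_heq rfl (Strict.assoc (𝟙 one) M.C.unit M.S.F).symm (𝟙 one ◁ τ)
  obtain ⟨σ', hσ'⟩ := exists_heq rfl (Strict.assoc M.C.unit M.S.F M.S.F) (τ ▷ M.S.F)
  refine ⟨σ, σ', hσ, hσ', ?_⟩
  have h1 := LaxData.comp_φ₀_heq M.S.toLaxData M.S.toLaxData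
  have h2 : M.S.φ₀ = _ ≫ _ := (MonoidalObject.Hom₂.unit M.μ).symm
  have h3 := id_whiskerLeft_heq τ
  rw [und_μ]
  have e : 𝟙 one ≫ M.C.unit = M.C.unit := Strict.id_comp _
  have h4 : (λ_ (𝟙 (one : D))).hom ▷ M.C.unit =
      eqToHom (congrArg (fun k => k ≫ M.C.unit) (Strict.id_comp (𝟙 one))) := by
    rw [Strict.leftUnitor_eqToIso, eqToIso.hom, eqToHom_whiskerRight]
  have h5 : (idMonad one).μ ▷ M.C.unit ≫ τ ≍ τ := id_comp_heq _ τ h4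
  refine h5.trans (hτ.trans ((heq_of_eq h2).trans ?_))
  refine HEq.trans ?_ (heq_of_eq (Category.assoc _ _ _))
  refine comp_heq (by rw [e, e]) rfl rfl (h1.trans ?_) HEq.rfl
  exact comp_heq (by rw [e, e]) (by rw [e]) (Strict.assoc _ _ _)
    (hτ.symm.trans (h3.symm.trans hσ.symm))
    ((whiskerRight_heq e.symm rfl rfl hτ.symm).trans hσ'.symm)

/-- The unit as an oplax morphism of monads. -/
noncomputable def unitHom : Hom (idMonad one) (und M) :=
  mkHom (M := idMonad one) (N := und M) M.C.unit
    (eqToHom (Strict.id_comp M.C.unit) ≫ M.S.φ₀)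
    (unit_η_law M (id_comp_heq _ _ rfl)) (unit_μ_law M (id_comp_heq _ _ rfl))

theorem unitHom_τ : (unitHom M).τ ≍ M.S.φ₀ := id_comp_heq _ _ rfl

variable {M}

theorem lift_eq_pair {Z S T : MndOp D} (a : Z ⟶ S) (b : Z ⟶ T) :
    lift a b = pair a b :=
  FiniteProducts.hom_ext (D := MndOp D)
    ((lift_fst a b).trans (hom_ext (lift_fst _ _) ((comp_prodFst_τ _).trans (pairτ_fst a b))).symm)
    ((lift_snd a b).trans (hom_ext (lift_snd _ _) ((comp_prodSnd_τ _).trans (pairτ_snd a b))).symm)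

theorem lift_F {Z S T : MndOp D} (a : Z ⟶ S) (b : Z ⟶ T) :
    Hom.F (lift a b) = lift a.F b.F := by
  rw [lift_eq_pair]; rfl

/-- The tensor product of two oplax morphisms into `und M`. -/
noncomputable abbrev tensE {Z : MndOp D} (a b : Z ⟶ und M) : Z ⟶ und M :=
  tens (D := MndOp D) (tensHom M) a b

theorem tensE_F {Z : MndOp D} (a b : Z ⟶ und M) : Hom.F (tensE a b) = tens M.C.ten a.F b.F :=
  congrArg (fun k => k ≫ M.C.ten) (lift_F a b)

theorem pairτ_heq {Z S T : MndOp D} (a : Hom Z S) (b : Hom Z T) :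
    pairτ a b ≍ lift₂ a.τ b.τ :=
  FiniteProducts.hom₂_heq (comp_lift _ _ _)
    (lift_comp_prodS a b)
    ((pairτ_fst _ _).trans (lift₂_fst _ _).symm) ((pairτ_snd _ _).trans (lift₂_snd _ _).symm)

/-- The structure `2`-cell of a tensor product of oplax morphisms. -/
theorem tensE_τ {Z : MndOp D} (a b : Z ⟶ und M) {p q : Z.C ⟶ M.C.C} {F G : Z.C ⟶ M.C.C}
    {ξ : p ⟶ F ≫ M.S.F} {υ : q ⟶ G ≫ M.S.F} (hp : Z.S ≫ a.F = p) (hq : Z.S ≫ b.F = q)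
    (hF : a.F = F) (hG : b.F = G) (hξ : a.τ ≍ ξ) (hυ : b.τ ≍ υ) :
    Hom.τ (tensE a b) ≍ tens₂ M.C.ten ξ υ ≫ M.S.phiAt F G := by
  subst hp hq hF hG hξ hυ
  have e : tensE a b = Hom.comp (pair a b) (tensHom M) :=
    congrArg (fun k => Hom.comp k (tensHom M)) (lift_eq_pair a b)
  refine (τ_heq_of_eq e).trans ?_
  have e1 : Z.S ≫ tens M.C.ten a.F b.F = tens M.C.ten (Z.S ≫ a.F) (Z.S ≫ b.F) := comp_tens ..
  have e2 : (lift a.F b.F ≫ prodS (und M) (und M)) ≫ M.C.ten =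
      tens M.C.ten (a.F ≫ M.S.F) (b.F ≫ M.S.F) :=
    congrArg (fun k => k ≫ M.C.ten)
      (lift_comp_prodS a b)
  obtain ⟨σ, hσ⟩ := exists_heq e1.symm rfl (tens₂ M.C.ten a.τ b.τ)
  obtain ⟨σ', hσ'⟩ := exists_heq rfl (Strict.assoc _ _ _) (M.S.phiAt a.F b.F)
  have h := Hom.heq_comp_τ (pair a b) (tensHom M) (σ := σ) (σ' := σ')
    (e2.symm.trans (Strict.assoc _ _ _)) ?_ ?_
  · exact h.trans (comp_heq e1 rfl (Strict.assoc _ _ _).symm hσ hσ')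
  · exact hσ.trans (whiskerRight_heq (comp_lift _ _ _).symm
      (lift_comp_prodS a b).symm rfl (pairτ_heq a b).symm)
  · exact hσ'.trans (M.S.phiAt_heq _ _)

variable (M) in
/-- The unit as an oplax morphism of monads from any monad. -/
noncomputable abbrev unitE (Z : MndOp D) : Z ⟶ und M :=
  bang (D := MndOp D) Z ≫ unitHom M

theorem unitE_F (Z : MndOp D) : Hom.F (unitE M Z) = M.C.unitAt Z.C :=
  congrArg (fun k => k ≫ M.C.unit) (bang_ext _ _)

theorem unitE_τ (Z : MndOp D) : Hom.τ (unitE M Z) ≍ M.S.phi₀At Z.C := by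
  have e : Hom.F (bang (D := MndOp D) Z) = bang Z.C := bang_ext _ _
  have e' : Z.S ≫ bang Z.C = bang Z.C := bang_ext _ _
  have hb : Hom.τ (bang (D := MndOp D) Z) ≍ 𝟙 (bang Z.C) := by
    obtain ⟨σ, hσ⟩ := exists_heq ((congrArg (fun k => Z.S ≫ k) e).trans e')
      ((congrArg (fun k => k ≫ 𝟙 one) e).trans (Strict.comp_id _)) (Hom.τ (bang (D := MndOp D) Z))
    exact hσ.symm.trans (heq_of_eq (bang₂_ext _ _))
  have h1 : Z.S ≫ Hom.F (bang (D := MndOp D) Z) ≫ M.C.unit = bang Z.C ≫ M.C.unit := by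
    exact (Strict.assoc _ _ _).symm.trans (congrArg (fun k => k ≫ M.C.unit) (bang_ext _ _))
  have h2 : bang Z.C ≫ M.C.unit ≫ M.S.F =
      Hom.F (bang (D := MndOp D) Z) ≫ M.C.unit ≫ M.S.F := by rw [e]; rfl
  obtain ⟨σ, hσ⟩ := exists_heq h1.symm rfl (𝟙 (bang Z.C ≫ M.C.unit))
  obtain ⟨σ', hσ'⟩ := exists_heq rfl h2 (bang Z.C ◁ M.S.φ₀)
  have e2 : 𝟙 one ≫ M.C.unit = M.C.unit := Strict.id_comp _
  have h3 := Hom.heq_comp_τ (bang (D := MndOp D) Z) (unitHom M) (σ := σ) (σ' := σ')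
    ((congrArg (fun k => bang Z.C ≫ k) e2).symm.trans
      (congrArg (fun k => k ≫ 𝟙 one ≫ M.C.unit) e).symm) ?_ ?_
  · refine h3.trans ?_
    have h4 : σ ≫ σ' ≍ 𝟙 (bang Z.C ≫ M.C.unit) ≫ bang Z.C ◁ M.S.φ₀ :=
      comp_heq h1 rfl h2.symm hσ hσ'
    rw [Category.id_comp] at h4
    exact h4.trans (M.S.phi₀At_heq Z.C).symm
  · refine hσ.trans (HEq.trans (heq_of_eq (id_whiskerRight _ _).symm) ?_)
    exact whiskerRight_heq (h := M.C.unit) (h' := M.C.unit) (bang_ext _ _) (bang_ext _ _) rfl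
      hb.symm
  · exact hσ'.trans (whiskerLeft_heq e.symm e2.symm rfl (unitHom_τ M).symm)

theorem isStrictHom_fst (S T : MndOp D) : IsStrictHom (fst S T) := ⟨prodS_fst S T, rfl⟩

theorem isStrictHom_snd (S T : MndOp D) : IsStrictHom (snd S T) := ⟨prodS_snd S T, rfl⟩

/-- The associativity constraint at generalized elements, as an invertible `2`-cell. -/
noncomputable def _root_.TwoCat.MonoidalData.assocIsoAt (A : MonoidalData D) {X : D}
    (a b c : X ⟶ A.C) : tens A.ten a (tens A.ten b c) ≅ tens A.ten (tens A.ten a b) c :=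
  eqToIso (A.assocAt_dom a b c).symm ≪≫ whiskerLeftIso (lift a (lift b c)) A.assoc ≪≫
    eqToIso (A.assocAt_cod a b c)

/-- The left unit constraint at a generalized element, as an invertible `2`-cell. -/
noncomputable def _root_.TwoCat.MonoidalData.leftIsoAt (A : MonoidalData D) {X : D}
    (a : X ⟶ A.C) : tens A.ten (A.unitAt X) a ≅ a :=
  eqToIso (A.leftAt_dom a).symm ≪≫ whiskerLeftIso a A.left ≪≫ eqToIso (Strict.comp_id a)

/-- The right unit constraint at a generalized element, as an invertible `2`-cell. -/
noncomputable def _root_.TwoCat.MonoidalData.rightIsoAt (A : MonoidalData D) {X : D}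
    (a : X ⟶ A.C) : tens A.ten a (A.unitAt X) ≅ a :=
  eqToIso (A.rightAt_dom a).symm ≪≫ whiskerLeftIso a A.right ≪≫ eqToIso (Strict.comp_id a)

/-- The associativity constraint is a `2`-cell of monads: this is the compatibility of the lax
monoidal `1`-cell `S` with associativity. -/
theorem exists_assocE {Z : MndOp D} {a b c : Z ⟶ und M} (ha : IsStrictHom a) (hb : IsStrictHom b)
    (hc : IsStrictHom c) : ∃ e : tensE a (tensE b c) ≅ tensE (tensE a b) c,
      Hom₂.σ e.hom ≍ M.C.assocAt a.F b.F c.F := by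
  have tab := (tensE_τ a b ha.1 hb.1 rfl rfl ha.τ_heq hb.τ_heq).trans
    (id_comp_heq rfl _ (tens₂_id _ _ _))
  have tbc := (tensE_τ b c hb.1 hc.1 rfl rfl hb.τ_heq hc.τ_heq).trans
    (id_comp_heq rfl _ (tens₂_id _ _ _))
  have eab : Z.S ≫ Hom.F (tensE a b) = tens M.C.ten (a.F ≫ M.S.F) (b.F ≫ M.S.F) := by
    rw [tensE_F]
    exact (comp_tens _ _ _ _).trans (congrArg₂ (tens M.C.ten) ha.1 hb.1)
  have ebc : Z.S ≫ Hom.F (tensE b c) = tens M.C.ten (b.F ≫ M.S.F) (c.F ≫ M.S.F) := by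
    rw [tensE_F]
    exact (comp_tens _ _ _ _).trans (congrArg₂ (tens M.C.ten) hb.1 hc.1)
  have t1 := tensE_τ a (tensE b c) ha.1 ebc rfl (tensE_F b c) ha.τ_heq tbc
  have t2 := tensE_τ (tensE a b) c eab hc.1 (tensE_F a b) rfl tab hc.τ_heq
  refine exists_iso_of_heq
    ((tensE_F _ _).trans (congrArg (fun k => tens M.C.ten a.F k) (tensE_F b c)))
    ((tensE_F _ _).trans (congrArg (fun k => tens M.C.ten k c.F) (tensE_F a b)))
    (M.C.assocIsoAt a.F b.F c.F) ?_ ?_ t1 t2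
    (M.C.whiskerLeft_assocAt Z.S ha.1 hb.1 hc.1) ?_
  · refine (comp_tens _ _ _ _).trans (congrArg₂ (tens M.C.ten) ha.1 ?_)
    exact (comp_tens _ _ _ _).trans (congrArg₂ (tens M.C.ten) hb.1 hc.1)
  · refine (comp_tens _ _ _ _).trans (congrArg₂ (tens M.C.ten) ?_ hc.1)
    exact (comp_tens _ _ _ _).trans (congrArg₂ (tens M.C.ten) ha.1 hb.1)
  · exact (MonoidalObject.Hom.assocAt M.S a.F b.F c.F).trans (Category.assoc _ _ _).symm

/-- The left unit constraint is a `2`-cell of monads. -/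
theorem exists_leftE {Z : MndOp D} {a : Z ⟶ und M} (ha : IsStrictHom a) :
    ∃ e : tensE (unitE M Z) a ≅ a, Hom₂.σ e.hom ≍ M.C.leftAt a.F := by
  have eu : Z.S ≫ Hom.F (unitE M Z) = M.C.unitAt Z.C := by
    rw [unitE_F]
    exact M.C.comp_unitAt Z.S
  have t1 := tensE_τ (unitE M Z) a eu ha.1 (unitE_F Z) rfl (unitE_τ Z) ha.τ_heq
  refine exists_iso_of_heq
    ((tensE_F _ _).trans (congrArg (fun k => tens M.C.ten k a.F) (unitE_F Z))) rfl
    (M.C.leftIsoAt a.F) ?_ ha.1 t1 ha.τ_heq (M.C.whiskerLeft_leftAt Z.S ha.1) ?_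
  · exact (comp_tens _ _ _ _).trans (congrArg₂ (tens M.C.ten) (M.C.comp_unitAt Z.S) ha.1)
  · refine (Category.comp_id _).trans ?_
    exact (MonoidalObject.Hom.leftAt M.S a.F).trans (Category.assoc _ _ _).symm

/-- The right unit constraint is a `2`-cell of monads. -/
theorem exists_rightE {Z : MndOp D} {a : Z ⟶ und M} (ha : IsStrictHom a) :
    ∃ e : tensE a (unitE M Z) ≅ a, Hom₂.σ e.hom ≍ M.C.rightAt a.F := by
  have eu : Z.S ≫ Hom.F (unitE M Z) = M.C.unitAt Z.C := by
    rw [unitE_F]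
    exact M.C.comp_unitAt Z.S
  have t1 := tensE_τ a (unitE M Z) ha.1 eu rfl (unitE_F Z) ha.τ_heq (unitE_τ Z)
  refine exists_iso_of_heq
    ((tensE_F _ _).trans (congrArg (fun k => tens M.C.ten a.F k) (unitE_F Z))) rfl
    (M.C.rightIsoAt a.F) ?_ ha.1 t1 ha.τ_heq (M.C.whiskerLeft_rightAt Z.S ha.1) ?_
  · exact (comp_tens _ _ _ _).trans (congrArg₂ (tens M.C.ten) ha.1 (M.C.comp_unitAt Z.S))
  · refine (Category.comp_id _).trans ?_
    exact (MonoidalObject.Hom.rightAt M.S a.F).trans (Category.assoc _ _ _).symm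

end MndOp

end MonoidalMonads

/-! ### Strict monoidal `1`-cells and cofaithful `1`-cells -/

section StrictMonoidal

variable {D : Type u} [Bicategory.{w, v} D]

/-- A `1`-cell along which `2`-cells can be cancelled. -/
def Cofaithful {X Y : D} (f : X ⟶ Y) : Prop :=
  ∀ {Z : D} {h k : Y ⟶ Z} {θ θ' : h ⟶ k}, f ◁ θ = f ◁ θ' → θ = θ'

variable [Strict D] [FiniteProducts D]

/-- A `1`-cell that preserves tensor product, unit and constraints strictly. -/
structure IsStrictMonoidal (A A' : MonoidalData D) (F : A.C ⟶ A'.C) : Prop where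
  ten : lift (fst A.C A.C ≫ F) (snd A.C A.C ≫ F) ≫ A'.ten = A.ten ≫ F
  unit : A'.unit = A.unit ≫ F
  assoc : ∀ {X : D} (a b c : X ⟶ A.C),
    A'.assocAt (a ≫ F) (b ≫ F) (c ≫ F) ≍ A.assocAt a b c ▷ F
  left : ∀ {X : D} (a : X ⟶ A.C), A'.leftAt (a ≫ F) ≍ A.leftAt a ▷ F
  right : ∀ {X : D} (a : X ⟶ A.C), A'.rightAt (a ≫ F) ≍ A.rightAt a ▷ F

namespace MonoidalData

theorem assocAt_congr (A : MonoidalData D) {X : D} {a b c a' b' c' : X ⟶ A.C} (ha : a = a')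
    (hb : b = b') (hc : c = c') : A.assocAt a b c ≍ A.assocAt a' b' c' := by
  cases ha; cases hb; cases hc; rfl

/-- The triangle equation for `2`-cells at two generalized elements. -/
def TriangleAt (A : MonoidalData D) {X : D} (a b : X ⟶ A.C) : Prop :=
  A.assocAt a (A.unitAt X) b ≫ tens₂ A.ten (A.rightAt a) (𝟙 b) = tens₂ A.ten (𝟙 a) (A.leftAt b)

/-- The pentagon can be tested after composition with a cofaithful `1`-cell. -/
theorem pentagonAt_of_cofaithful {A : MonoidalData D} {X Y : D} {h : Y ⟶ X} (hh : Cofaithful h)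
    {a b c d : X ⟶ A.C} {a' b' c' d' : Y ⟶ A.C} (ha : h ≫ a = a') (hb : h ≫ b = b')
    (hc : h ≫ c = c') (hd : h ≫ d = d') (H : A.PentagonAt a' b' c' d') : A.PentagonAt a b c d := by
  subst ha hb hc hd
  apply hh
  have ct : ∀ x y : X ⟶ A.C, h ≫ tens A.ten x y = tens A.ten (h ≫ x) (h ≫ y) :=
    comp_tens A.ten h
  have wt : ∀ {x y x' y' : X ⟶ A.C} (σ : x ⟶ x') (τ : y ⟶ y'),
      h ◁ tens₂ A.ten σ τ ≍ tens₂ A.ten (h ◁ σ) (h ◁ τ) := whiskerLeft_tens₂ A.ten h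
  have wa : ∀ x y z : X ⟶ A.C, h ◁ A.assocAt x y z ≍ A.assocAt (h ≫ x) (h ≫ y) (h ≫ z) :=
    fun x y z => A.whiskerLeft_assocAt h rfl rfl rfl
  simp only [whiskerLeft_comp]
  unfold PentagonAt at H
  have w1 := wt (𝟙 a) (A.assocAt b c d)
  have w2 := wt (A.assocAt a b c) (𝟙 d)
  have w3 := wa a b c
  have w4 := wa b c d
  have w5 := wa a (tens A.ten b c) d
  have w6 := wa a b (tens A.ten c d)
  have w7 := wa (tens A.ten a b) c d
  rw [whiskerLeft_id] at w1 w2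
  grind

/-- The triangle can be tested after composition with a cofaithful `1`-cell. -/
theorem triangleAt_of_cofaithful {A : MonoidalData D} {X Y : D} {h : Y ⟶ X} (hh : Cofaithful h)
    {a b : X ⟶ A.C} {a' b' : Y ⟶ A.C} (ha : h ≫ a = a') (hb : h ≫ b = b')
    (H : A.TriangleAt a' b') : A.TriangleAt a b := by
  subst ha hb
  apply hh
  have ct : ∀ x y : X ⟶ A.C, h ≫ tens A.ten x y = tens A.ten (h ≫ x) (h ≫ y) :=
    comp_tens A.ten h
  have w1 := whiskerLeft_tens₂ A.ten h (A.rightAt a) (𝟙 b)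
  have w2 := whiskerLeft_tens₂ A.ten h (𝟙 a) (A.leftAt b)
  have w3 := A.whiskerLeft_assocAt h (a := a) (b := A.unitAt X) (c := b) rfl (A.comp_unitAt h) rfl
  have w4 := A.whiskerLeft_leftAt h (a := b) rfl
  have w5 := A.whiskerLeft_rightAt h (a := a) rfl
  have e := A.comp_unitAt h
  simp only [whiskerLeft_comp]
  unfold TriangleAt at H
  rw [whiskerLeft_id] at w1 w2
  grind

end MonoidalData

namespace IsStrictMonoidal

variable {A A' : MonoidalData D} {F : A.C ⟶ A'.C} (hF : IsStrictMonoidal A A' F)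
include hF

theorem tens_comp {X : D} (a b : X ⟶ A.C) :
    tens A'.ten (a ≫ F) (b ≫ F) = tens A.ten a b ≫ F := by
  have e : lift (a ≫ F) (b ≫ F) = lift a b ≫ lift (fst A.C A.C ≫ F) (snd A.C A.C ≫ F) := by
    rw [comp_lift, ← Strict.assoc, ← Strict.assoc, lift_fst, lift_snd]
  rw [tens, e, Strict.assoc, hF.ten, ← Strict.assoc, tens]

theorem tens₂_comp {X : D} {a b a' b' : X ⟶ A.C} (σ : a ⟶ a') (τ : b ⟶ b') :
    tens₂ A'.ten (σ ▷ F) (τ ▷ F) ≍ tens₂ A.ten σ τ ▷ F := by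
  have e : ∀ a b : X ⟶ A.C,
      lift (a ≫ F) (b ≫ F) = lift a b ≫ lift (fst A.C A.C ≫ F) (snd A.C A.C ≫ F) := fun a b => by
    rw [comp_lift, ← Strict.assoc, ← Strict.assoc, lift_fst, lift_snd]
  have h1 : lift₂ (σ ▷ F) (τ ▷ F) ≍
      lift₂ σ τ ▷ lift (fst A.C A.C ≫ F) (snd A.C A.C ≫ F) := by
    have a1 := whiskerRight_lift (lift₂ σ τ) (fst A.C A.C ≫ F) (snd A.C A.C ≫ F)
    have a2 := whiskerRight_comp_heq (lift₂ σ τ) (fst A.C A.C) F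
    have a3 := whiskerRight_comp_heq (lift₂ σ τ) (snd A.C A.C) F
    have a4 := lift₂_fst σ τ
    have a5 := lift₂_snd σ τ
    have b1 := lift_fst a b
    have b2 := lift_fst a' b'
    have b3 := lift_snd a b
    have b4 := lift_snd a' b'
    grind [Strict.assoc]
  have h2 := whiskerRight_comp_heq (lift₂ σ τ) (lift (fst A.C A.C ≫ F) (snd A.C A.C ≫ F)) A'.ten
  have h3 := whiskerRight_comp_heq (lift₂ σ τ) A.ten F
  refine (whiskerRight_heq (e _ _) (e _ _) rfl h1).trans (h2.symm.trans (HEq.trans ?_ h3))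
  exact whiskerRight_heq rfl rfl hF.ten HEq.rfl

theorem unitAt_comp (X : D) : A'.unitAt X = A.unitAt X ≫ F := by
  rw [MonoidalData.unitAt, hF.unit, ← Strict.assoc, MonoidalData.unitAt]

/-- A strict monoidal `1`-cell carries the pentagon over to its target. -/
theorem pentagonAt {X : D} {a b c d : X ⟶ A.C} (H : A.PentagonAt a b c d) :
    A'.PentagonAt (a ≫ F) (b ≫ F) (c ≫ F) (d ≫ F) := by
  have ct := fun x y : X ⟶ A.C => hF.tens_comp x y
  have w1 := hF.tens₂_comp (𝟙 a) (A.assocAt b c d)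
  have w2 := hF.tens₂_comp (A.assocAt a b c) (𝟙 d)
  have w3 := hF.assoc a b c
  have w4 := hF.assoc b c d
  have w5 := hF.assoc a (tens A.ten b c) d
  have w6 := hF.assoc a b (tens A.ten c d)
  have w7 := hF.assoc (tens A.ten a b) c d
  rw [id_whiskerRight] at w1 w2
  have H' := congrArg (fun t => t ▷ F) H
  simp only [comp_whiskerRight] at H'
  unfold MonoidalData.PentagonAt
  grind

/-- A strict monoidal `1`-cell carries the triangle over to its target. -/
theorem triangleAt {X : D} {a b : X ⟶ A.C} (H : A.TriangleAt a b) :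
    A'.TriangleAt (a ≫ F) (b ≫ F) := by
  have ct := fun x y : X ⟶ A.C => hF.tens_comp x y
  have w1 := hF.tens₂_comp (𝟙 a) (A.leftAt b)
  have w2 := hF.tens₂_comp (A.rightAt a) (𝟙 b)
  have w3 := hF.assoc a (A.unitAt X) b
  have w4 := hF.left b
  have w5 := hF.right a
  have e := hF.unitAt_comp X
  rw [id_whiskerRight] at w1 w2
  have H' := congrArg (fun t => t ▷ F) H
  simp only [comp_whiskerRight] at H'
  unfold MonoidalData.TriangleAt
  grind

end IsStrictMonoidal

namespace IsStrictMonoidal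

variable {A A' : MonoidalObject D} {F : A.C ⟶ A'.C}
  (hF : IsStrictMonoidal A.toMonoidalData A'.toMonoidalData F)

/-- A strict monoidal `1`-cell as a lax monoidal `1`-cell: the data. -/
noncomputable def toLaxData : LaxData A A' where
  F := F
  φ := eqToHom hF.ten
  φ₀ := eqToHom hF.unit

theorem toLaxData_phiAt {X : D} (a b : X ⟶ A.C) :
    hF.toLaxData.phiAt a b = eqToHom (hF.tens_comp a b) := by
  refine eq_of_heq ((hF.toLaxData.phiAt_heq a b).trans ?_)
  change _ ◁ eqToHom hF.ten ≍ _
  rw [whiskerLeft_eqToHom]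
  exact eqToHom_heq _ _ (hF.toLaxData.phiAt_dom a b)

theorem toLaxData_phi₀At (X : D) :
    hF.toLaxData.phi₀At X = eqToHom (hF.unitAt_comp X) := by
  refine eq_of_heq ((hF.toLaxData.phi₀At_heq X).trans ?_)
  change _ ◁ eqToHom hF.unit ≍ _
  rw [whiskerLeft_eqToHom]
  exact eqToHom_heq _ _ rfl

theorem toLaxData_assocAt {X : D} (a b c : X ⟶ A.C) : hF.toLaxData.AssocAt a b c := by
  rw [LaxData.AssocAt, toLaxData_phiAt, toLaxData_phiAt, toLaxData_phiAt, toLaxData_phiAt]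
  have h1 : tens₂ A'.ten (eqToHom (hF.tens_comp a b)) (𝟙 (c ≫ F)) = eqToHom _ :=
    tens₂_eqToHom _ _ rfl
  have h2 : tens₂ A'.ten (𝟙 (a ≫ F)) (eqToHom (hF.tens_comp b c)) = eqToHom _ :=
    tens₂_eqToHom _ rfl _
  refine (congrArg (fun t => A'.assocAt _ _ _ ≫ t ≫ _) h1).trans
    (Eq.trans ?_ (congrArg (fun t => t ≫ _ ≫ _) h2).symm)
  exact eq_of_heq ((comp_eqToHom_eqToHom_heq _ _ _).trans ((hF.assoc a b c).trans
    (eqToHom_eqToHom_comp_heq _ _ _).symm))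

theorem toLaxData_rightAt {X : D} (a : X ⟶ A.C) : hF.toLaxData.RightAt a := by
  rw [LaxData.RightAt, toLaxData_phiAt, toLaxData_phi₀At]
  have h1 : tens₂ A'.ten (𝟙 (a ≫ F)) (eqToHom (hF.unitAt_comp X)) = eqToHom _ :=
    tens₂_eqToHom _ rfl _
  refine Eq.trans ?_ (congrArg (fun t => t ≫ _ ≫ _) h1).symm
  exact eq_of_heq ((hF.right a).trans (eqToHom_eqToHom_comp_heq _ _ _).symm)

theorem toLaxData_leftAt {X : D} (a : X ⟶ A.C) : hF.toLaxData.LeftAt a := by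
  rw [LaxData.LeftAt, toLaxData_phiAt, toLaxData_phi₀At]
  have h1 : tens₂ A'.ten (eqToHom (hF.unitAt_comp X)) (𝟙 (a ≫ F)) = eqToHom _ :=
    tens₂_eqToHom _ _ rfl
  refine Eq.trans ?_ (congrArg (fun t => t ≫ _ ≫ _) h1).symm
  exact eq_of_heq ((hF.left a).trans (eqToHom_eqToHom_comp_heq _ _ _).symm)

/-- A strict monoidal `1`-cell as a lax monoidal `1`-cell. -/
noncomputable def toHom : MonoidalObject.Hom A A' where
  toLaxData := hF.toLaxData
  assoc := hF.toLaxData_assocAt _ _ _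
  right := hF.toLaxData_rightAt _
  left := hF.toLaxData_leftAt _

include hF

variable {N : MonoidalObject D} {f : LaxData A N} {g : LaxData A' N} (e : F ≫ g.F = f.F)
  (hφ : ∀ {X : D} (a b : X ⟶ A.C), g.phiAt (a ≫ F) (b ≫ F) ≍ f.phiAt a b)

include e hφ

/-- If `f` is the composite of a strict monoidal `F` with `g`, also on the lax structure, then the
associativity axiom of `f` is that of `g` at elements in the image of `F`. -/
theorem laxAssocAt {X : D} {a b c : X ⟶ A.C} (H : f.AssocAt a b c) :
    g.AssocAt (a ≫ F) (b ≫ F) (c ≫ F) := by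
  have ct := fun x y : X ⟶ A.C => hF.tens_comp x y
  have e' : ∀ x : X ⟶ A.C, (x ≫ F) ≫ g.F = x ≫ f.F := fun x => by rw [Strict.assoc, e]
  have w1 := hφ a b
  have w2 := hφ b c
  have w3 := hφ a (tens A.ten b c)
  have w4 := hφ (tens A.ten a b) c
  have w5 := hF.assoc a b c
  have w6 := whiskerRight_comp_heq (A.assocAt a b c) F g.F
  have w7 := N.assocAt_congr (e' a) (e' b) (e' c)
  unfold LaxData.AssocAt at H ⊢
  grind

/-- The analogue of `laxAssocAt` for the right unit axiom. -/
theorem laxRightAt (hφ₀ : ∀ X : D, g.phi₀At X ≍ f.phi₀At X) {X : D} {a : X ⟶ A.C}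
    (H : f.RightAt a) : g.RightAt (a ≫ F) := by
  have ct := fun x y : X ⟶ A.C => hF.tens_comp x y
  have eu := hF.unitAt_comp X
  have e' : ∀ x : X ⟶ A.C, (x ≫ F) ≫ g.F = x ≫ f.F := fun x => by rw [Strict.assoc, e]
  have w1 := hφ a (A.unitAt X)
  have w2 := hφ₀ X
  have w5 := hF.right a
  have w6 := whiskerRight_comp_heq (A.rightAt a) F g.F
  have w7 := rightAt_heq N (e' a)
  unfold LaxData.RightAt at H ⊢
  grind

/-- The analogue of `laxAssocAt` for the left unit axiom. -/
theorem laxLeftAt (hφ₀ : ∀ X : D, g.phi₀At X ≍ f.phi₀At X) {X : D} {a : X ⟶ A.C}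
    (H : f.LeftAt a) : g.LeftAt (a ≫ F) := by
  have ct := fun x y : X ⟶ A.C => hF.tens_comp x y
  have eu := hF.unitAt_comp X
  have e' : ∀ x : X ⟶ A.C, (x ≫ F) ≫ g.F = x ≫ f.F := fun x => by rw [Strict.assoc, e]
  have w1 := hφ (A.unitAt X) a
  have w2 := hφ₀ X
  have w5 := hF.left a
  have w6 := whiskerRight_comp_heq (A.leftAt a) F g.F
  have w7 := leftAt_heq N (e' a)
  unfold LaxData.LeftAt at H ⊢
  grind

end IsStrictMonoidal

namespace MonoidalObject.LaxData

variable {A N : MonoidalObject D} {g : LaxData A N} {X Y : D} {h : Y ⟶ X} (hh : Cofaithful h)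
include hh

/-- The associativity axiom of a lax monoidal `1`-cell can be tested after composition with a
cofaithful `1`-cell; similarly for the unit axioms below. -/
theorem assocAt_of_cofaithful {a b c : X ⟶ A.C} {a' b' c' : Y ⟶ A.C} (ha : h ≫ a = a')
    (hb : h ≫ b = b') (hc : h ≫ c = c') (H : g.AssocAt a' b' c') : g.AssocAt a b c := by
  subst ha hb hc
  apply hh
  have ct : ∀ x y : X ⟶ A.C, h ≫ tens A.ten x y = tens A.ten (h ≫ x) (h ≫ y) :=
    comp_tens A.ten h
  have ct' : ∀ x y : X ⟶ N.C, h ≫ tens N.ten x y = tens N.ten (h ≫ x) (h ≫ y) :=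
    comp_tens N.ten h
  have e' : ∀ x : X ⟶ A.C, h ≫ x ≫ g.F = (h ≫ x) ≫ g.F := fun x => (Strict.assoc _ _ _).symm
  have w1 := whiskerLeft_tens₂ N.ten h (g.phiAt a b) (𝟙 (c ≫ g.F))
  have w2 := whiskerLeft_tens₂ N.ten h (𝟙 (a ≫ g.F)) (g.phiAt b c)
  have w3 := A.whiskerLeft_assocAt h (a := a) (b := b) (c := c) rfl rfl rfl
  have w4 := N.whiskerLeft_assocAt h (e' a) (e' b) (e' c)
  have w5 := g.whiskerLeft_phiAt h (a := a) (b := b) rfl rfl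
  have w6 := g.whiskerLeft_phiAt h (a := b) (b := c) rfl rfl
  have w7 := g.whiskerLeft_phiAt h (a := a) (b := tens A.ten b c) rfl (ct b c)
  have w8 := g.whiskerLeft_phiAt h (a := tens A.ten a b) (b := c) (ct a b) rfl
  have w9 := whisker_assoc_heq h (A.assocAt a b c) g.F
  simp only [whiskerLeft_comp]
  unfold LaxData.AssocAt at H
  rw [whiskerLeft_id] at w1 w2
  grind

theorem rightAt_of_cofaithful {a : X ⟶ A.C} {a' : Y ⟶ A.C} (ha : h ≫ a = a')
    (H : g.RightAt a') : g.RightAt a := by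
  subst ha
  apply hh
  have ct : ∀ x y : X ⟶ A.C, h ≫ tens A.ten x y = tens A.ten (h ≫ x) (h ≫ y) :=
    comp_tens A.ten h
  have ct' : ∀ x y : X ⟶ N.C, h ≫ tens N.ten x y = tens N.ten (h ≫ x) (h ≫ y) :=
    comp_tens N.ten h
  have e' : ∀ x : X ⟶ A.C, h ≫ x ≫ g.F = (h ≫ x) ≫ g.F := fun x => (Strict.assoc _ _ _).symm
  have eu := A.comp_unitAt h
  have eu' := N.comp_unitAt h
  have w2 := whiskerLeft_tens₂ N.ten h (𝟙 (a ≫ g.F)) (g.phi₀At X)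
  have w3 := A.whiskerLeft_rightAt h (a := a) rfl
  have w4 := N.whiskerLeft_rightAt h (e' a)
  have w5 := g.whiskerLeft_phiAt h (a := a) (b := A.unitAt X) rfl eu
  have w6 := g.whiskerLeft_phi₀At h
  have w9 := whisker_assoc_heq h (A.rightAt a) g.F
  simp only [whiskerLeft_comp]
  unfold LaxData.RightAt at H
  rw [whiskerLeft_id] at w2
  grind

theorem leftAt_of_cofaithful {a : X ⟶ A.C} {a' : Y ⟶ A.C} (ha : h ≫ a = a')
    (H : g.LeftAt a') : g.LeftAt a := by
  subst ha
  apply hh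
  have ct : ∀ x y : X ⟶ A.C, h ≫ tens A.ten x y = tens A.ten (h ≫ x) (h ≫ y) :=
    comp_tens A.ten h
  have ct' : ∀ x y : X ⟶ N.C, h ≫ tens N.ten x y = tens N.ten (h ≫ x) (h ≫ y) :=
    comp_tens N.ten h
  have e' : ∀ x : X ⟶ A.C, h ≫ x ≫ g.F = (h ≫ x) ≫ g.F := fun x => (Strict.assoc _ _ _).symm
  have eu := A.comp_unitAt h
  have eu' := N.comp_unitAt h
  have w2 := whiskerLeft_tens₂ N.ten h (g.phi₀At X) (𝟙 (a ≫ g.F))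
  have w3 := A.whiskerLeft_leftAt h (a := a) rfl
  have w4 := N.whiskerLeft_leftAt h (e' a)
  have w5 := g.whiskerLeft_phiAt h (a := A.unitAt X) (b := a) eu rfl
  have w6 := g.whiskerLeft_phi₀At h
  have w9 := whisker_assoc_heq h (A.leftAt a) g.F
  simp only [whiskerLeft_comp]
  unfold LaxData.LeftAt at H
  rw [whiskerLeft_id] at w2
  grind

end MonoidalObject.LaxData

end StrictMonoidal

/-- Factorization of an invertible `2`-cell through a universal arrow. -/
theorem IsUniversalArrow.exists_iso₂_heq {B : Type u₁} [Bicategory.{w₁, v₁} B] {C : Type u₂}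
    [Bicategory.{w₂, v₂} C] {R : StrictPseudofunctor C B} {b : B} {c : C}
    {u : b ⟶ R.obj c} (hu : IsUniversalArrow R u) {d : C} {h k : c ⟶ d} {f g : b ⟶ R.obj d}
    (hf : u ≫ R.map h = f) (hg : u ≫ R.map k = g) (θ : f ≅ g) :
    ∃ e : h ≅ k, u ◁ R.map₂ e.hom ≍ θ.hom := by
  subst hf hg
  obtain ⟨ψ, hψ, -⟩ := hu.lift₂_unique θ.hom
  obtain ⟨ψ', hψ', -⟩ := hu.lift₂_unique θ.inv
  refine ⟨⟨ψ, ψ', hu.hom₂_ext ?_, hu.hom₂_ext ?_⟩, heq_of_eq hψ⟩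
  · rw [R.map₂_comp, Bicategory.whiskerLeft_comp, hψ, hψ', θ.hom_inv_id, R.map₂_id,
      Bicategory.whiskerLeft_id]
  · rw [R.map₂_comp, Bicategory.whiskerLeft_comp, hψ, hψ', θ.inv_hom_id, R.map₂_id,
      Bicategory.whiskerLeft_id]

theorem MndOp.σ_heq {D : Type u} [Bicategory.{w, v} D] {M N : MndOp D} {f g f' g' : M ⟶ N}
    (hf : f = f') (hg : g = g') {s : f ⟶ g} {s' : f' ⟶ g'} (h : s ≍ s') :
    MndOp.Hom₂.σ s ≍ MndOp.Hom₂.σ s' := by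
  cases hf; cases hg; cases h; rfl

section StrictMonoidal

variable {D : Type u} [Bicategory.{w, v} D] [Strict D] [FiniteProducts D]

theorem lift_comp_lift {X A B A' B' : D} (a : X ⟶ A) (b : X ⟶ B) (f : A ⟶ A') (g : B ⟶ B') :
    lift a b ≫ lift (fst A B ≫ f) (snd A B ≫ g) = lift (a ≫ f) (b ≫ g) := by
  rw [comp_lift, ← Strict.assoc, ← Strict.assoc, lift_fst, lift_snd]

/-- Strict preservation of the constraints can be tested at the projections. The `1`-cell `G` is
`F × (F × F)`, given by its action on generalized elements. -/
theorem IsStrictMonoidal.of_projections {A A' : MonoidalData D} {F : A.C ⟶ A'.C}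
    {G : prod A.C (prod A.C A.C) ⟶ prod A'.C (prod A'.C A'.C)}
    (ten : lift (fst A.C A.C ≫ F) (snd A.C A.C ≫ F) ≫ A'.ten = A.ten ≫ F)
    (unit : A'.unit = A.unit ≫ F)
    (hG : ∀ {X : D} (a b c : X ⟶ A.C),
      lift a (lift b c) ≫ G = lift (a ≫ F) (lift (b ≫ F) (c ≫ F)))
    (assoc : G ◁ A'.assoc.hom ≍ A.assocAt (fst A.C (prod A.C A.C))
      (snd A.C (prod A.C A.C) ≫ fst A.C A.C) (snd A.C (prod A.C A.C) ≫ snd A.C A.C) ▷ F)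
    (left : F ◁ A'.left.hom ≍ A.leftAt (𝟙 A.C) ▷ F)
    (right : F ◁ A'.right.hom ≍ A.rightAt (𝟙 A.C) ▷ F) : IsStrictMonoidal A A' F := by
  have ct : ∀ {X : D} (a b : X ⟶ A.C), tens A'.ten (a ≫ F) (b ≫ F) = tens A.ten a b ≫ F := by
    intro X a b
    rw [tens, ← lift_comp_lift, Strict.assoc, ten, ← Strict.assoc, tens]
  have cu : ∀ X : D, A'.unitAt X = A.unitAt X ≫ F := fun X => by
    rw [MonoidalData.unitAt, unit, ← Strict.assoc, MonoidalData.unitAt]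
  refine ⟨ten, unit, fun {X} a b c => ?_, fun {X} a => ?_, fun {X} a => ?_⟩
  · have e : ∀ {Y : D} (k : prod A'.C (prod A'.C A'.C) ⟶ Y), G ≫ k =
        lift (fst A.C (prod A.C A.C) ≫ F) (lift ((snd A.C (prod A.C A.C) ≫ fst A.C A.C) ≫ F)
          ((snd A.C (prod A.C A.C) ≫ snd A.C A.C) ≫ F)) ≫ k := fun k => by
      rw [← hG, ← comp_lift, lift_fst_snd, Strict.comp_id, lift_fst_snd, Strict.id_comp]
    refine (conj_heq _ _ _).trans ?_
    refine (whiskerLeft_heq (hG a b c).symm rfl rfl HEq.rfl).trans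
      ((comp_whiskerLeft_heq _ _ _).trans ?_)
    refine (whiskerLeft_heq rfl ?_ ?_ assoc).trans ?_
    · rw [e, A'.assocAt_dom, ct, ct]
    · rw [e, A'.assocAt_cod, ct, ct]
    · refine (whisker_assoc_heq _ _ _).symm.trans (whiskerRight_heq ?_ ?_ rfl
        (A.whiskerLeft_assocAt _ (lift_fst _ _) ?_ ?_))
      · rw [A.assocAt_dom]
      · rw [A.assocAt_cod]
      · rw [← Strict.assoc, lift_snd, lift_fst]
      · rw [← Strict.assoc, lift_snd, lift_snd]
  · refine (conj_heq _ _ _).trans ((comp_whiskerLeft_heq _ _ _).trans ?_)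
    refine (whiskerLeft_heq rfl ?_ ?_ left).trans ?_
    · rw [A'.leftAt_dom, cu, ← ct, Strict.id_comp]
    · rw [Strict.comp_id, Strict.id_comp]
    · refine (whisker_assoc_heq _ _ _).symm.trans (whiskerRight_heq ?_ (Strict.comp_id a) rfl
        (A.whiskerLeft_leftAt _ (Strict.comp_id a)))
      rw [comp_tens, A.comp_unitAt, Strict.comp_id]
  · refine (conj_heq _ _ _).trans ((comp_whiskerLeft_heq _ _ _).trans ?_)
    refine (whiskerLeft_heq rfl ?_ ?_ right).trans ?_
    · rw [A'.rightAt_dom, cu, ← ct, Strict.id_comp]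
    · rw [Strict.comp_id, Strict.id_comp]
    · refine (whisker_assoc_heq _ _ _).symm.trans (whiskerRight_heq ?_ (Strict.comp_id a) rfl
        (A.whiskerLeft_rightAt _ (Strict.comp_id a)))
      rw [comp_tens, A.comp_unitAt, Strict.comp_id]

end StrictMonoidal

/-! ### The monoidal structure of a Kleisli object -/

section KleisliObjects

variable {D : Type u} [Bicategory.{w, v} D] [Strict D]

/-- The underlying `1`-cell of a universal arrow to `ι` is cofaithful, because a `2`-cell of monads
is determined by its underlying `2`-cell. -/
theorem IsUniversalArrow.cofaithful {Z : MndOp D} {W : D} {z : Z ⟶ (iota D).obj W}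
    (hz : IsUniversalArrow (iota D) z) : Cofaithful (MndOp.Hom.F z) := by
  intro Y h k θ θ' e
  exact hz.hom₂_ext (MndOp.hom₂_ext e)

/-- An invertible `2`-cell of monads descends along universal arrows. -/
theorem IsUniversalArrow.exists_iso_whisker_heq {Z T : MndOp D} {W X : D}
    {z : Z ⟶ (iota D).obj W} (hz : IsUniversalArrow (iota D) z) (u : T ⟶ (iota D).obj X)
    {h k : W ⟶ X} {f g : Z ⟶ T} (hh : z ≫ (iota D).map h = f ≫ u)
    (hk : z ≫ (iota D).map k = g ≫ u) (e : f ≅ g) :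
    ∃ e' : h ≅ k, MndOp.Hom.F z ◁ e'.hom ≍ MndOp.Hom₂.σ e.hom ▷ MndOp.Hom.F u := by
  obtain ⟨e', he⟩ := hz.exists_iso₂_heq hh hk (whiskerRightIso e u)
  exact ⟨e', MndOp.σ_heq hh hk he⟩

/-- An oplax morphism from an identity monad is determined by its underlying `1`-cell. -/
theorem hom_from_idMonad_ext {A : D} {N : MndOp D} {f g : idMonad A ⟶ N}
    (h : MndOp.Hom.F f = MndOp.Hom.F g) : f = g := by
  have key : ∀ f : MndOp.Hom (idMonad A) N, f.τ ≍ f.F ◁ N.η := fun f => by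
    refine HEq.trans ?_ f.heq_η
    exact (id_comp_heq rfl f.τ (id_whiskerRight _ _)).symm
  exact MndOp.hom_ext h ((key f).trans ((whiskerLeft_heq h rfl rfl HEq.rfl).trans (key g).symm))

variable [FiniteProducts D] {K : StrictPseudofunctor (MndOp D) D} (adj : TwoAdjunction K (iota D))

include adj in
/-- As a right `2`-adjoint, `ι` preserves products. -/
theorem isBinaryProduct_iota (A B : D) :
    IsBinaryProduct ((iota D).map (fst A B)) ((iota D).map (snd A B)) :=
  map_isBinaryProduct_of_universal (fun b => ⟨_, _, adj.isUniversalArrow_unit b⟩)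
    (isBinaryProduct A B)

/-- The pairing of two oplax morphisms into identity monads. -/
noncomputable def iotaLift {Z : MndOp D} {A B : D} (x : Z ⟶ (iota D).obj A)
    (y : Z ⟶ (iota D).obj B) : Z ⟶ (iota D).obj (prod A B) :=
  ((isBinaryProduct_iota adj A B).lift_unique x y).choose

theorem iotaLift_fst {Z : MndOp D} {A B : D} (x : Z ⟶ (iota D).obj A)
    (y : Z ⟶ (iota D).obj B) : iotaLift adj x y ≫ (iota D).map (fst A B) = x :=
  ((isBinaryProduct_iota adj A B).lift_unique x y).choose_spec.1.1

theorem iotaLift_snd {Z : MndOp D} {A B : D} (x : Z ⟶ (iota D).obj A)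
    (y : Z ⟶ (iota D).obj B) : iotaLift adj x y ≫ (iota D).map (snd A B) = y :=
  ((isBinaryProduct_iota adj A B).lift_unique x y).choose_spec.1.2

include adj in
theorem iota_hom_ext {Z : MndOp D} {A B : D} {x y : Z ⟶ (iota D).obj (prod A B)}
    (h₁ : x ≫ (iota D).map (fst A B) = y ≫ (iota D).map (fst A B))
    (h₂ : x ≫ (iota D).map (snd A B) = y ≫ (iota D).map (snd A B)) : x = y :=
  ((isBinaryProduct_iota adj A B).lift_unique _ _).unique ⟨h₁, h₂⟩ ⟨rfl, rfl⟩

theorem iotaLift_F {Z : MndOp D} {A B : D} (x : Z ⟶ (iota D).obj A)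
    (y : Z ⟶ (iota D).obj B) : MndOp.Hom.F (iotaLift adj x y) =
      lift (MndOp.Hom.F x) (MndOp.Hom.F y) :=
  FiniteProducts.hom_ext
    ((congrArg MndOp.Hom.F (iotaLift_fst adj x y)).trans (lift_fst _ _).symm)
    ((congrArg MndOp.Hom.F (iotaLift_snd adj x y)).trans (lift_snd _ _).symm)

/-- The product `u × u'` of arrows into identity monads. -/
noncomputable def iotaProd {S T : MndOp D} {A B : D} (u : S ⟶ (iota D).obj A)
    (u' : T ⟶ (iota D).obj B) : prod S T ⟶ (iota D).obj (prod A B) :=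
  iotaLift adj (fst S T ≫ u) (snd S T ≫ u')

theorem iotaProd_F {S T : MndOp D} {A B : D} (u : S ⟶ (iota D).obj A)
    (u' : T ⟶ (iota D).obj B) : MndOp.Hom.F (iotaProd adj u u') =
      lift (fst S.C T.C ≫ MndOp.Hom.F u) (snd S.C T.C ≫ MndOp.Hom.F u') :=
  iotaLift_F adj _ _

theorem iotaProd_fst {S T : MndOp D} {A B : D} (u : S ⟶ (iota D).obj A)
    (u' : T ⟶ (iota D).obj B) : iotaProd adj u u' ≫ (iota D).map (fst A B) = fst S T ≫ u :=
  iotaLift_fst adj _ _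

theorem iotaProd_snd {S T : MndOp D} {A B : D} (u : S ⟶ (iota D).obj A)
    (u' : T ⟶ (iota D).obj B) : iotaProd adj u u' ≫ (iota D).map (snd A B) = snd S T ≫ u' :=
  iotaLift_snd adj _ _

theorem iotaProd_snd_comp {S T : MndOp D} {A B Y : D} (u : S ⟶ (iota D).obj A)
    (u' : T ⟶ (iota D).obj B) {k : B ⟶ Y} {x : T ⟶ (iota D).obj Y}
    (h : u' ≫ (iota D).map k = x) :
    iotaProd adj u u' ≫ (iota D).map (snd A B ≫ k) = snd S T ≫ x := by
  rw [(iota D).map_comp, ← Strict.assoc, iotaProd_snd, Strict.assoc, h]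

theorem iotaProd_snd_fst {S T R : MndOp D} {A B Y : D} (u : S ⟶ (iota D).obj A)
    (u' : T ⟶ (iota D).obj B) (u'' : R ⟶ (iota D).obj Y) :
    iotaProd adj u (iotaProd adj u' u'') ≫ (iota D).map (snd A (prod B Y) ≫ fst B Y) =
      (snd S (prod T R) ≫ fst T R) ≫ u' :=
  (iotaProd_snd_comp adj _ _ (iotaProd_fst adj u' u'')).trans (Strict.assoc _ _ _).symm

theorem iotaProd_snd_snd {S T R : MndOp D} {A B Y : D} (u : S ⟶ (iota D).obj A)
    (u' : T ⟶ (iota D).obj B) (u'' : R ⟶ (iota D).obj Y) :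
    iotaProd adj u (iotaProd adj u' u'') ≫ (iota D).map (snd A (prod B Y) ≫ snd B Y) =
      (snd S (prod T R) ≫ snd T R) ≫ u'' :=
  (iotaProd_snd_comp adj _ _ (iotaProd_snd adj u' u'')).trans (Strict.assoc _ _ _).symm

/-- Generalized elements of a product of monads, composed with a product of arrows. -/
theorem lift_comp_iotaProd_F {S T : MndOp D} {A B Y : D} (u : S ⟶ (iota D).obj A)
    (u' : T ⟶ (iota D).obj B) (a : Y ⟶ S.C) (b : Y ⟶ T.C) :
    lift a b ≫ MndOp.Hom.F (iotaProd adj u u') =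
      lift (a ≫ MndOp.Hom.F u) (b ≫ MndOp.Hom.F u') :=
  (congrArg (fun k => lift a b ≫ k) (iotaProd_F adj u u')).trans (lift_comp_lift _ _ _ _)

theorem isUniversalArrow_iotaProd (hK : PreservesFiniteProducts K) {S T : MndOp D} {A B : D}
    {u : S ⟶ (iota D).obj A} (hu : IsUniversalArrow (iota D) u) {u' : T ⟶ (iota D).obj B}
    (hu' : IsUniversalArrow (iota D) u') : IsUniversalArrow (iota D) (iotaProd adj u u') :=
  adj.isUniversalArrow_prod hK (isBinaryProduct S T) (isBinaryProduct A B) hu hu'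
    (iotaLift_fst adj _ _) (iotaLift_snd adj _ _)

theorem comp_iota_lift {Z S : MndOp D} {W A : D} {u : S ⟶ (iota D).obj A}
    {z : Z ⟶ (iota D).obj W} {x y : Z ⟶ S} {x' y' : W ⟶ A}
    (hx : z ≫ (iota D).map x' = x ≫ u) (hy : z ≫ (iota D).map y' = y ≫ u) :
    z ≫ (iota D).map (lift x' y') = lift x y ≫ iotaProd adj u u := by
  apply iota_hom_ext adj
  · rw [Strict.assoc, ← (iota D).map_comp, lift_fst, hx, Strict.assoc, iotaProd, iotaLift_fst,
      ← Strict.assoc, lift_fst]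
  · rw [Strict.assoc, ← (iota D).map_comp, lift_snd, hy, Strict.assoc, iotaProd, iotaLift_snd,
      ← Strict.assoc, lift_snd]

/-- If `t` is the descent of `t'` along `u × u` and `x'`, `y'` are the descents of `x`, `y` along
`z`, then `t(x', y')` is the descent of `t'(x, y)` along `z`. -/
theorem comp_iota_tens {Z S : MndOp D} {W X : D} {u : S ⟶ (iota D).obj X} {t : prod X X ⟶ X}
    {t' : prod S S ⟶ S} (ht : iotaProd adj u u ≫ (iota D).map t = t' ≫ u)
    {z : Z ⟶ (iota D).obj W} {x y : Z ⟶ S} {x' y' : W ⟶ X}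
    (hx : z ≫ (iota D).map x' = x ≫ u) (hy : z ≫ (iota D).map y' = y ≫ u) :
    z ≫ (iota D).map (tens t x' y') = tens t' x y ≫ u := by
  change z ≫ (iota D).map (lift x' y' ≫ t) = (lift x y ≫ t') ≫ u
  rw [(iota D).map_comp, ← Strict.assoc, comp_iota_lift adj hx hy, Strict.assoc, ht,
    ← Strict.assoc]

variable (hK : PreservesFiniteProducts K) (M : MndOp (MonoidalObject D)) {X : D}
  {u : MndOp.und M ⟶ (iota D).obj X} (hu : IsUniversalArrow (iota D) u)

variable {M} in
/-- The constant `1`-cell at the unit of the Kleisli object is the descent of the constant oplax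
morphism at the unit. -/
theorem comp_iota_unit {Z : MndOp D} {W : D} (z : Z ⟶ (iota D).obj W) :
    z ≫ (iota D).map (bang W ≫ M.C.unit ≫ MndOp.Hom.F u) = MndOp.unitE M Z ≫ u := by
  have h : (iota D).map (M.C.unit ≫ MndOp.Hom.F u) = MndOp.unitHom M ≫ u :=
    hom_from_idMonad_ext rfl
  have e : z ≫ (iota D).map (bang W) = bang (D := MndOp D) Z := bang_ext (D := MndOp D) _ _
  rw [(iota D).map_comp, ← Strict.assoc]
  exact (congrArg₂ (fun (a : Z ⟶ (iota D).obj one) (b : (iota D).obj one ⟶ (iota D).obj X) =>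
    a ≫ b) e h).trans (Strict.assoc _ _ _).symm

namespace KleisliMonoidal

include hK hu in
theorem exists_ten : ∃ t : prod X X ⟶ X,
    iotaProd adj u u ≫ (iota D).map t = MndOp.tensHom M ≫ u :=
  ((isUniversalArrow_iotaProd adj hK hu hu).lift_unique _).exists

/-- The tensor product of the Kleisli object of a monoidal monad. -/
noncomputable def ten : prod X X ⟶ X := (exists_ten adj hK M hu).choose

theorem ten_spec : iotaProd adj u u ≫ (iota D).map (ten adj hK M hu) = MndOp.tensHom M ≫ u :=
  (exists_ten adj hK M hu).choose_spec

/-- The associativity constraint descends along `u × (u × u)`. -/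
theorem exists_assoc : ∃ e : tens (ten adj hK M hu) (fst X (prod X X)) (tens (ten adj hK M hu)
      (snd X (prod X X) ≫ fst X X) (snd X (prod X X) ≫ snd X X)) ≅
    tens (ten adj hK M hu) (tens (ten adj hK M hu) (fst X (prod X X))
      (snd X (prod X X) ≫ fst X X)) (snd X (prod X X) ≫ snd X X),
    MndOp.Hom.F (iotaProd adj u (iotaProd adj u u)) ◁ e.hom ≍
      M.C.assocAt (fst M.C.C (prod M.C.C M.C.C)) (snd M.C.C (prod M.C.C M.C.C) ≫ fst M.C.C M.C.C)
        (snd M.C.C (prod M.C.C M.C.C) ≫ snd M.C.C M.C.C) ▷ MndOp.Hom.F u := by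
  have hz := isUniversalArrow_iotaProd adj hK hu (isUniversalArrow_iotaProd adj hK hu hu)
  have h1 := iotaProd_fst adj u (iotaProd adj u u)
  have h3 := iotaProd_snd_fst adj u u u
  have h4 := iotaProd_snd_snd adj u u u
  have ht := ten_spec adj hK M hu
  have s1 := MndOp.isStrictHom_fst (MndOp.und M) (prod (MndOp.und M) (MndOp.und M))
  have s2 := (MndOp.isStrictHom_snd (MndOp.und M) (prod (MndOp.und M) (MndOp.und M))).comp
    (MndOp.isStrictHom_fst (MndOp.und M) (MndOp.und M))
  have s3 := (MndOp.isStrictHom_snd (MndOp.und M) (prod (MndOp.und M) (MndOp.und M))).comp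
    (MndOp.isStrictHom_snd (MndOp.und M) (MndOp.und M))
  obtain ⟨e, he⟩ := MndOp.exists_assocE s1 s2 s3
  obtain ⟨e', he'⟩ := hz.exists_iso_whisker_heq u
    (comp_iota_tens adj ht h1 (comp_iota_tens adj ht h3 h4))
    (comp_iota_tens adj ht (comp_iota_tens adj ht h1 h3) h4) e
  refine ⟨e', he'.trans (whiskerRight_heq ?_ ?_ rfl he)⟩
  · exact (MndOp.tensE_F _ _).trans (congrArg (fun k => tens M.C.ten _ k) (MndOp.tensE_F _ _))
  · exact (MndOp.tensE_F _ _).trans (congrArg (fun k => tens M.C.ten k _) (MndOp.tensE_F _ _))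

/-- The left unit constraint descends along `u`. -/
theorem exists_left :
    ∃ e : tens (ten adj hK M hu) (bang X ≫ M.C.unit ≫ MndOp.Hom.F u) (𝟙 X) ≅ 𝟙 X,
    MndOp.Hom.F u ◁ e.hom ≍ M.C.leftAt (𝟙 M.C.C) ▷ MndOp.Hom.F u := by
  have h1 : u ≫ (iota D).map (𝟙 X) = 𝟙 _ ≫ u := by
    rw [(iota D).map_id, Strict.comp_id, Strict.id_comp]
  have ht := ten_spec adj hK M hu
  obtain ⟨e, he⟩ := MndOp.exists_leftE (MndOp.isStrictHom_id (MndOp.und M))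
  obtain ⟨e', he'⟩ := hu.exists_iso_whisker_heq u
    (comp_iota_tens adj ht (comp_iota_unit u) h1) h1 e
  refine ⟨e', he'.trans (whiskerRight_heq ?_ rfl rfl he)⟩
  exact (MndOp.tensE_F _ _).trans (congrArg (fun k => tens M.C.ten k _) (MndOp.unitE_F _))

/-- The right unit constraint descends along `u`. -/
theorem exists_right :
    ∃ e : tens (ten adj hK M hu) (𝟙 X) (bang X ≫ M.C.unit ≫ MndOp.Hom.F u) ≅ 𝟙 X,
    MndOp.Hom.F u ◁ e.hom ≍ M.C.rightAt (𝟙 M.C.C) ▷ MndOp.Hom.F u := by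
  have h1 : u ≫ (iota D).map (𝟙 X) = 𝟙 _ ≫ u := by
    rw [(iota D).map_id, Strict.comp_id, Strict.id_comp]
  have ht := ten_spec adj hK M hu
  obtain ⟨e, he⟩ := MndOp.exists_rightE (MndOp.isStrictHom_id (MndOp.und M))
  obtain ⟨e', he'⟩ := hu.exists_iso_whisker_heq u
    (comp_iota_tens adj ht h1 (comp_iota_unit u)) h1 e
  refine ⟨e', he'.trans (whiskerRight_heq ?_ rfl rfl he)⟩
  exact (MndOp.tensE_F _ _).trans (congrArg (fun k => tens M.C.ten _ k) (MndOp.unitE_F _))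

/-- The tensor product, unit and constraints of the Kleisli object of a monoidal monad. -/
noncomputable def data : MonoidalData D where
  C := X
  ten := ten adj hK M hu
  unit := M.C.unit ≫ MndOp.Hom.F u
  assoc := (exists_assoc adj hK M hu).choose
  left := (exists_left adj hK M hu).choose
  right := (exists_right adj hK M hu).choose

/-- The universal arrow `u` preserves the monoidal structure strictly. -/
theorem isStrictMonoidal :
    IsStrictMonoidal M.C.toMonoidalData (data adj hK M hu) (MndOp.Hom.F u) :=
  IsStrictMonoidal.of_projections (A := M.C.toMonoidalData) (A' := data adj hK M hu)
    (G := MndOp.Hom.F (iotaProd adj u (iotaProd adj u u)))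
    ((congrArg (fun k => k ≫ ten adj hK M hu) (iotaProd_F adj u u)).symm.trans
      (congrArg MndOp.Hom.F (ten_spec adj hK M hu))) rfl
    (fun a b c => (lift_comp_iotaProd_F adj u (iotaProd adj u u) a (lift b c)).trans
      (congrArg (fun k => lift _ k) (lift_comp_iotaProd_F adj u u b c)))
    (exists_assoc adj hK M hu).choose_spec (exists_left adj hK M hu).choose_spec
    (exists_right adj hK M hu).choose_spec

theorem data_pentagon : (data adj hK M hu).PentagonAt (fst X (prod X (prod X X)))
    (snd X (prod X (prod X X)) ≫ fst X (prod X X))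
    (snd X (prod X (prod X X)) ≫ snd X (prod X X) ≫ fst X X)
    (snd X (prod X (prod X X)) ≫ snd X (prod X X) ≫ snd X X) := by
  have hz := isUniversalArrow_iotaProd adj hK hu (isUniversalArrow_iotaProd adj hK hu
    (isUniversalArrow_iotaProd adj hK hu hu))
  refine MonoidalData.pentagonAt_of_cofaithful (A := data adj hK M hu) hz.cofaithful
    (congrArg MndOp.Hom.F (iotaProd_fst adj _ _))
    (congrArg MndOp.Hom.F (iotaProd_snd_fst adj _ _ _))
    (congrArg MndOp.Hom.F ((iotaProd_snd_comp adj _ _ (iotaProd_snd_fst adj _ _ _)).trans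
      (Strict.assoc _ _ _).symm))
    (congrArg MndOp.Hom.F ((iotaProd_snd_comp adj _ _ (iotaProd_snd_snd adj _ _ _)).trans
      (Strict.assoc _ _ _).symm)) ?_
  exact (isStrictMonoidal adj hK M hu).pentagonAt M.C.pentagon

theorem data_triangle : (data adj hK M hu).TriangleAt (fst X X) (snd X X) :=
  MonoidalData.triangleAt_of_cofaithful (A := data adj hK M hu)
    (isUniversalArrow_iotaProd adj hK hu hu).cofaithful
    (congrArg MndOp.Hom.F (iotaProd_fst adj _ _)) (congrArg MndOp.Hom.F (iotaProd_snd adj _ _))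
    ((isStrictMonoidal adj hK M hu).triangleAt M.C.triangle)

end KleisliMonoidal

/-- The Kleisli object of a monoidal monad as a monoidal object. -/
noncomputable def kleisliMonoidal : MonoidalObject D where
  toMonoidalData := KleisliMonoidal.data adj hK M hu
  pentagon := KleisliMonoidal.data_pentagon adj hK M hu
  triangle := KleisliMonoidal.data_triangle adj hK M hu

namespace KleisliMonoidal

/-- The universal arrow of the underlying monad as a strict monoidal `1`-cell. -/
noncomputable def arrow : MonoidalObject.Hom M.C (kleisliMonoidal adj hK M hu) :=
  IsStrictMonoidal.toHom (A := M.C) (A' := kleisliMonoidal adj hK M hu)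
    (isStrictMonoidal adj hK M hu)

end KleisliMonoidal

end KleisliObjects

/-! ### Structure `2`-cells of composites with a strict morphism -/

section IotaMaps

variable {D : Type u} [Bicategory.{w, v} D] [Strict D]

/-- Cancellation of a cofaithful `1`-cell in a heterogeneous equality. -/
theorem Cofaithful.heq {X Y Z : D} {f : X ⟶ Y} (hf : Cofaithful f) {h k h' k' : Y ⟶ Z}
    {θ : h ⟶ k} {θ' : h' ⟶ k'} (p : h = h') (q : k = k') (e : f ◁ θ ≍ f ◁ θ') : θ ≍ θ' := by
  subst p q
  exact heq_of_eq (hf (eq_of_heq e))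

namespace MndOp

/-- A `2`-cell between `1`-cells that are propositionally the underlying ones of two oplax
morphisms, as a `2`-cell of monads. -/
theorem exists_hom₂_of_heq {Z T : MndOp D} {f g : Z ⟶ T} {F G : Z.C ⟶ T.C} (hF : f.F = F)
    (hG : g.F = G) (σ : F ⟶ G) {τ : Z.S ≫ F ⟶ F ≫ T.S} {τ' : Z.S ≫ G ⟶ G ≫ T.S} (hτ : f.τ ≍ τ)
    (hτ' : g.τ ≍ τ') (h : Z.S ◁ σ ≫ τ' ≍ τ ≫ σ ▷ T.S) : ∃ s : f ⟶ g, Hom₂.σ s ≍ σ := by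
  subst hF hG hτ hτ'
  exact ⟨⟨σ, eq_of_heq h⟩, HEq.rfl⟩

theorem IsStrictHom.comp_τ {Z S T : MndOp D} {a : Z ⟶ S} (ha : IsStrictHom a) (u : S ⟶ T) :
    Hom.τ (a ≫ u) ≍ a.F ◁ u.τ := by
  obtain ⟨h, h'⟩ := ha
  obtain ⟨σ, hσ⟩ := exists_heq (Strict.assoc Z.S a.F u.F) rfl (a.τ ▷ u.F)
  obtain ⟨σ', hσ'⟩ := exists_heq (Strict.assoc a.F S.S u.F).symm rfl (a.F ◁ u.τ)
  refine (Hom.heq_comp_τ a u (Strict.assoc a.F S.S u.F) hσ hσ').trans (HEq.trans ?_ hσ')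
  have e : Z.S ≫ a.F ≫ u.F = (a.F ≫ S.S) ≫ u.F := by rw [← Strict.assoc, h]
  refine id_comp_heq e _ (eq_of_heq (hσ.trans ?_))
  rw [h', eqToHom_whiskerRight]
  exact eqToHom_heq _ _ (Strict.assoc _ _ _)

theorem isStrictHom_iota_map {W Y : D} (k : W ⟶ Y) : IsStrictHom ((iota D).map k) := by
  refine ⟨(Strict.id_comp k).trans (Strict.comp_id k).symm, ?_⟩
  change (λ_ k).hom ≫ (ρ_ k).inv = _
  rw [Strict.leftUnitor_eqToIso, Strict.rightUnitor_eqToIso]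
  exact eqToHom_trans (Strict.id_comp k) (Strict.comp_id k).symm

theorem IsStrictHom.τ_comp {Z S T : MndOp D} (z : Z ⟶ S) {b : S ⟶ T} (hb : IsStrictHom b) :
    Hom.τ (z ≫ b) ≍ z.τ ▷ b.F := by
  obtain ⟨h, h'⟩ := hb
  obtain ⟨σ, hσ⟩ := exists_heq (Strict.assoc Z.S z.F b.F) rfl (z.τ ▷ b.F)
  obtain ⟨σ', hσ'⟩ := exists_heq (Strict.assoc z.F S.S b.F).symm rfl (z.F ◁ b.τ)
  refine (Hom.heq_comp_τ z b (Strict.assoc z.F S.S b.F) hσ hσ').trans (HEq.trans ?_ hσ)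
  have e : (z.F ≫ S.S) ≫ b.F = z.F ≫ b.F ≫ T.S := by rw [Strict.assoc, h]
  refine comp_id_heq e _ (eq_of_heq (hσ'.trans ?_))
  rw [h', whiskerLeft_eqToHom]
  exact eqToHom_heq _ _ (Strict.assoc _ _ _).symm

theorem comp_iota_map_τ {Z : MndOp D} {W Y : D} (z : Z ⟶ (iota D).obj W) (k : W ⟶ Y) :
    Hom.τ (z ≫ (iota D).map k) ≍ z.τ ▷ k :=
  (isStrictHom_iota_map k).τ_comp z

end MndOp

end IotaMaps

namespace MonoidalObject

variable {D : Type u} [Bicategory.{w, v} D] [Strict D] [FiniteProducts D]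

theorem leftUnitor_inv_σ {M N : MonoidalObject D} (f : M ⟶ N) :
    MonoidalObject.Hom₂.σ (λ_ f).inv = (λ_ (LaxData.F (Hom.toLaxData f))).inv := by
  rw [Strict.leftUnitor_eqToIso, Strict.leftUnitor_eqToIso]
  exact eqToHom_σ (Hom.id_comp f).symm

theorem leftUnitor_hom_σ {M N : MonoidalObject D} (f : M ⟶ N) :
    MonoidalObject.Hom₂.σ (λ_ f).hom = (λ_ (LaxData.F (Hom.toLaxData f))).hom := by
  rw [Strict.leftUnitor_eqToIso, Strict.leftUnitor_eqToIso]
  exact eqToHom_σ (Hom.id_comp f)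

theorem rightUnitor_inv_σ {M N : MonoidalObject D} (f : M ⟶ N) :
    MonoidalObject.Hom₂.σ (ρ_ f).inv = (ρ_ (LaxData.F (Hom.toLaxData f))).inv := by
  rw [Strict.rightUnitor_eqToIso, Strict.rightUnitor_eqToIso]
  exact eqToHom_σ (Hom.comp_id f).symm

theorem associator_inv_σ {M N P Q : MonoidalObject D} (f : M ⟶ N) (g : N ⟶ P) (h : P ⟶ Q) :
    MonoidalObject.Hom₂.σ (α_ f g h).inv =
      (α_ (LaxData.F (Hom.toLaxData f)) (LaxData.F (Hom.toLaxData g))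
        (LaxData.F (Hom.toLaxData h))).inv := by
  rw [Strict.associator_eqToIso, Strict.associator_eqToIso]
  exact eqToHom_σ (Hom.comp_assoc f g h).symm

theorem hom₂_heq {M N : MonoidalObject D} {f g f' g' : M ⟶ N} (hf : f = f') (hg : g = g')
    {s : f ⟶ g} {t : f' ⟶ g'} (h : Hom₂.σ s ≍ Hom₂.σ t) : s ≍ t := by
  subst hf hg
  exact heq_of_eq (Hom₂.ext (eq_of_heq h))

end MonoidalObject

section Arrow

variable {D : Type u} [Bicategory.{w, v} D] [Strict D] [FiniteProducts D]
  {K : StrictPseudofunctor (MndOp D) D} (adj : TwoAdjunction K (iota D))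

/-- The structure `2`-cell of `t(f ∘ π₁, g ∘ π₂)`, where `f` and `g` factor through `u` and `u'`:
it is the tensor product of those of `f` and `g`. -/
theorem iotaProd_comp_tens_τ {S T : MndOp D} {A B Y : D} (u : S ⟶ (iota D).obj A)
    (u' : T ⟶ (iota D).obj B) (t : prod Y Y ⟶ Y) {a : A ⟶ Y} {b : B ⟶ Y}
    {f : S ⟶ (iota D).obj Y} {g : T ⟶ (iota D).obj Y} (hf : u ≫ (iota D).map a = f)
    (hg : u' ≫ (iota D).map b = g) :
    MndOp.Hom.τ (iotaProd adj u u' ≫ (iota D).map (tens t (fst A B ≫ a) (snd A B ≫ b))) ≍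
      tens₂ t (fst S.C T.C ◁ f.τ) (snd S.C T.C ◁ g.τ) := by
  subst hf hg
  refine (MndOp.comp_iota_map_τ _ _).trans ((whiskerRight_tens _ _ _ _).trans ?_)
  have e1 : iotaProd adj u u' ≫ (iota D).map (fst A B ≫ a) =
      fst S T ≫ u ≫ (iota D).map a := by
    rw [(iota D).map_comp, ← Strict.assoc, iotaProd_fst, Strict.assoc]
  have e2 : iotaProd adj u u' ≫ (iota D).map (snd A B ≫ b) =
      snd S T ≫ u' ≫ (iota D).map b := by
    rw [(iota D).map_comp, ← Strict.assoc, iotaProd_snd, Strict.assoc]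
  have h1 := ((MndOp.comp_iota_map_τ _ _).symm.trans (MndOp.τ_heq_of_eq e1)).trans
    ((MndOp.isStrictHom_fst S T).comp_τ _)
  have h2 := ((MndOp.comp_iota_map_τ _ _).symm.trans (MndOp.τ_heq_of_eq e2)).trans
    ((MndOp.isStrictHom_snd S T).comp_τ _)
  have d1 := congrArg MndOp.Hom.F e1
  have d2 := congrArg MndOp.Hom.F e2
  have c1 : ∀ {R Z : D} {p : MndOp.C (prod S T) ⟶ Z} {q : Z ⟶ R} {r : MndOp.C S ⟶ R}
      (_ : p ≫ q = fst S.C T.C ≫ r), ((prod S T).S ≫ p) ≫ q = fst S.C T.C ≫ S.S ≫ r :=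
    fun h => (Strict.assoc _ _ _).trans ((congrArg _ h).trans ((Strict.assoc _ _ _).symm.trans
      ((congrArg (fun k => k ≫ _) (MndOp.prodS_fst S T)).trans (Strict.assoc _ _ _))))
  have c2 : ∀ {R Z : D} {p : MndOp.C (prod S T) ⟶ Z} {q : Z ⟶ R} {r : MndOp.C T ⟶ R}
      (_ : p ≫ q = snd S.C T.C ≫ r), ((prod S T).S ≫ p) ≫ q = snd S.C T.C ≫ T.S ≫ r :=
    fun h => (Strict.assoc _ _ _).trans ((congrArg _ h).trans ((Strict.assoc _ _ _).symm.trans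
      ((congrArg (fun k => k ≫ _) (MndOp.prodS_snd S T)).trans (Strict.assoc _ _ _))))
  have c3 : ∀ {R Z V : D} {p : V ⟶ Z} {q : Z ⟶ R} {v : V ⟶ R}
      (_ : p ≫ q = v), (p ≫ 𝟙 Z) ≫ q = v ≫ 𝟙 R := fun h => by
    rw [Strict.comp_id, Strict.comp_id, h]
  exact tens₂_heq t (c1 d1) (c2 d2) ((c3 d1).trans (Strict.assoc _ _ _))
    ((c3 d2).trans (Strict.assoc _ _ _)) h1 h2

end Arrow

/-! ### Images of oplax morphisms under a `2`-functor -/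

section MapToIota

variable {B : Type u₁} [Bicategory.{w₁, v₁} B] {C : Type u₂} [Bicategory.{w₂, v₂} C]
  (G : StrictPseudofunctor B C)

theorem map₂_heq {a b : B} {f g f' g' : a ⟶ b} (hf : f = f') (hg : g = g') {θ : f ⟶ g}
    {θ' : f' ⟶ g'} (h : θ ≍ θ') : G.map₂ θ ≍ G.map₂ θ' := by
  subst hf hg h
  rfl

theorem mapMonadHom_τ {M N : MndOp B} (g : MndOp.Hom M N) :
    (mapMonadHom G g).τ ≍ G.map₂ g.τ := by
  change (G.mapComp M.S g.F).inv ≫ G.map₂ g.τ ≫ (G.mapComp g.F N.S).hom ≍ _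
  rw [G.mapComp_eq_eqToIso, G.mapComp_eq_eqToIso]
  exact conj_heq (G.map_comp _ _).symm _ (G.map_comp _ _)

variable [Strict C]

theorem isStrictHom_mapIdMonad (X : B) : MndOp.IsStrictHom (mapIdMonad G X) := by
  have e : G.map (𝟙 X) = 𝟙 (G.obj X) := G.map_id X
  have e' : 𝟙 (G.obj X) = 𝟙 (G.obj X) ≫ 𝟙 (G.obj X) := (Strict.comp_id _).symm
  refine ⟨(Strict.comp_id (G.map (𝟙 X))).trans (e.trans e'), ?_⟩
  change (ρ_ (G.map (𝟙 X))).hom ≫ (G.mapId X).hom ≫ (λ_ (𝟙 (G.obj X))).inv = _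
  rw [Strict.rightUnitor_eqToIso, Strict.leftUnitor_eqToIso, G.mapId_eq_eqToIso]
  simp only [eqToIso.hom, eqToIso.inv, eqToHom_trans]
  rfl

variable [Strict B]

/-- The oplax morphism `G M ⟶ ι (G Y)` induced by a `2`-functor `G` and an oplax morphism
`M ⟶ ι Y`. -/
def mapToIota {M : MndOp B} {Y : B} (g : M ⟶ (iota B).obj Y) :
    mapMonad G M ⟶ (iota C).obj (G.obj Y) :=
  (mapMonadHom G g).comp (mapIdMonad G Y)

variable {G}

theorem mapToIota_F {M : MndOp B} {Y : B} (g : M ⟶ (iota B).obj Y) :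
    MndOp.Hom.F (mapToIota G g) = G.map (MndOp.Hom.F g) :=
  Strict.comp_id _

theorem mapToIota_τ {M : MndOp B} {Y : B} (g : M ⟶ (iota B).obj Y) :
    MndOp.Hom.τ (mapToIota G g) ≍ G.map₂ (MndOp.Hom.τ g) :=
  ((isStrictHom_mapIdMonad G Y).τ_comp (mapMonadHom G g)).trans
    ((whiskerRight_id_heq _).trans (mapMonadHom_τ G g))

theorem mapToIota_comp_iota {M : MndOp B} {Y Y' : B} (z : M ⟶ (iota B).obj Y) (k : Y ⟶ Y') :
    mapToIota G (z ≫ (iota B).map k) = mapToIota G z ≫ (iota C).map (G.map k) := by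
  refine MndOp.hom_ext ?_ ?_
  · exact (mapToIota_F _).trans ((G.map_comp (MndOp.Hom.F z) k).trans
      (congrArg (fun t => t ≫ G.map k) (mapToIota_F z)).symm)
  · refine (mapToIota_τ _).trans ?_
    have h1 := map₂_heq G (Strict.assoc M.S (MndOp.Hom.F z) k).symm
      ((Strict.comp_id _).trans (congrArg (fun t => t ≫ k) (Strict.comp_id (MndOp.Hom.F z))).symm)
      (MndOp.comp_iota_map_τ z k)
    refine h1.trans ((map₂_whiskerRight_heq G _ _).trans
      (HEq.trans ?_ (MndOp.comp_iota_map_τ _ _).symm))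
    refine whiskerRight_heq ?_ ?_ rfl (mapToIota_τ z).symm
    · exact (G.map_comp _ _).trans (congrArg (fun t => G.map M.S ≫ t) (mapToIota_F z).symm)
    · exact (congrArg G.map (Strict.comp_id (MndOp.Hom.F z))).trans
        ((mapToIota_F z).symm.trans (Strict.comp_id _).symm)

theorem mapToIota_comp {M N : MndOp B} {Y : B} (f : M ⟶ N) (z : N ⟶ (iota B).obj Y) :
    mapToIota G (f ≫ z) = (mapMndOp G).map f ≫ mapToIota G z := by
  change (mapMonadHom G (MndOp.Hom.comp f z)).comp _ = _
  rw [mapMonadHom_comp]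
  exact Strict.assoc (B := MndOp C) _ _ _

/-- The transformation induced by a `2`-functor and a transformation between oplax morphisms into
an identity monad. -/
def mapToIota₂ {M : MndOp B} {Y : B} {g g' : M ⟶ (iota B).obj Y} (θ : g ⟶ g') :
    mapToIota G g ⟶ mapToIota G g' :=
  MndOp.Hom.whiskerRight (mapMonadHom₂ G θ) (mapIdMonad G Y)

theorem mapToIota₂_σ {M : MndOp B} {Y : B} {g g' : M ⟶ (iota B).obj Y} (θ : g ⟶ g') :
    MndOp.Hom₂.σ (mapToIota₂ (G := G) θ) ≍ G.map₂ (MndOp.Hom₂.σ θ) :=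
  whiskerRight_id_heq _

end MapToIota

/-! ### The universal arrow as an oplax morphism of monoidal monads -/

section MonoidalArrow

variable {D : Type u} [Bicategory.{w, v} D] [Strict D] [FiniteProducts D]
  {K : StrictPseudofunctor (MndOp D) D} (adj : TwoAdjunction K (iota D))
  (hK : PreservesFiniteProducts K) (M : MndOp (MonoidalObject D)) {X : D}
  {u : MndOp.und M ⟶ (iota D).obj X} (hu : IsUniversalArrow (iota D) u)

theorem MonoidalObject.φ_heq_of_eq {M N : MonoidalObject D} {f g : Hom M N} (h : f = g) :
    f.φ ≍ g.φ := by
  cases h; rfl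

theorem MonoidalObject.φ₀_heq_of_eq {M N : MonoidalObject D} {f g : Hom M N} (h : f = g) :
    f.φ₀ ≍ g.φ₀ := by
  cases h; rfl

namespace KleisliMonoidal

theorem arrow_phiAt {Y : D} (a b : Y ⟶ M.C.C) : (arrow adj hK M hu).phiAt a b =
    eqToHom ((isStrictMonoidal adj hK M hu).tens_comp a b) :=
  IsStrictMonoidal.toLaxData_phiAt (A := M.C) (A' := kleisliMonoidal adj hK M hu)
    (isStrictMonoidal adj hK M hu) a b

/-- The tensor product of two copies of the structure `2`-cell of `u` is the structure `2`-cell of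
`u × u` followed by the tensor product. -/
theorem tens₂_τ_heq : tens₂ (ten adj hK M hu) (fst M.C.C M.C.C ◁ MndOp.Hom.τ u)
      (snd M.C.C M.C.C ◁ MndOp.Hom.τ u) ≍
    MndOp.Hom.τ (iotaProd adj u u ≫ (iota D).map (ten adj hK M hu)) := by
  have h := iotaProd_comp_tens_τ adj u u (ten adj hK M hu)
    (show u ≫ (iota D).map (𝟙 X) = u by rw [(iota D).map_id, Strict.comp_id])
    (show u ≫ (iota D).map (𝟙 X) = u by rw [(iota D).map_id, Strict.comp_id])
  refine h.symm.trans (MndOp.τ_heq_of_eq ?_)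
  rw [Strict.comp_id, Strict.comp_id, tens, lift_fst_snd, Strict.id_comp]

/-- The structure `2`-cell of `u` is compatible with tensor products. Both sides are structure
`2`-cells of the two equal composites `(u × u) ≫ ⊗` and `⊗ ≫ u`. -/
theorem arrowτ_tensor : tens₂ (kleisliMonoidal adj hK M hu).ten (fst M.C.C M.C.C ◁ MndOp.Hom.τ u)
      (snd M.C.C M.C.C ◁ MndOp.Hom.τ u) ≫
      LaxData.φ (LaxData.comp (arrow adj hK M hu).toLaxData (LaxData.id _)) =
    LaxData.φ (LaxData.comp M.S.toLaxData (arrow adj hK M hu).toLaxData) ≫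
      M.C.ten ◁ MndOp.Hom.τ u := by
  have h1 := tens₂_τ_heq adj hK M hu
  have h2 := MndOp.τ_heq_of_eq (ten_spec adj hK M hu)
  have t := (isStrictMonoidal adj hK M hu).ten
  have t' := (isStrictMonoidal adj hK M hu).tens_comp (fst M.C.C M.C.C ≫ M.S.F)
    (snd M.C.C M.C.C ≫ M.S.F)
  obtain ⟨σ, hσ⟩ := exists_heq (Strict.assoc (MndOp.prodS (MndOp.und M) (MndOp.und M)) M.C.ten
    (MndOp.Hom.F u)) rfl (M.S.φ ▷ MndOp.Hom.F u)
  obtain ⟨σ', hσ'⟩ := exists_heq (Strict.assoc M.C.ten M.S.F (MndOp.Hom.F u)).symm rfl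
    (M.C.ten ◁ MndOp.Hom.τ u)
  have h3 := MndOp.Hom.heq_comp_τ (MndOp.tensHom M) u (Strict.assoc _ _ _) hσ hσ'
  have i1 : LaxData.φ (LaxData.comp (arrow adj hK M hu).toLaxData (LaxData.id _)) ≍
      eqToHom t := φ_heq_of_eq (Hom.comp_id (arrow adj hK M hu))
  have i2 := LaxData.comp_φ_heq M.S.toLaxData (arrow adj hK M hu).toLaxData
  rw [arrow_phiAt] at i2
  have c : MndOp.Hom.F u ≫ 𝟙 X = MndOp.Hom.F u := Strict.comp_id _
  have d : tens (ten adj hK M hu) (fst M.C.C M.C.C ≫ MndOp.Hom.F u ≫ 𝟙 X)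
      (snd M.C.C M.C.C ≫ MndOp.Hom.F u ≫ 𝟙 X) = tens (ten adj hK M hu)
      (fst M.C.C M.C.C ≫ MndOp.Hom.F u) (snd M.C.C M.C.C ≫ MndOp.Hom.F u) :=
    congrArg (fun k => tens (ten adj hK M hu) (fst M.C.C M.C.C ≫ k) (snd M.C.C M.C.C ≫ k)) c
  have p : tens (ten adj hK M hu) (fst M.C.C M.C.C ≫ MndOp.Hom.F u ≫ 𝟙 X)
      (snd M.C.C M.C.C ≫ MndOp.Hom.F u ≫ 𝟙 X) = M.C.ten ≫ MndOp.Hom.F u ≫ 𝟙 X :=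
    d.trans (t.trans (congrArg (fun k => M.C.ten ≫ k) c.symm))
  have j1 : LaxData.φ (LaxData.comp (arrow adj hK M hu).toLaxData (LaxData.id _)) = eqToHom p :=
    eq_of_heq (i1.trans (eqToHom_heq t p d.symm))
  have j2 : LaxData.φ (LaxData.comp M.S.toLaxData (arrow adj hK M hu).toLaxData) ≍ σ :=
    i2.trans ((id_comp_heq t' _ rfl).trans hσ.symm)
  have d' : tens (ten adj hK M hu) (fst M.C.C M.C.C ≫ M.S.F ≫ MndOp.Hom.F u)
      (snd M.C.C M.C.C ≫ M.S.F ≫ MndOp.Hom.F u) = _ :=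
    (congrArg₂ (tens (ten adj hK M hu)) (Strict.assoc _ _ _).symm (Strict.assoc _ _ _).symm).trans
      (t'.trans (Strict.assoc _ _ _))
  apply eq_of_heq
  refine (comp_id_heq p _ j1).trans ((h1.trans (h2.trans h3)).trans ?_)
  exact comp_heq d'.symm (Strict.assoc _ _ _) rfl j2.symm hσ'

/-- The structure `2`-cell of `u` is compatible with units: an oplax morphism from an identity monad
has no structure beyond its `1`-cell. -/
theorem arrowτ_unit :
      LaxData.φ₀ (LaxData.comp M.S.toLaxData (arrow adj hK M hu).toLaxData) ≫
        M.C.unit ◁ MndOp.Hom.τ u =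
      LaxData.φ₀ (LaxData.comp (arrow adj hK M hu).toLaxData (LaxData.id _)) := by
  have h := hom_from_idMonad_ext (A := one) (N := (iota D).obj X) (f := MndOp.unitHom M ≫ u)
    (g := (iota D).map (M.C.unit ≫ MndOp.Hom.F u)) rfl
  have h2 := MndOp.τ_heq_of_eq h
  have e1 : 𝟙 one ≫ M.C.unit ≫ MndOp.Hom.F u = M.C.unit ≫ MndOp.Hom.F u := Strict.id_comp _
  have e2 : 𝟙 one ≫ M.C.unit = M.C.unit := Strict.id_comp _
  have e3 : M.C.unit ≫ MndOp.Hom.F u ≫ 𝟙 X = M.C.unit ≫ MndOp.Hom.F u :=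
    congrArg (fun k => M.C.unit ≫ k) (Strict.comp_id _)
  obtain ⟨σ, hσ⟩ := exists_heq e1.symm rfl (M.S.φ₀ ▷ MndOp.Hom.F u)
  obtain ⟨σ', hσ'⟩ := exists_heq (Strict.assoc M.C.unit M.S.F (MndOp.Hom.F u)).symm rfl
    (M.C.unit ◁ MndOp.Hom.τ u)
  have h3 := MndOp.Hom.heq_comp_τ (MndOp.unitHom M) u (Strict.assoc _ _ _)
    (hσ.trans (whiskerRight_heq e2.symm rfl rfl (MndOp.unitHom_τ M).symm)) hσ'
  obtain ⟨h4, h5⟩ := MndOp.isStrictHom_iota_map (M.C.unit ≫ MndOp.Hom.F u)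
  have i1 : LaxData.φ₀ (LaxData.comp (arrow adj hK M hu).toLaxData (LaxData.id _)) ≍
      eqToHom (rfl : M.C.unit ≫ MndOp.Hom.F u = _) := φ₀_heq_of_eq (Hom.comp_id (arrow adj hK M hu))
  have i2 : LaxData.φ₀ (LaxData.comp M.S.toLaxData (arrow adj hK M hu).toLaxData) ≍
    𝟙 (M.C.unit ≫ MndOp.Hom.F u) ≫ M.S.φ₀ ▷ MndOp.Hom.F u := LaxData.comp_φ₀_heq _ _
  rw [Category.id_comp] at i2
  apply eq_of_heq
  refine (comp_heq e1.symm (Strict.assoc _ _ _).symm rfl (i2.trans hσ.symm) hσ'.symm).trans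
    ((h3.symm.trans (h2.trans ((heq_of_eq h5).trans ?_))).trans i1.symm)
  exact eqToHom_heq h4 _ e1

/-- The universal arrow of the underlying monad as an oplax morphism of monoidal monads. -/
noncomputable def arrowHom : MndOp.Hom M (idMonad (kleisliMonoidal adj hK M hu)) where
  F := arrow adj hK M hu
  τ := MonoidalObject.Hom₂.mk (MndOp.Hom.τ u) (arrowτ_tensor adj hK M hu)
    (arrowτ_unit adj hK M hu)
  τ_η := by
    have h := MndOp.Hom.τ_η u
    rw [MndOp.und_η] at h
    refine MonoidalObject.Hom₂.ext ?_
    have h1 := leftUnitor_inv_σ (arrow adj hK M hu)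
    have h2 := rightUnitor_inv_σ (arrow adj hK M hu)
    exact (congrArg (fun t => t ≫ MonoidalObject.Hom₂.σ M.η ▷ MndOp.Hom.F u ≫ MndOp.Hom.τ u)
      h1).trans (h.trans (congrArg (fun t => t ≫ MndOp.Hom.F u ◁ 𝟙 (𝟙 X)) h2).symm)
  τ_μ := by
    have h := MndOp.Hom.τ_μ u
    rw [MndOp.und_μ] at h
    refine MonoidalObject.Hom₂.ext ?_
    -- The coherence `2`-cells of monoidal objects lie over those of `D`.
    have gen : ∀ {a b : D} {f₀ f₁ f₂ f₃ f₄ f₅ f₆ : a ⟶ b} {p p' : f₀ ⟶ f₁} {q : f₁ ⟶ f₂}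
        {r r' : f₂ ⟶ f₃} {s : f₃ ⟶ f₄} {t t' : f₄ ⟶ f₅} {k k' : f₅ ⟶ f₆} (_ : p' = p) (_ : r' = r)
        (_ : t' = t) (_ : k' = k), p ≫ q ≫ r ≫ s ≫ t ≫ k = p' ≫ q ≫ r' ≫ s ≫ t' ≫ k' := by
      rintro _ _ _ _ _ _ _ _ _ _ _ _ _ _ _ _ _ _ _ rfl rfl rfl rfl
      rfl
    refine h.trans (gen (associator_σ M.S M.S (arrow adj hK M hu))
      (associator_inv_σ M.S (arrow adj hK M hu) (𝟙 _))
      (associator_σ (arrow adj hK M hu) (Hom.id _) (Hom.id _)) ?_)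
    exact congrArg (fun t => MndOp.Hom.F u ◁ t) (leftUnitor_hom_σ (Hom.id _))

end KleisliMonoidal

end MonoidalArrow

/-! ### Universality among monoidal objects -/

section Universality

variable {D : Type u} [Bicategory.{w, v} D] [Strict D] [FiniteProducts D]
  {K : StrictPseudofunctor (MndOp D) D} (adj : TwoAdjunction K (iota D))
  (hK : PreservesFiniteProducts K) (M : MndOp (MonoidalObject D)) {X : D}
  {u : MndOp.und M ⟶ (iota D).obj X} (hu : IsUniversalArrow (iota D) u)

/-- A monoidal `2`-cell `s : S ≫ g ⟹ g`, read as the statement that the lax structure of `g` is a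
`2`-cell of monads. -/
theorem MonoidalObject.Hom₂.tensor_heq {C Y : MonoidalObject D} {S : Hom C C} {g : Hom C Y}
    (s : Hom₂ (S.comp g) (g.comp (Hom.id Y)))
    {τ : lift (fst C.C C.C ≫ S.F) (snd C.C C.C ≫ S.F) ≫ tens Y.ten (fst C.C C.C ≫ g.F)
      (snd C.C C.C ≫ g.F) ⟶ tens Y.ten (fst C.C C.C ≫ g.F) (snd C.C C.C ≫ g.F) ≫ 𝟙 Y.C}
    {σ : lift (fst C.C C.C ≫ S.F) (snd C.C C.C ≫ S.F) ≫ C.ten ≫ g.F ⟶ C.ten ≫ S.F ≫ g.F}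
    {σ' : C.ten ≫ S.F ≫ g.F ⟶ (C.ten ≫ g.F) ≫ 𝟙 Y.C}
    (hτ : τ ≍ tens₂ Y.ten (fst C.C C.C ◁ s.σ) (snd C.C C.C ◁ s.σ))
    (hσ : σ ≍ S.φ ▷ g.F) (hσ' : σ' ≍ C.ten ◁ s.σ) :
    lift (fst C.C C.C ≫ S.F) (snd C.C C.C ≫ S.F) ◁ g.φ ≫ σ ≫ σ' ≍ τ ≫ g.φ ▷ 𝟙 Y.C := by
  have ct := s.tensor
  have c1 : (g.comp (Hom.id Y)).φ ≍ g.φ := φ_heq_of_eq (Hom.comp_id g)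
  have c2 : (S.comp g).φ ≍ _ := LaxData.comp_φ_heq S.toLaxData g.toLaxData
  have c3 := g.phiAt_heq (fst C.C C.C ≫ S.F) (snd C.C C.C ≫ S.F)
  have c4 := whiskerRight_id_heq g.φ
  have e1 : (g.comp (Hom.id Y)).F = g.F := Strict.comp_id _
  have e2 : (S.comp g).F = S.F ≫ g.F := rfl
  have e3 := g.phiAt_dom (fst C.C C.C ≫ S.F) (snd C.C C.C ≫ S.F)
  have e4 : lift (fst C.C C.C ≫ S.F) (snd C.C C.C ≫ S.F) ≫ C.ten =
    tens C.ten (fst C.C C.C ≫ S.F) (snd C.C C.C ≫ S.F) := rfl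
  grind [Strict.comp_id, Strict.assoc]

/-- Compatibility with tensor products can be tested along a cofaithful `1`-cell. -/
theorem MonoidalObject.tensor_of_cofaithful {A A' N : MonoidalObject D}
    {G : prod A.C A.C ⟶ prod A'.C A'.C} {F : A.C ⟶ A'.C} (hG : Cofaithful G)
    (ht : G ≫ A'.ten = A.ten ≫ F) (h₁ : G ≫ fst A'.C A'.C = fst A.C A.C ≫ F)
    (h₂ : G ≫ snd A'.C A'.C = snd A.C A.C ≫ F) {h k : LaxData A' N}
    {φ : tens N.ten (fst A.C A.C ≫ F ≫ h.F) (snd A.C A.C ≫ F ≫ h.F) ⟶ A.ten ≫ F ≫ h.F}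
    {φ' : tens N.ten (fst A.C A.C ≫ F ≫ k.F) (snd A.C A.C ≫ F ≫ k.F) ⟶ A.ten ≫ F ≫ k.F}
    (hφ : φ ≍ G ◁ h.φ) (hφ' : φ' ≍ G ◁ k.φ) {ψ : h.F ⟶ k.F} {s : F ≫ h.F ⟶ F ≫ k.F}
    (hs : F ◁ ψ = s)
    (H : tens₂ N.ten (fst A.C A.C ◁ s) (snd A.C A.C ◁ s) ≫ φ' = φ ≫ A.ten ◁ s) :
    tens₂ N.ten (fst A'.C A'.C ◁ ψ) (snd A'.C A'.C ◁ ψ) ≫ k.φ = h.φ ≫ A'.ten ◁ ψ := by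
  subst hs
  apply hG
  have w1 := whiskerLeft_tens₂ N.ten G (fst A'.C A'.C ◁ ψ) (snd A'.C A'.C ◁ ψ)
  have ct := fun x y : prod A'.C A'.C ⟶ N.C => comp_tens N.ten G x y
  have w2 := comp_whiskerLeft_heq G (fst A'.C A'.C) ψ
  have w3 := comp_whiskerLeft_heq G (snd A'.C A'.C) ψ
  have w4 := comp_whiskerLeft_heq G A'.ten ψ
  have w5 := comp_whiskerLeft_heq (fst A.C A.C) F ψ
  have w6 := comp_whiskerLeft_heq (snd A.C A.C) F ψ
  have w7 := comp_whiskerLeft_heq A.ten F ψ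
  simp only [whiskerLeft_comp]
  grind [Strict.assoc]

namespace KleisliMonoidal

/-- The arrow into the Kleisli object, as an arrow to the embedding `2`-functor. -/
noncomputable abbrev arrowTo : M ⟶ (iota (MonoidalObject D)).obj (kleisliMonoidal adj hK M hu) :=
  arrowHom adj hK M hu

theorem mapToIota_arrowTo : mapToIota (forget D) (arrowTo adj hK M hu) = u :=
  MndOp.hom_ext (mapToIota_F _) (mapToIota_τ _)

/-- The underlying oplax morphism of one whose target is the image of a monoidal object. -/
noncomputable abbrev under {M : MndOp (MonoidalObject D)} {Y : MonoidalObject D}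
    (g : M ⟶ (iota (MonoidalObject D)).obj Y) : MndOp.und M ⟶ (iota D).obj Y.C :=
  mapToIota (forget D) g

theorem under_F {M : MndOp (MonoidalObject D)} {Y : MonoidalObject D}
    (g : M ⟶ (iota (MonoidalObject D)).obj Y) :
    MndOp.Hom.F (under g) = LaxData.F (Hom.toLaxData (MndOp.Hom.F g)) :=
  mapToIota_F _

theorem under_τ {M : MndOp (MonoidalObject D)} {Y : MonoidalObject D}
    (g : M ⟶ (iota (MonoidalObject D)).obj Y) :
    MndOp.Hom.τ (under g) ≍ MonoidalObject.Hom₂.σ (MndOp.Hom.τ g) :=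
  mapToIota_τ _

section Lift

variable {Y : MonoidalObject D} (g : M ⟶ (iota (MonoidalObject D)).obj Y) {h : X ⟶ Y.C}
  (hh : u ≫ (iota D).map h = under g)

include hh in
theorem F_comp_eq : MndOp.Hom.F u ≫ h = LaxData.F (Hom.toLaxData (MndOp.Hom.F g)) :=
  (congrArg MndOp.Hom.F hh).trans (under_F g)

include hh in
theorem iotaProd_F_comp : MndOp.Hom.F (iotaProd adj u u) ≫ tens Y.ten (fst X X ≫ h) (snd X X ≫ h) =
    tens Y.ten (fst M.C.C M.C.C ≫ LaxData.F (Hom.toLaxData (MndOp.Hom.F g)))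
      (snd M.C.C M.C.C ≫ LaxData.F (Hom.toLaxData (MndOp.Hom.F g))) := by
  have e := F_comp_eq M g hh
  have e1 := congrArg MndOp.Hom.F (iotaProd_fst adj u u)
  have e2 := congrArg MndOp.Hom.F (iotaProd_snd adj u u)
  refine (comp_tens _ _ _ _).trans (congrArg₂ (tens Y.ten) ?_ ?_)
  · exact (Strict.assoc _ _ _).symm.trans ((congrArg (fun k => k ≫ h) e1).trans
      ((Strict.assoc _ _ _).trans (congrArg (fun k => fst M.C.C M.C.C ≫ k) e)))
  · exact (Strict.assoc _ _ _).symm.trans ((congrArg (fun k => k ≫ h) e2).trans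
      ((Strict.assoc _ _ _).trans (congrArg (fun k => snd M.C.C M.C.C ≫ k) e)))

include hh in
theorem iotaProd_F_comp_ten : MndOp.Hom.F (iotaProd adj u u) ≫ ten adj hK M hu ≫ h =
    M.C.ten ≫ LaxData.F (Hom.toLaxData (MndOp.Hom.F g)) :=
  (Strict.assoc _ _ _).symm.trans
    ((congrArg (fun k => k ≫ h) (congrArg MndOp.Hom.F (ten_spec adj hK M hu))).trans
      ((Strict.assoc _ _ _).trans (congrArg (fun k => M.C.ten ≫ k) (F_comp_eq M g hh))))

include hh in
/-- The lax structure of `g` descends along `u × u`: by `Hom₂.tensor_heq` it is a `2`-cell of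
monads, from `⊗ ∘ (g × g)` to `g ∘ ⊗`. -/
theorem exists_φ : ∃ φ : tens Y.ten (fst X X ≫ h) (snd X X ≫ h) ⟶ ten adj hK M hu ≫ h,
    MndOp.Hom.F (iotaProd adj u u) ◁ φ ≍ LaxData.φ (Hom.toLaxData (MndOp.Hom.F g)) := by
  have hv := isUniversalArrow_iotaProd adj hK hu hu
  have e := F_comp_eq M g hh
  have a1 := iotaProd_comp_tens_τ adj u u Y.ten hh hh
  have a2 : iotaProd adj u u ≫ (iota D).map (ten adj hK M hu ≫ h) =
      MndOp.tensHom M ≫ under g := by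
    rw [(iota D).map_comp, ← Strict.assoc, ten_spec, ← hh, Strict.assoc]
  obtain ⟨τ, hτ⟩ := exists_heq (congrArg (fun k => MndOp.prodS (MndOp.und M) (MndOp.und M) ≫ k)
    (iotaProd_F_comp adj M g hh)) (congrArg (fun k => k ≫ 𝟙 Y.C) (iotaProd_F_comp adj M g hh))
    (MndOp.Hom.τ (iotaProd adj u u ≫ (iota D).map (tens Y.ten (fst X X ≫ h) (snd X X ≫ h))))
  obtain ⟨σ, hσ⟩ := exists_heq (Strict.assoc _ _ _) (Strict.assoc _ _ _)
    (M.S.φ ▷ LaxData.F (Hom.toLaxData (MndOp.Hom.F g)))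
  obtain ⟨σ', hσ'⟩ := exists_heq rfl ((congrArg (fun k => M.C.ten ≫ k) (Strict.comp_id _)).trans
    (Strict.comp_id (M.C.ten ≫ LaxData.F (Hom.toLaxData (MndOp.Hom.F g)))).symm)
    (M.C.ten ◁ MonoidalObject.Hom₂.σ (MndOp.Hom.τ g))
  have d₀ := congrArg (fun k => M.S.F ≫ k) (under_F g)
  have d₁ := congrArg (fun k => k ≫ 𝟙 Y.C) (under_F g)
  obtain ⟨σ₁, hσ₁⟩ := exists_heq (Strict.assoc (MndOp.prodS (MndOp.und M) (MndOp.und M)) M.C.ten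
    (MndOp.Hom.F (under g))) rfl (M.S.φ ▷ MndOp.Hom.F (under g))
  obtain ⟨σ₁', hσ₁'⟩ := exists_heq (Strict.assoc M.C.ten M.S.F (MndOp.Hom.F (under g))).symm rfl
    (M.C.ten ◁ MndOp.Hom.τ (under g))
  obtain ⟨s, hs⟩ := MndOp.exists_hom₂_of_heq
    (f := iotaProd adj u u ≫ (iota D).map (tens Y.ten (fst X X ≫ h) (snd X X ≫ h)))
    (g := MndOp.tensHom M ≫ under g) (iotaProd_F_comp adj M g hh)
    (congrArg (fun k => M.C.ten ≫ k) (under_F g)) (LaxData.φ (Hom.toLaxData (MndOp.Hom.F g)))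
    (τ := τ) (τ' := σ ≫ σ') hτ.symm ((MndOp.Hom.heq_comp_τ (MndOp.tensHom M) (under g)
      (Strict.assoc M.C.ten M.S.F (MndOp.Hom.F (under g))) hσ₁ hσ₁').trans
        (comp_heq (congrArg (fun k => MndOp.prodS (MndOp.und M) (MndOp.und M) ≫ M.C.ten ≫ k)
          (under_F g)) ((Strict.assoc _ _ _).trans (congrArg (fun k => M.C.ten ≫ k) d₀))
          ((congrArg (fun k => M.C.ten ≫ k) d₁).trans (Strict.assoc _ _ _).symm) (hσ₁.trans
            ((whiskerRight_heq rfl rfl (under_F g) HEq.rfl).trans hσ.symm)) (hσ₁'.trans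
            ((whiskerLeft_heq rfl d₀ d₁ (under_τ g)).trans hσ'.symm))))
    (MonoidalObject.Hom₂.tensor_heq (MndOp.Hom.τ g) (hτ.trans (a1.trans (tens₂_heq _
      (congrArg _ d₀) (congrArg _ d₀) (congrArg _ d₁) (congrArg _ d₁)
      (whiskerLeft_heq rfl d₀ d₁ (under_τ g)) (whiskerLeft_heq rfl d₀ d₁ (under_τ g)))))
      hσ hσ')
  obtain ⟨φ, hφ⟩ := hv.exists_map₂_heq rfl a2 s
  refine ⟨φ, HEq.trans ?_ hs⟩
  exact MndOp.σ_heq rfl a2 hφ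

/-- The lax monoidal structure on the `1`-cell `h` induced by `g`, before its axioms. -/
noncomputable def liftData : LaxData (kleisliMonoidal adj hK M hu) Y where
  F := h
  φ := (exists_φ adj hK M hu g hh).choose
  φ₀ := LaxData.φ₀ (Hom.toLaxData (MndOp.Hom.F g)) ≫
    eqToHom ((congrArg (fun k => M.C.unit ≫ k) (F_comp_eq M g hh)).symm.trans
      (Strict.assoc _ _ _).symm)

theorem liftData_phi₀At (Z : D) : (liftData adj hK M hu g hh).phi₀At Z ≍
    LaxData.phi₀At (Hom.toLaxData (MndOp.Hom.F g)) Z := by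
  have e : M.C.unit ≫ LaxData.F (Hom.toLaxData (MndOp.Hom.F g)) =
      (M.C.unit ≫ MndOp.Hom.F u) ≫ h :=
    (congrArg (fun k => M.C.unit ≫ k) (F_comp_eq M g hh)).symm.trans (Strict.assoc _ _ _).symm
  refine (LaxData.phi₀At_heq _ _).trans (HEq.trans ?_ (LaxData.phi₀At_heq _ _).symm)
  exact whiskerLeft_heq rfl rfl e.symm (comp_id_heq e _ rfl)

theorem liftData_phiAt {Z : D} (a b : Z ⟶ M.C.C) :
    (liftData adj hK M hu g hh).phiAt (a ≫ MndOp.Hom.F u) (b ≫ MndOp.Hom.F u) ≍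
      LaxData.phiAt (Hom.toLaxData (MndOp.Hom.F g)) a b := by
  have hφ := (exists_φ adj hK M hu g hh).choose_spec
  refine (LaxData.phiAt_heq _ _ _).trans (HEq.trans ?_ (LaxData.phiAt_heq _ _ _).symm)
  refine (whiskerLeft_heq (lift_comp_iotaProd_F adj u u a b).symm rfl rfl HEq.rfl).trans
    ((comp_whiskerLeft_heq _ _ _).trans ?_)
  exact whiskerLeft_heq rfl (iotaProd_F_comp adj M g hh) (iotaProd_F_comp_ten adj hK M hu g hh) hφ

/-- The lax monoidal `1`-cell induced by `g` on the Kleisli object. The axioms are tested along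
products of copies of `u`, where they are the axioms of `g`. -/
noncomputable def liftHom : MonoidalObject.Hom (kleisliMonoidal adj hK M hu) Y where
  toLaxData := liftData adj hK M hu g hh
  assoc := LaxData.assocAt_of_cofaithful (A := kleisliMonoidal adj hK M hu)
    (isUniversalArrow_iotaProd adj hK hu (isUniversalArrow_iotaProd adj hK hu hu)).cofaithful
    (congrArg MndOp.Hom.F (iotaProd_fst adj _ _))
    (congrArg MndOp.Hom.F (iotaProd_snd_fst adj _ _ _))
    (congrArg MndOp.Hom.F (iotaProd_snd_snd adj _ _ _))
    (IsStrictMonoidal.laxAssocAt (A := M.C) (A' := kleisliMonoidal adj hK M hu)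
      (isStrictMonoidal adj hK M hu) (F_comp_eq M g hh) (liftData_phiAt adj hK M hu g hh)
      (Hom.assoc (MndOp.Hom.F g)))
  right := LaxData.rightAt_of_cofaithful (A := kleisliMonoidal adj hK M hu) hu.cofaithful
    ((Strict.comp_id _).trans (Strict.id_comp _).symm)
    (IsStrictMonoidal.laxRightAt (A := M.C) (A' := kleisliMonoidal adj hK M hu)
      (isStrictMonoidal adj hK M hu) (F_comp_eq M g hh) (liftData_phiAt adj hK M hu g hh)
      (liftData_phi₀At adj hK M hu g hh) (Hom.right (MndOp.Hom.F g)))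
  left := LaxData.leftAt_of_cofaithful (A := kleisliMonoidal adj hK M hu) hu.cofaithful
    ((Strict.comp_id _).trans (Strict.id_comp _).symm)
    (IsStrictMonoidal.laxLeftAt (A := M.C) (A' := kleisliMonoidal adj hK M hu)
      (isStrictMonoidal adj hK M hu) (F_comp_eq M g hh) (liftData_phiAt adj hK M hu g hh)
      (liftData_phi₀At adj hK M hu g hh) (Hom.left (MndOp.Hom.F g)))

end Lift

theorem under_arrowTo_comp {Y : MonoidalObject D} (k : kleisliMonoidal adj hK M hu ⟶ Y) :
    under (arrowTo adj hK M hu ≫ (iota (MonoidalObject D)).map k) =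
      u ≫ (iota D).map ((forget D).map k) :=
  (mapToIota_comp_iota _ _).trans (congrArg (fun z : MndOp.und M ⟶ (iota D).obj X =>
    z ≫ (iota D).map ((forget D).map k)) (mapToIota_arrowTo adj hK M hu))

section Comparison

variable {Y : MonoidalObject D}

theorem arrow_comp_φ (k : MonoidalObject.Hom (kleisliMonoidal adj hK M hu) Y) :
    LaxData.φ (LaxData.comp (arrow adj hK M hu).toLaxData k.toLaxData) ≍
      MndOp.Hom.F (iotaProd adj u u) ◁ k.φ := by
  refine (LaxData.comp_φ_heq _ _).trans ?_
  have p := (isStrictMonoidal adj hK M hu).ten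
  refine (comp_id_heq (congrArg (fun t => t ≫ k.F) p) _ (eqToHom_whiskerRight p k.F)).trans ?_
  exact (LaxData.phiAt_heq _ _ _).trans (whiskerLeft_heq (iotaProd_F adj u u).symm rfl rfl HEq.rfl)

theorem arrow_comp_φ₀ (k : MonoidalObject.Hom (kleisliMonoidal adj hK M hu) Y) :
    LaxData.φ₀ (LaxData.comp (arrow adj hK M hu).toLaxData k.toLaxData) ≍ k.φ₀ := by
  refine (LaxData.comp_φ₀_heq _ _).trans ?_
  refine comp_id_heq rfl k.φ₀ ?_
  exact id_whiskerRight _ _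

/-- The lax monoidal `1`-cell `liftHom` factors `g` through the Kleisli object. -/
theorem arrowTo_comp_iota {g : M ⟶ (iota (MonoidalObject D)).obj Y} {h : X ⟶ Y.C}
    (hh : u ≫ (iota D).map h = under g) : arrowTo adj hK M hu ≫
      (iota (MonoidalObject D)).map (liftHom adj hK M hu g hh) = g := by
  have e1 : Hom.comp (arrow adj hK M hu) (liftHom adj hK M hu g hh) = MndOp.Hom.F g := by
    refine MonoidalObject.hom_ext (F_comp_eq M g hh) ?_ ?_
    · exact (arrow_comp_φ _ _ _ _ _).trans (exists_φ adj hK M hu g hh).choose_spec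
    · refine (arrow_comp_φ₀ _ _ _ _ _).trans (comp_id_heq _ _ rfl)
  refine MndOp.hom_ext e1 (MonoidalObject.hom₂_heq (congrArg (fun k => M.S ≫ k) e1)
    (congrArg (fun k => k ≫ 𝟙 Y) e1) ?_)
  exact (under_τ _).symm.trans ((MndOp.τ_heq_of_eq ((under_arrowTo_comp adj hK M hu
    (liftHom adj hK M hu g hh)).trans hh)).trans (under_τ g))

end Comparison

/-- The arrow from a monoidal monad to its Kleisli object is universal in `Mnd_op(Mon(D))`. -/
theorem isUniversalArrow_arrowTo :
    IsUniversalArrow (iota (MonoidalObject D)) (arrowTo adj hK M hu) where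
  lift_unique {Y} g := by
    obtain ⟨h, hh, -⟩ := hu.lift_unique (under g)
    refine ⟨liftHom adj hK M hu g hh, arrowTo_comp_iota adj hK M hu hh, ?_⟩
    intro k hk
    have e : LaxData.F (Hom.toLaxData k) = h :=
      hu.hom_ext (((under_arrowTo_comp adj hK M hu k).symm.trans (congrArg under hk)).trans hh.symm)
    have hk' : Hom.comp (arrow adj hK M hu) k = MndOp.Hom.F g := congrArg MndOp.Hom.F hk
    have hg := congrArg MndOp.Hom.F (arrowTo_comp_iota adj hK M hu hh)
    refine MonoidalObject.hom_ext e ?_ ?_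
    · refine Cofaithful.heq (isUniversalArrow_iotaProd adj hK hu hu).cofaithful
        (congrArg (fun t => tens Y.ten (fst X X ≫ t) (snd X X ≫ t)) e)
        (congrArg (fun t => ten adj hK M hu ≫ t) e) ?_
      exact (arrow_comp_φ adj hK M hu k).symm.trans ((φ_heq_of_eq hk').trans
        (exists_φ adj hK M hu g hh).choose_spec.symm)
    · exact (arrow_comp_φ₀ adj hK M hu k).symm.trans ((φ₀_heq_of_eq (hk'.trans hg.symm)).trans
        (arrow_comp_φ₀ adj hK M hu _))
  lift₂_unique {Y h k} θ := by
    have eh := under_arrowTo_comp adj hK M hu h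
    have ek := under_arrowTo_comp adj hK M hu k
    obtain ⟨ψ, hψ⟩ := hu.exists_map₂_heq eh.symm ek.symm (mapToIota₂ (G := forget D) θ)
    have hψ' : MndOp.Hom.F u ◁ ψ = MonoidalObject.Hom₂.σ (MndOp.Hom₂.σ θ) :=
      eq_of_heq ((MndOp.σ_heq eh.symm ek.symm hψ).trans (mapToIota₂_σ θ))
    have ct := MonoidalObject.Hom₂.tensor (MndOp.Hom₂.σ θ)
    have cu := MonoidalObject.Hom₂.unit (MndOp.Hom₂.σ θ)
    refine ⟨MonoidalObject.Hom₂.mk ψ ?_ ?_, ?_, ?_⟩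
    · exact tensor_of_cofaithful (A := M.C) (A' := kleisliMonoidal adj hK M hu)
        (isUniversalArrow_iotaProd adj hK hu hu).cofaithful
        (congrArg MndOp.Hom.F (ten_spec adj hK M hu))
        (congrArg MndOp.Hom.F (iotaProd_fst adj _ _)) (congrArg MndOp.Hom.F (iotaProd_snd adj _ _))
        (arrow_comp_φ adj hK M hu h) (arrow_comp_φ adj hK M hu k) hψ' ct
    · have c := comp_whiskerLeft_heq M.C.unit (MndOp.Hom.F u) ψ
      have dh := arrow_comp_φ₀ adj hK M hu h
      have dk := arrow_comp_φ₀ adj hK M hu k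
      rw [← hψ'] at cu
      refine eq_of_heq (HEq.trans ?_ ((heq_of_eq cu).trans dk))
      exact comp_heq rfl (Strict.assoc _ _ _) (Strict.assoc _ _ _) dh.symm c
    · exact MndOp.hom₂_ext (MonoidalObject.Hom₂.ext hψ')
    · rintro ψ' rfl
      refine MonoidalObject.Hom₂.ext (hu.cofaithful ?_)
      exact hψ'.symm

end KleisliMonoidal

end Universality

/-! ### The comparison of Kleisli objects -/

section StandardKleisliObjects

variable {B : Type u₁} [Bicategory.{w₁, v₁} B] {C : Type u₂} [Bicategory.{w₂, v₂} C] [Strict C]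

/-- A `2`-natural transformation with invertible components is a `2`-natural isomorphism. -/
def TwoNatTrans.toTwoNatIso {F G : StrictPseudofunctor B C} (t : TwoNatTrans F G)
    (s : ∀ a : B, G.obj a ⟶ F.obj a) (h : ∀ a, t.app a ≫ s a = 𝟙 (F.obj a))
    (h' : ∀ a, s a ≫ t.app a = 𝟙 (G.obj a)) : TwoNatIso F G where
  hom := t
  inv :=
    have nat : ∀ {a b : B} (f : a ⟶ b), G.map f ≫ s b = s a ≫ F.map f := fun {a b} f => by
      rw [← Strict.id_comp (G.map f), ← h' a, Strict.assoc (s a), ← t.naturality f, Strict.assoc,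
        Strict.assoc, h, Strict.comp_id]
    { app := s
      naturality := nat
      naturality₂ := fun {a b f g} θ => naturality₂_of_heq _ _ (by
        have e1 := nat f
        have e2 := nat g
        have e3 := t.naturality f
        have e4 := t.naturality g
        have e5 := h' a
        have e6 := h b
        have n := t.naturality₂_heq θ
        have w1 := id_whiskerLeft_heq (G.map₂ θ)
        have w2 := whiskerRight_id_heq (F.map₂ θ)
        have w3 := comp_whiskerLeft_heq (s a) (t.app a) (G.map₂ θ)
        have w4 := whiskerRight_comp_heq (F.map₂ θ) (t.app b) (s b)
        have w5 := whisker_assoc_heq (s a) (F.map₂ θ ▷ t.app b) (s b)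
        grind [Strict.assoc, Strict.comp_id, Strict.id_comp]) }
  hom_inv := h
  inv_hom := h'

variable [Strict B]

/-- Composition with the unit recovers an arrow from its transpose. -/
theorem TwoAdjunction.unitAt_comp_transpose {L : StrictPseudofunctor B C}
    {R : StrictPseudofunctor C B} (adj : TwoAdjunction L R) {b : B} {d : C} (f : b ⟶ R.obj d) :
    adj.unitAt b ≫ R.map (L.map f ≫ adj.counit.app d) = f := by
  -- The source of `adj.counit.app d` is `L (R d)` only by unfolding, so the counit is first
  -- replaced by a variable of the intended type.
  have key : ∀ e : ∀ c : C, L.obj (R.obj c) ⟶ c,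
      (∀ c : C, adj.unitAt (R.obj c) ≫ R.map (e c) = 𝟙 (R.obj c)) →
        adj.unitAt b ≫ R.map (L.map f ≫ e d) = f := fun e tr => by
    rw [R.map_comp, ← Strict.assoc, ← adj.unit_naturality, Strict.assoc, tr, Strict.comp_id]
  exact key adj.counit.app adj.right_triangle

variable {G : StrictPseudofunctor B C} {KB : StrictPseudofunctor (MndOp B) B}
  (adjB : TwoAdjunction KB (iota B)) {KC : StrictPseudofunctor (MndOp C) C}
  (adjC : TwoAdjunction KC (iota C))

/-- The comparison is the `1`-cell through which the image of the unit of `B` factors over the unit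
of `C`. -/
theorem unitAt_comp_kleisliComparison (M : MndOp B) :
    adjC.unitAt ((mapMndOp G).obj M) ≫ (iota C).map (kleisliComparison G adjB adjC M) =
      mapToIota G (adjB.unitAt M) := by
  exact adjC.unitAt_comp_transpose (b := (mapMndOp G).obj M) (mapToIota G (adjB.unitAt M))

theorem kleisliComparison_naturality {M N : MndOp B} (f : M ⟶ N) :
    KC.map ((mapMndOp G).map f) ≫ kleisliComparison G adjB adjC N =
      kleisliComparison G adjB adjC M ≫ G.map (KB.map f) := by
  refine (adjC.isUniversalArrow_unit _).hom_ext ?_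
  rw [(iota C).map_comp, ← Strict.assoc, ← adjC.unit_naturality, Strict.assoc,
    unitAt_comp_kleisliComparison, ← mapToIota_comp, adjB.unit_naturality, mapToIota_comp_iota,
    (iota C).map_comp, ← Strict.assoc, unitAt_comp_kleisliComparison]
  rfl

theorem kleisliComparison_naturality₂ {M N : MndOp B} {f g : M ⟶ N} (θ : f ⟶ g) :
    KC.map₂ ((mapMndOp G).map₂ θ) ▷ kleisliComparison G adjB adjC N ≍
      kleisliComparison G adjB adjC M ◁ G.map₂ (KB.map₂ θ) := by
  refine Cofaithful.heq (adjC.isUniversalArrow_unit ((mapMndOp G).obj M)).cofaithful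
    (kleisliComparison_naturality adjB adjC f) (kleisliComparison_naturality adjB adjC g) ?_
  have n := MndOp.σ_heq (adjC.unit_naturality _) (adjC.unit_naturality _)
    (adjC.unit_naturality₂ ((mapMndOp G).map₂ θ))
  have nB := map₂_heq G (congrArg MndOp.Hom.F (adjB.unit_naturality f))
    (congrArg MndOp.Hom.F (adjB.unit_naturality g))
    (MndOp.σ_heq (adjB.unit_naturality _) (adjB.unit_naturality _) (adjB.unit_naturality₂ θ))
  have k : ∀ P : MndOp B, MndOp.Hom.F (adjC.unitAt ((mapMndOp G).obj P)) ≫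
      kleisliComparison G adjB adjC P = G.map (MndOp.Hom.F (adjB.unitAt P)) := fun P =>
    (congrArg MndOp.Hom.F (unitAt_comp_kleisliComparison adjB adjC P)).trans (mapToIota_F _)
  have d := fun {x : M ⟶ N} => (congrArg MndOp.Hom.F
    (adjC.unit_naturality ((mapMndOp G).map x))).symm
  refine (whisker_assoc_heq _ _ _).symm.trans ((whiskerRight_heq d d rfl n.symm).trans ?_)
  refine (whiskerRight_comp_heq _ _ _).symm.trans
    ((whiskerRight_heq rfl rfl (k N) HEq.rfl).trans ?_)
  refine (map₂_whiskerRight_heq G _ _).symm.trans (nB.trans ((map₂_whiskerLeft_heq G _ _).trans ?_))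
  exact (whiskerLeft_heq (k M).symm rfl rfl HEq.rfl).trans (comp_whiskerLeft_heq _ _ _)

/-- Kleisli objects are standard with respect to a `2`-functor that preserves the universal
arrows. -/
theorem standardKleisli_of_universal
    (hG : ∀ M : MndOp B, IsUniversalArrow (iota C) (mapToIota G (adjB.unitAt M))) :
    StandardKleisli G adjB adjC := by
  have key : ∀ M : MndOp B, ∃ k : G.obj (KB.obj M) ⟶ KC.obj ((mapMndOp G).obj M),
      kleisliComparison G adjB adjC M ≫ k = 𝟙 _ ∧ k ≫ kleisliComparison G adjB adjC M = 𝟙 _ := by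
    intro M
    have hu := adjC.isUniversalArrow_unit ((mapMndOp G).obj M)
    obtain ⟨e, e', h1, h2, h3⟩ := hu.exists_iso (hG M)
    have h4 : kleisliComparison G adjB adjC M = e :=
      hu.hom_ext ((unitAt_comp_kleisliComparison adjB adjC M).trans h3.symm)
    exact ⟨e', by rw [h4, h1], by rw [h4, h2]⟩
  choose k hk hk' using key
  let t : TwoNatTrans ((mapMndOp G).comp KC) (KB.comp G) :=
    { app := fun M => kleisliComparison G adjB adjC M
      naturality := fun f => kleisliComparison_naturality adjB adjC f
      naturality₂ := fun θ => naturality₂_of_heq _ _ (kleisliComparison_naturality₂ adjB adjC θ) }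
  exact ⟨t.toTwoNatIso k hk hk', fun M => rfl⟩

end StandardKleisliObjects

/-! ### Kleisli objects of monoidal objects -/

section Monoidal

variable {D : Type u} [Bicategory.{w, v} D] [Strict D] [FiniteProducts D]
  {K : StrictPseudofunctor (MndOp D) D} (adj : TwoAdjunction K (iota D))
  (hK : PreservesFiniteProducts K)

include adj hK in
/-- The Kleisli object of a monad in `Mon(D)` is that of its underlying monad, with the induced
monoidal structure. -/
theorem admitsKleisli_monoidalObject : AdmitsKleisli (MonoidalObject D) :=
  ⟨_, ⟨IsUniversalArrow.adjunction (R := iota (MonoidalObject D))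
    (obj := fun M => kleisliMonoidal adj hK M (adj.isUniversalArrow_unit (MndOp.und M)))
    (u := fun M => KleisliMonoidal.arrowTo adj hK M (adj.isUniversalArrow_unit (MndOp.und M)))
    (fun M => KleisliMonoidal.isUniversalArrow_arrowTo adj hK M _)⟩⟩

include hK in
/-- Whatever the left `2`-adjoint of `ι` for `Mon(D)`, its Kleisli objects are standard: its unit is
isomorphic to the arrow `arrowTo`, whose underlying arrow is universal. -/
theorem standardKleisli_forget {K' : StrictPseudofunctor (MndOp (MonoidalObject D))
    (MonoidalObject D)} (adj' : TwoAdjunction K' (iota (MonoidalObject D))) :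
    StandardKleisli (forget D) adj' adj := by
  refine standardKleisli_of_universal adj' adj fun M => ?_
  have hu := adj.isUniversalArrow_unit (MndOp.und M)
  obtain ⟨e, e', h1, h2, h3⟩ := (KleisliMonoidal.isUniversalArrow_arrowTo adj hK M hu).exists_iso
    (adj'.isUniversalArrow_unit M)
  rw [← h3]
  have h := hu.comp_iso (e := (forget D).map e) (e' := (forget D).map e')
    (congrArg (forget D).map h1) (congrArg (forget D).map h2)
  rwa [← KleisliMonoidal.under_arrowTo_comp adj hK M hu e] at h

end Monoidal

end TwoCat

theorem mainTheorem1 (D : Type u) [Bicategory.{w, v} D] [Bicategory.Strict D]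
    [TwoCat.FiniteProducts D] (K : StrictPseudofunctor (TwoCat.MndOp D) D)
    (adj : TwoCat.TwoAdjunction K (TwoCat.iota D)) (hK : TwoCat.PreservesFiniteProducts K) :
    TwoCat.AdmitsKleisli (TwoCat.MonoidalObject D) ∧
      ∀ (K' : StrictPseudofunctor (TwoCat.MndOp (TwoCat.MonoidalObject D))
          (TwoCat.MonoidalObject D))
        (adj' : TwoCat.TwoAdjunction K' (TwoCat.iota (TwoCat.MonoidalObject D))),
        TwoCat.StandardKleisli (TwoCat.forget D) adj' adj :=
  ⟨TwoCat.admitsKleisli_monoidalObject adj hK, fun _ adj' =>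
    TwoCat.standardKleisli_forget adj hK adj'⟩
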